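/- Let $\mathbf k=\mathbb F_q$ be a finite field. For graded spaces $V,W$ let $\mathrm{Hom}^n(V,W)$ be the space of homogeneous linear maps of degree $n$; if $V$ carries a complete flag, let $\mathrm{Hom}^n_{<0}(V,V)$ be the space of those $f\in\mathrm{Hom}^n(V,V)$ with $f(F_jV)\subseteq F_{j-1}V$ for all $j\ge 1$. Define $\mathcal H$ as follows. *Objects:* finite-dimensional $\mathbb Z$-graded $\mathbf k$-vector spaces $V$ with a complete flag of graded subspaces $0=F_0V\subset F_1V\subset\dots\subset F_{\dim V}V=V$, $\dim F_iV=i$. The product $V\otimes W$ of objects is $V\oplus W$ with the flag $F_0V\subset\dots\subset F_{\dim V}V=V\subset V\oplus F_1W\subset\dots\subset V\oplus W$. The unit object is $0$. *Morphisms:* $\mathrm{Hom}_{\mathcal H}(V,W)$ is the $\mathbb Q$-vector space with basis the equivalence classes of triples $(d_V,f,d_W)$, where $d_V\in\mathrm{Hom}^1_{<0}(V,V)$ and $d_W\in\mathrm{Hom}^1_{<0}(W,W)$ satisfy $d_V^2=0$, $d_W^2=0$, and $f:(V,d_V)\to(W,d_W)$ is a quasi-isomorphism. Here $(d_V,f,d_W)\sim(d_V',f',d_W')$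 if there are automorphisms $\phi$ of $V$ and $\psi$ of $W$ preserving grading and flag, with $\phi d_V=d_V'\phi$, $\psi d_W=d_W'\psi$, and $\psi f$ chain homotopic to $f'\phi$. *Composition* is the $\mathbb Q$-bilinear map given, for triples $(d_U,f,d_V)$ from $U$ to $V$ and $(d_V',g,d_W)$ from $V$ to $W$, by $$(d_V',g,d_W)\circ(d_U,f,d_V)=\Big(\prod_{i\ge1}|\mathrm{Hom}^{-i}_{<0}(V,V)|^{(-1)^i}\Big)\sum_b (d_U,gbf,d_W),$$ where $b$ runs over all isomorphisms $(V,d_V)\to(V,d_V')$ preserving grading, flag and differential. *Product of morphisms* is the $\mathbb Q$-bilinear map given, for triples $(d_U,f,d_V)$ from $U$ to $V$ and $(d_X,g,d_Y)$ from $X$ to $Y$, by $$(d_U,f,d_V)\otimes(d_X,g,d_Y)=\prod_{i\ge0}\big(|\mathrm{Hom}^{-i}(X,U)|\,|\mathrm{Hom}^{-i}(Y,V)|\,|\mathrm{Hom}^{-i-1}(X,V)|\big)^{(-1)^{i+1}}\sum_\delta\left(\begin{bmatrix}d_U&\delta_{11}\\0&d_X\end{bmatrix},\begin{bmatrix}f&\delta_{12}\\0&g\end{bmatrix},\begin{bmatrix}d_V&\delta_{22}\\0&d_Y\end{bmatrix}\right),$$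 where $\delta$ runs over all $(\delta_{11},\delta_{12},\delta_{22})\in\mathrm{Hom}^1(X,U)\oplus\mathrm{Hom}^0(X,V)\oplus\mathrm{Hom}^1(Y,V)$ with $d_U\delta_{11}+\delta_{11}d_X=0$, $d_V\delta_{22}+\delta_{22}d_Y=0$ and $\delta_{12}d_X+f\delta_{11}=d_V\delta_{12}+\delta_{22}g$. **Proposition.** $\mathcal H$ is a monoidal category. That is: composition and the product of morphisms are well defined on equivalence classes; composition is associative, with identities $$1_V=(q-1)^{-\dim V}\Big(\prod_{i\ge0}|\mathrm{Hom}^{-i}_{<0}(V,V)|^{(-1)^{i+1}}\Big)\sum_{d\in\mathrm{Hom}^1_{<0}(V,V),\,d^2=0}(d,1,d);$$ and $\otimes$ (which is bifunctorial) together with the unit object $0$ and the associator and unitors induced by the canonical isomorphisms $(U\oplus V)\oplus W\cong U\oplus(V\oplus W)$, $0\oplus V\cong V$, $V\oplus0\cong V$ satisfies all axioms of a monoidal category. Here an isomorphism $e:V\to W$ of graded spaces with flag induces the isomorphism $(q-1)^{-\dim V}\big(\prod_{i\ge0}|\mathrm{Hom}^{-i}_{<0}(V,V)|^{(-1)^{i+1}}\big)\sum_{d}(d,e,e\,d\,e^{-1})$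 of $\mathcal H$, the sum being over the same $d$ as in $1_V$, with inverse the morphism induced by $e^{-1}$. -/

import Mathlib

open CategoryTheory

universe u v

/-- A finite-dimensional `ℤ`-graded vector space over `k` with a complete flag of graded subspaces
`0 = F_0 ⊂ F_1 ⊂ ... ⊂ F_n = V`, `n = dim V`, `dim F_i = i`.
The flag is indexed by all natural numbers, with the convention `F_i = V` for `i ≥ dim V`. -/
structure FlagSpace (k : Type u) [Field k] where
  carrier : Type v
  [addCommGroup : AddCommGroup carrier]
  [module : Module k carrier]
  [finite : Module.Finite k carrier]
  /-- the homogeneous components -/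
  deg : ℤ → Submodule k carrier
  isInternal : DirectSum.IsInternal deg
  /-- the complete flag -/
  flag : ℕ → Submodule k carrier
  flag_mono : Monotone flag
  finrank_flag : ∀ i, Module.finrank k (flag i) = min i (Module.finrank k carrier)
  /-- every step of the flag is a graded subspace, that is, the sum of its homogeneous parts -/
  flag_graded : ∀ i, flag i = ⨆ n, flag i ⊓ deg n

attribute [instance] FlagSpace.addCommGroup FlagSpace.module FlagSpace.finite

noncomputable section

namespace FlagSpace

instance {k : Type u} [Field k] : CoeSort (FlagSpace.{u, v} k) (Type v) := ⟨FlagSpace.carrier⟩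

/-- The dimension of the total space. -/
abbrev dim {k : Type u} [Field k] (V : FlagSpace.{u, v} k) : ℕ := Module.finrank k V

theorem flag_zero {k : Type u} [Field k] (V : FlagSpace.{u, v} k) : V.flag 0 = ⊥ := by
  have h := V.finrank_flag 0
  simp only [Nat.zero_min] at h
  exact Submodule.finrank_eq_zero.mp h

theorem flag_top {k : Type u} [Field k] (V : FlagSpace.{u, v} k) {i : ℕ} (hi : V.dim ≤ i) :
    V.flag i = ⊤ := by
  apply Submodule.eq_top_of_finrank_eq
  rw [V.finrank_flag i, min_eq_right hi]

/-- The zero object. -/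
def zero (k : Type u) [Field k] : FlagSpace.{u, v} k where
  carrier := PUnit.{v + 1}
  deg _ := ⊥
  isInternal := by
    rw [DirectSum.isInternal_submodule_iff_iSupIndep_and_iSup_eq_top]
    exact ⟨fun _ => disjoint_bot_left, Subsingleton.elim _ _⟩
  flag _ := ⊥
  flag_mono _ _ _ := le_rfl
  finrank_flag i := by simp [Module.finrank_zero_of_subsingleton]
  flag_graded i := Subsingleton.elim _ _

theorem prod_isInternal {k : Type u} [Field k] (V W : FlagSpace.{u, v} k) :
    DirectSum.IsInternal (fun n => (V.deg n).prod (W.deg n)) := by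
  have hV := (DirectSum.isInternal_submodule_iff_iSupIndep_and_iSup_eq_top _).mp V.isInternal
  have hW := (DirectSum.isInternal_submodule_iff_iSupIndep_and_iSup_eq_top _).mp W.isInternal
  rw [DirectSum.isInternal_submodule_iff_iSupIndep_and_iSup_eq_top]
  constructor
  · intro i
    have hle : (⨆ j, ⨆ (_ : j ≠ i), (V.deg j).prod (W.deg j)) ≤
        (⨆ j, ⨆ (_ : j ≠ i), V.deg j).prod (⨆ j, ⨆ (_ : j ≠ i), W.deg j) :=
      iSup₂_le fun j hj => Submodule.prod_mono (le_iSup₂_of_le j hj le_rfl)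
        (le_iSup₂_of_le j hj le_rfl)
    refine Disjoint.mono_right hle ?_
    rw [Submodule.disjoint_def]
    rintro ⟨x, y⟩ ⟨hx, hy⟩ ⟨hx', hy'⟩
    change x ∈ V.deg i at hx
    change y ∈ W.deg i at hy
    have h1 : x = 0 := Submodule.disjoint_def.mp (hV.1 i) x hx hx'
    have h2 : y = 0 := Submodule.disjoint_def.mp (hW.1 i) y hy hy'
    exact Prod.ext h1 h2
  · rw [eq_top_iff]
    rintro ⟨x, y⟩ -
    have hx : (⊤ : Submodule k V) ≤ Submodule.comap (LinearMap.inl k V W)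
        (⨆ n, (V.deg n).prod (W.deg n)) := by
      rw [← hV.2]
      exact iSup_le fun n a ha => Submodule.mem_comap.mpr
        (Submodule.mem_iSup_of_mem n ⟨ha, zero_mem _⟩)
    have hy : (⊤ : Submodule k W) ≤ Submodule.comap (LinearMap.inr k V W)
        (⨆ n, (V.deg n).prod (W.deg n)) := by
      rw [← hW.2]
      exact iSup_le fun n a ha => Submodule.mem_comap.mpr
        (Submodule.mem_iSup_of_mem n ⟨zero_mem _, ha⟩)
    have hx1 : x ∈ (⊤ : Submodule k V) := trivial
    have hy1 : y ∈ (⊤ : Submodule k W) := trivial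
    have h := add_mem (Submodule.mem_comap.mp (hx hx1)) (Submodule.mem_comap.mp (hy hy1))
    have e : LinearMap.inl k V W x + LinearMap.inr k V W y = (x, y) := by simp
    exact e ▸ h

theorem finrank_submodule_prod {k : Type u} [Field k] (V W : FlagSpace.{u, v} k)
    (A : Submodule k V) (B : Submodule k W) :
    Module.finrank k (A.prod B) = Module.finrank k A + Module.finrank k B := by
  have h : A.prod B = LinearMap.range (A.subtype.prodMap B.subtype) := by
    rw [LinearMap.range_prodMap, Submodule.range_subtype, Submodule.range_subtype]
  rw [h, LinearMap.finrank_range_of_inj, Module.finrank_prod]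
  exact Function.Injective.prodMap A.injective_subtype B.injective_subtype

theorem prod_graded {k : Type u} [Field k] (V W : FlagSpace.{u, v} k) (i j : ℕ) :
    (V.flag i).prod (W.flag j) =
      ⨆ n, (V.flag i).prod (W.flag j) ⊓ (V.deg n).prod (W.deg n) := by
  apply le_antisymm
  · rintro ⟨x, y⟩ ⟨hx, hy⟩
    change x ∈ V.flag i at hx
    change y ∈ W.flag j at hy
    have h1 : V.flag i ≤ Submodule.comap (LinearMap.inl k V W)
        (⨆ n, (V.flag i).prod (W.flag j) ⊓ (V.deg n).prod (W.deg n)) := by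
      conv_lhs => rw [V.flag_graded i]
      exact iSup_le fun n a ha => Submodule.mem_iSup_of_mem n
        ⟨⟨ha.1, zero_mem _⟩, ⟨ha.2, zero_mem _⟩⟩
    have h2 : W.flag j ≤ Submodule.comap (LinearMap.inr k V W)
        (⨆ n, (V.flag i).prod (W.flag j) ⊓ (V.deg n).prod (W.deg n)) := by
      conv_lhs => rw [W.flag_graded j]
      exact iSup_le fun n a ha => Submodule.mem_iSup_of_mem n
        ⟨⟨zero_mem _, ha.1⟩, ⟨zero_mem _, ha.2⟩⟩
    have h := add_mem (Submodule.mem_comap.mp (h1 hx)) (Submodule.mem_comap.mp (h2 hy))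
    have e : LinearMap.inl k V W x + LinearMap.inr k V W y = (x, y) := by simp
    exact e ▸ h
  · exact iSup_le fun n => inf_le_left

/-- The monoidal product of objects: `V ⊕ W` with the flag
`F_0 V ⊂ ... ⊂ F_{dim V} V = V ⊂ V ⊕ F_1 W ⊂ ... ⊂ V ⊕ W`.
With truncated subtraction, the `i`-th step is `F_i V ⊕ 0` for `i ≤ dim V` and
`V ⊕ F_{i - dim V} W` for `i ≥ dim V`. -/
def prod {k : Type u} [Field k] (V W : FlagSpace.{u, v} k) : FlagSpace.{u, v} k where
  carrier := V × W
  deg n := (V.deg n).prod (W.deg n)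
  isInternal := prod_isInternal V W
  flag i := (V.flag i).prod (W.flag (i - V.dim))
  flag_mono i j h := Submodule.prod_mono (V.flag_mono h)
    (W.flag_mono (Nat.sub_le_sub_right h _))
  finrank_flag i := by
    rw [finrank_submodule_prod, V.finrank_flag, W.finrank_flag, Module.finrank_prod]
    simp only [dim]
    omega
  flag_graded i := prod_graded V W i _

theorem dim_prod {k : Type u} [Field k] (V W : FlagSpace.{u, v} k) :
    (V.prod W).dim = V.dim + W.dim :=
  Module.finrank_prod

end FlagSpace

/-- `Hom^n(V, W)`: the homogeneous linear maps of degree `n`, not required to respect flags. -/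
def homDeg {k : Type u} [Field k] (V W : FlagSpace.{u, v} k) (n : ℤ) :
    Submodule k (V →ₗ[k] W) where
  carrier := {f | ∀ i, ∀ x ∈ V.deg i, f x ∈ W.deg (i + n)}
  add_mem' hf hg i x hx := add_mem (hf i x hx) (hg i x hx)
  zero_mem' _ _ _ := zero_mem _
  smul_mem' c _ hf i x hx := Submodule.smul_mem _ c (hf i x hx)

/-- `Hom^n_{<0}(V, V)`: the homogeneous endomorphisms of degree `n` mapping `F_j V` to
`F_{j-1} V` for all `j ≥ 1`. -/
def homLower {k : Type u} [Field k] (V : FlagSpace.{u, v} k) (n : ℤ) :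
    Submodule k (V →ₗ[k] V) where
  carrier := {f | f ∈ homDeg V V n ∧ ∀ j, ∀ x ∈ V.flag (j + 1), f x ∈ V.flag j}
  add_mem' hf hg := ⟨add_mem hf.1 hg.1, fun j x hx => add_mem (hf.2 j x hx) (hg.2 j x hx)⟩
  zero_mem' := ⟨zero_mem _, fun _ _ _ => zero_mem _⟩
  smul_mem' c _ hf := ⟨Submodule.smul_mem _ c hf.1,
    fun j x hx => Submodule.smul_mem _ c (hf.2 j x hx)⟩

/-- A flag-lowering differential of degree `1`. -/
@[ext]
structure FlagDifferential {k : Type u} [Field k] (V : FlagSpace.{u, v} k) where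
  map : V →ₗ[k] V
  mem : map ∈ homLower V 1
  sq : map ∘ₗ map = 0

/-- The cohomology `ker d / im d` (the direct sum of the cohomology spaces of all degrees). -/
abbrev Cohomology {k : Type u} [Field k] {V : FlagSpace.{u, v} k} (d : FlagDifferential V) : Type v :=
  LinearMap.ker d.map ⧸ (LinearMap.range d.map).submoduleOf (LinearMap.ker d.map)

/-- The map induced on cohomology by a chain map. -/
def cohomologyMap {k : Type u} [Field k] {V W : FlagSpace.{u, v} k} (d : FlagDifferential V)
    (d' : FlagDifferential W) (f : V →ₗ[k] W) (hf : f ∘ₗ d.map = d'.map ∘ₗ f) :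
    Cohomology d →ₗ[k] Cohomology d' :=
  Submodule.mapQ _ _
    (f.restrict (p := LinearMap.ker d.map) (q := LinearMap.ker d'.map) (fun x hx => by
      have h := LinearMap.congr_fun hf x
      simp only [LinearMap.comp_apply, LinearMap.mem_ker.mp hx] at h
      exact LinearMap.mem_ker.mpr (h.symm.trans (map_zero f))))
    (by
      rintro ⟨x, hx⟩ ⟨y, hy⟩
      exact ⟨f y, (LinearMap.congr_fun hf y).symm.trans (congrArg f hy)⟩)

/-- `f : (V, d) → (W, d')` is a quasi-isomorphism: a chain map of degree `0` which induces an
isomorphism on cohomology. -/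
structure IsQuasiIso {k : Type u} [Field k] {V W : FlagSpace.{u, v} k} (d : FlagDifferential V)
    (d' : FlagDifferential W) (f : V →ₗ[k] W) : Prop where
  mem_homDeg : f ∈ homDeg V W 0
  comm : f ∘ₗ d.map = d'.map ∘ₗ f
  bijective : Function.Bijective (cohomologyMap d d' f comm)

theorem isQuasiIso_iff {k : Type u} [Field k] {V W : FlagSpace.{u, v} k} (d : FlagDifferential V)
    (d' : FlagDifferential W) (f : V →ₗ[k] W) :
    IsQuasiIso d d' f ↔ f ∈ homDeg V W 0 ∧ (∀ x, f (d.map x) = d'.map (f x)) ∧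
      (∀ x y, d.map x = 0 → f x = d'.map y → ∃ z, x = d.map z) ∧
      (∀ y, d'.map y = 0 → ∃ x z, d.map x = 0 ∧ y = f x + d'.map z) := by
  constructor
  · rintro ⟨h0, hc, hinj, hsurj⟩
    refine ⟨h0, fun x => LinearMap.congr_fun hc x, fun x y hx hy => ?_, fun y hy => ?_⟩
    · have h : cohomologyMap d d' f hc (Submodule.Quotient.mk ⟨x, hx⟩) =
          cohomologyMap d d' f hc 0 := by
        rw [map_zero]
        exact (Submodule.Quotient.mk_eq_zero _).mpr ⟨y, hy.symm⟩
      obtain ⟨z, hz⟩ := (Submodule.Quotient.mk_eq_zero _).mp (hinj h)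
      exact ⟨z, hz.symm⟩
    · obtain ⟨a, ha⟩ := hsurj (Submodule.Quotient.mk ⟨y, hy⟩)
      obtain ⟨⟨x, hx⟩, rfl⟩ := Submodule.Quotient.mk_surjective _ a
      obtain ⟨z, hz⟩ := (Submodule.Quotient.eq _).mp ha.symm
      refine ⟨x, z, hx, ?_⟩
      have hz' : d'.map z = y - f x := hz
      rw [hz']; abel
  · rintro ⟨h0, hc, hinj, hsurj⟩
    refine ⟨h0, LinearMap.ext hc, ?_, ?_⟩
    · rw [injective_iff_map_eq_zero]
      intro a ha
      obtain ⟨⟨x, hx⟩, rfl⟩ := Submodule.Quotient.mk_surjective _ a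
      obtain ⟨y, hy⟩ := (Submodule.Quotient.mk_eq_zero _).mp ha
      obtain ⟨z, hz⟩ := hinj x y hx hy.symm
      exact (Submodule.Quotient.mk_eq_zero _).mpr ⟨z, hz.symm⟩
    · intro b
      obtain ⟨⟨y, hy⟩, rfl⟩ := Submodule.Quotient.mk_surjective _ b
      obtain ⟨x, z, hx, hz⟩ := hsurj y hy
      refine ⟨Submodule.Quotient.mk ⟨x, hx⟩, Eq.symm ?_⟩
      refine (Submodule.Quotient.eq _).mpr ⟨z, ?_⟩
      change d'.map z = y - f x
      rw [hz]; abel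

theorem IsQuasiIso.comp {k : Type u} [Field k] {U V W : FlagSpace.{u, v} k}
    {d : FlagDifferential U} {d' : FlagDifferential V} {d'' : FlagDifferential W}
    {f : U →ₗ[k] V} {g : V →ₗ[k] W} (hg : IsQuasiIso d' d'' g) (hf : IsQuasiIso d d' f) :
    IsQuasiIso d d'' (g ∘ₗ f) := by
  rw [isQuasiIso_iff] at hf hg ⊢
  obtain ⟨f0, fc, fi, fs⟩ := hf
  obtain ⟨g0, gc, gi, gs⟩ := hg
  refine ⟨fun i x hx => ?_, fun x => ?_, fun x y hx hy => ?_, fun y hy => ?_⟩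
  · have h := g0 _ _ (f0 i x hx)
    simpa using h
  · simp [fc, gc]
  · obtain ⟨z, hz⟩ := gi (f x) y (by rw [← fc, hx, map_zero]) hy
    exact fi x z hx hz
  · obtain ⟨x, z, hx, rfl⟩ := gs y hy
    obtain ⟨w, t, hw, rfl⟩ := fs x hx
    exact ⟨w, g t + z, hw, by simp [gc, add_assoc]⟩

/-- Isomorphisms of graded vector spaces with complete flag. -/
@[ext]
structure FlagIso {k : Type u} [Field k] (V W : FlagSpace.{u, v} k) where
  equiv : V ≃ₗ[k] W
  deg_iff : ∀ n x, equiv x ∈ W.deg n ↔ x ∈ V.deg n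
  flag_iff : ∀ i x, equiv x ∈ W.flag i ↔ x ∈ V.flag i

namespace FlagIso

/-- The underlying linear map. -/
abbrev map {k : Type u} [Field k] {V W : FlagSpace.{u, v} k} (e : FlagIso V W) : V →ₗ[k] W :=
  e.equiv.toLinearMap

/-- The identity. -/
def refl {k : Type u} [Field k] (V : FlagSpace.{u, v} k) : FlagIso V V where
  equiv := LinearEquiv.refl k V
  deg_iff _ _ := Iff.rfl
  flag_iff _ _ := Iff.rfl

/-- The inverse. -/
def symm {k : Type u} [Field k] {V W : FlagSpace.{u, v} k} (e : FlagIso V W) : FlagIso W V where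
  equiv := e.equiv.symm
  deg_iff n x := by rw [← e.deg_iff, LinearEquiv.apply_symm_apply]
  flag_iff n x := by rw [← e.flag_iff, LinearEquiv.apply_symm_apply]

/-- The composite. -/
def trans {k : Type u} [Field k] {U V W : FlagSpace.{u, v} k} (e : FlagIso U V)
    (e' : FlagIso V W) : FlagIso U W where
  equiv := e.equiv.trans e'.equiv
  deg_iff n x := by rw [LinearEquiv.trans_apply, e'.deg_iff, e.deg_iff]
  flag_iff n x := by rw [LinearEquiv.trans_apply, e'.flag_iff, e.flag_iff]

/-- `e` is compatible with the differentials `d` and `d'`. -/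
def Intertwines {k : Type u} [Field k] {V W : FlagSpace.{u, v} k} (e : FlagIso V W)
    (d : FlagDifferential V) (d' : FlagDifferential W) : Prop :=
  e.map ∘ₗ d.map = d'.map ∘ₗ e.map

theorem Intertwines.symm {k : Type u} [Field k] {V W : FlagSpace.{u, v} k} {e : FlagIso V W}
    {d : FlagDifferential V} {d' : FlagDifferential W} (h : e.Intertwines d d') :
    e.symm.Intertwines d' d := by
  ext x
  have h1 := LinearMap.congr_fun h (e.equiv.symm x)
  simp only [LinearMap.comp_apply, LinearEquiv.coe_coe, LinearEquiv.apply_symm_apply] at h1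
  simp only [LinearMap.comp_apply, LinearEquiv.coe_coe, FlagIso.symm, ← h1,
    LinearEquiv.symm_apply_apply]

theorem Intertwines.trans {k : Type u} [Field k] {U V W : FlagSpace.{u, v} k}
    {e : FlagIso U V} {e' : FlagIso V W} {d : FlagDifferential U} {d' : FlagDifferential V}
    {d'' : FlagDifferential W} (h : e.Intertwines d d') (h1 : e'.Intertwines d' d'') :
    (e.trans e').Intertwines d d'' := by
  ext x
  have h2 := LinearMap.congr_fun h x
  have h3 := LinearMap.congr_fun h1 (e.equiv x)
  simp only [LinearMap.comp_apply, LinearEquiv.coe_coe] at h2 h3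
  simp only [LinearMap.comp_apply, LinearEquiv.coe_coe, FlagIso.trans, LinearEquiv.trans_apply,
    h2, h3]

theorem Intertwines.isQuasiIso {k : Type u} [Field k] {V W : FlagSpace.{u, v} k}
    {e : FlagIso V W} {d : FlagDifferential V} {d' : FlagDifferential W} (h : e.Intertwines d d') :
    IsQuasiIso d d' e.map := by
  have hs : ∀ y, d.map (e.equiv.symm y) = e.equiv.symm (d'.map y) :=
    fun y => (LinearMap.congr_fun h.symm y).symm
  rw [isQuasiIso_iff]
  refine ⟨fun i x hx => ?_, fun x => LinearMap.congr_fun h x, fun x y _ hy => ?_,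
    fun y hy => ?_⟩
  · rw [add_zero]; exact (e.deg_iff i x).mpr hx
  · refine ⟨e.equiv.symm y, ?_⟩
    rw [hs, ← hy]
    exact (e.equiv.symm_apply_apply x).symm
  · refine ⟨e.equiv.symm y, 0, ?_, ?_⟩
    · rw [hs, hy, map_zero]
    · simp

/-- The canonical isomorphism `(U ⊕ V) ⊕ W ≅ U ⊕ (V ⊕ W)`. -/
def assoc {k : Type u} [Field k] (U V W : FlagSpace.{u, v} k) :
    FlagIso ((U.prod V).prod W) (U.prod (V.prod W)) where
  equiv := LinearEquiv.prodAssoc k U V W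
  deg_iff _ _ := and_assoc.symm
  flag_iff i x := by
    change (x.1.1 ∈ U.flag i ∧ x.1.2 ∈ V.flag (i - U.dim) ∧ x.2 ∈ W.flag (i - U.dim - V.dim)) ↔
      (x.1.1 ∈ U.flag i ∧ x.1.2 ∈ V.flag (i - U.dim)) ∧ x.2 ∈ W.flag (i - (U.prod V).dim)
    rw [FlagSpace.dim_prod, Nat.sub_sub, and_assoc]

/-- The canonical isomorphism `0 ⊕ V ≅ V`. -/
def leftUnit {k : Type u} [Field k] (V : FlagSpace.{u, v} k) :
    FlagIso ((FlagSpace.zero k).prod V) V where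
  equiv := { LinearMap.snd k (FlagSpace.zero.{u, v} k) V with
    invFun := fun x => (PUnit.unit, x)
    left_inv := fun _ => rfl
    right_inv := fun _ => rfl }
  deg_iff n x := ⟨fun h => ⟨rfl, h⟩, fun h => h.2⟩
  flag_iff i x := by
    change x.2 ∈ V.flag i ↔ (x.1 ∈ (⊥ : Submodule k (FlagSpace.zero.{u, v} k))) ∧
      x.2 ∈ V.flag (i - Module.finrank k PUnit.{v + 1})
    rw [Module.finrank_zero_of_subsingleton, Nat.sub_zero]
    exact ⟨fun h => ⟨rfl, h⟩, fun h => h.2⟩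

/-- The canonical isomorphism `V ⊕ 0 ≅ V`. -/
def rightUnit {k : Type u} [Field k] (V : FlagSpace.{u, v} k) :
    FlagIso (V.prod (FlagSpace.zero k)) V where
  equiv := { LinearMap.fst k V (FlagSpace.zero.{u, v} k) with
    invFun := fun x => (x, PUnit.unit)
    left_inv := fun _ => rfl
    right_inv := fun _ => rfl }
  deg_iff _ _ := ⟨fun h => ⟨h, rfl⟩, fun h => h.1⟩
  flag_iff _ _ := ⟨fun h => ⟨h, rfl⟩, fun h => h.1⟩

end FlagIso

/-- A triple `(d_V, f, d_W)`: flag-lowering differentials on `V` and `W` and a quasi-isomorphism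
`f : (V, d_V) → (W, d_W)`. -/
@[ext]
structure Triple {k : Type u} [Field k] (V W : FlagSpace.{u, v} k) where
  dSrc : FlagDifferential V
  map : V →ₗ[k] W
  dTgt : FlagDifferential W
  isQuasiIso : IsQuasiIso dSrc dTgt map

/-- Equivalence of triples: there are automorphisms `φ`, `ψ` of the graded spaces with flag `V`, `W`
which are compatible with the differentials, such that `ψ ∘ f` and `f' ∘ φ` are chain homotopic
(through a homotopy which need not respect the flags). -/
def TripleEquiv {k : Type u} [Field k] {V W : FlagSpace.{u, v} k} (t t' : Triple V W) : Prop :=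
  ∃ (φ : FlagIso V V) (ψ : FlagIso W W),
    φ.Intertwines t.dSrc t'.dSrc ∧ ψ.Intertwines t.dTgt t'.dTgt ∧
    ∃ h ∈ homDeg V W (-1),
      ψ.map ∘ₗ t.map - t'.map ∘ₗ φ.map = t'.dTgt.map ∘ₗ h + h ∘ₗ t.dSrc.map

theorem tripleEquiv_equivalence {k : Type u} [Field k] (V W : FlagSpace.{u, v} k) :
    Equivalence (TripleEquiv (V := V) (W := W)) := by
  refine ⟨fun t => ?_, ?_, ?_⟩
  · exact ⟨FlagIso.refl V, FlagIso.refl W, rfl, rfl, 0, zero_mem _, by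
      ext x; simp [FlagIso.refl]⟩
  · rintro t t' ⟨φ, ψ, hφ, hψ, h, hh, e⟩
    refine ⟨φ.symm, ψ.symm, hφ.symm, hψ.symm, -(ψ.symm.map ∘ₗ h ∘ₗ φ.symm.map),
      neg_mem fun i x hx => ?_, ?_⟩
    · exact (ψ.symm.deg_iff _ _).mpr (hh i _ ((φ.symm.deg_iff i x).mpr hx))
    · ext x
      have h1 := LinearMap.congr_fun e (φ.equiv.symm x)
      have h2 := LinearMap.congr_fun hψ.symm (h (φ.equiv.symm x))
      have h3 := LinearMap.congr_fun hφ.symm x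
      simp only [LinearMap.comp_apply, LinearMap.sub_apply, LinearMap.add_apply,
        LinearEquiv.coe_coe, LinearEquiv.apply_symm_apply, FlagIso.symm] at h1 h2 h3
      have h4 := congrArg ψ.equiv.symm h1
      simp only [map_sub, map_add, LinearEquiv.symm_apply_apply] at h4
      simp only [LinearMap.comp_apply, LinearMap.sub_apply, LinearMap.add_apply,
        LinearMap.neg_apply, LinearEquiv.coe_coe, FlagIso.symm, map_neg, h3, ← h2]
      rw [← neg_sub, h4]
      abel
  · rintro t t' t'' ⟨φ, ψ, hφ, hψ, h, hh, e⟩ ⟨φ', ψ', hφ', hψ', h', hh', e'⟩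
    refine ⟨φ.trans φ', ψ.trans ψ', hφ.trans hφ', hψ.trans hψ',
      ψ'.map ∘ₗ h + h' ∘ₗ φ.map, add_mem (fun i x hx => ?_) (fun i x hx => ?_), ?_⟩
    · exact (ψ'.deg_iff _ _).mpr (hh i x hx)
    · exact hh' i _ ((φ.deg_iff i x).mpr hx)
    · ext x
      have h1 := congrArg ψ'.equiv (LinearMap.congr_fun e x)
      have h2 := LinearMap.congr_fun e' (φ.equiv x)
      have h3 := LinearMap.congr_fun hψ' (h x)
      have h4 := LinearMap.congr_fun hφ x
      simp only [LinearMap.comp_apply, LinearMap.sub_apply, LinearMap.add_apply,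
        LinearEquiv.coe_coe, map_sub, map_add] at h1 h2 h3 h4
      simp only [LinearMap.comp_apply, LinearMap.sub_apply, LinearMap.add_apply,
        LinearEquiv.coe_coe, FlagIso.trans, LinearEquiv.trans_apply, map_add, h4, ← h3]
      rw [← sub_add_sub_cancel, h1, h2]
      abel

instance tripleSetoid {k : Type u} [Field k] (V W : FlagSpace.{u, v} k) :
    Setoid (Triple V W) :=
  ⟨TripleEquiv, tripleEquiv_equivalence V W⟩

/-- The set `B(V, W)` of equivalence classes of triples. -/
abbrev TripleClass {k : Type u} [Field k] (V W : FlagSpace.{u, v} k) : Type v :=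
  Quotient (tripleSetoid V W)

/-- `Hom(V, W)`: the `ℚ`-vector space with basis `B(V, W)`. -/
abbrev HHom {k : Type u} [Field k] (V W : FlagSpace.{u, v} k) : Type v :=
  TripleClass V W →₀ ℚ

/-- The basis element of `Hom(V, W)` represented by a triple. -/
def Triple.basis {k : Type u} [Field k] {V W : FlagSpace.{u, v} k} (t : Triple V W) :
    HHom V W :=
  Finsupp.single (Quotient.mk (tripleSetoid V W) t) 1

/-- The triple `(d_U, g ∘ b ∘ f, d_W)`, where `b : (V, d_V) → (V, d_V')` is an isomorphism of
complexes with complete flag. -/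
def Triple.compAlong {k : Type u} [Field k] {U V W : FlagSpace.{u, v} k} (t : Triple U V)
    (s : Triple V W) (b : {b : FlagIso V V // b.Intertwines t.dTgt s.dSrc}) : Triple U W where
  dSrc := t.dSrc
  map := s.map ∘ₗ b.1.map ∘ₗ t.map
  dTgt := s.dTgt
  isQuasiIso := s.isQuasiIso.comp (b.2.isQuasiIso.comp t.isQuasiIso)

/-- The composite `s ∘ t` of two triples:
`(∏_{i ≥ 1} |Hom^{-i}_{<0}(V, V)|^{(-1)^i}) ∑_b (d_U, g b f, d_W)`. -/
def Triple.comp {k : Type u} [Field k] {U V W : FlagSpace.{u, v} k} (t : Triple U V)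
    (s : Triple V W) : HHom U W :=
  (∏ᶠ i : ℕ, (Nat.card (homLower V (-((i : ℤ) + 1))) : ℚ) ^ ((-1 : ℤ) ^ (i + 1))) •
    ∑ᶠ b : {b : FlagIso V V // b.Intertwines t.dTgt s.dSrc}, (t.compAlong s b).basis

/-- The upper triangular block matrix with diagonal `a`, `c` and off-diagonal entry `b`. -/
def blockMap {k : Type u} [Field k] {U V X Y : FlagSpace.{u, v} k} (a : U →ₗ[k] V)
    (b : X →ₗ[k] V) (c : X →ₗ[k] Y) : (U.prod X) →ₗ[k] (V.prod Y) :=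
  LinearMap.prod (a ∘ₗ LinearMap.fst k U X + b ∘ₗ LinearMap.snd k U X)
    (c ∘ₗ LinearMap.snd k U X)

theorem blockMap_apply {k : Type u} [Field k] {U V X Y : FlagSpace.{u, v} k} (a : U →ₗ[k] V)
    (b : X →ₗ[k] V) (c : X →ₗ[k] Y) (p : U × X) :
    blockMap a b c p = (a p.1 + b p.2, c p.2) := rfl

theorem blockMap_mem_homDeg {k : Type u} [Field k] {U V X Y : FlagSpace.{u, v} k} {n : ℤ}
    {a : U →ₗ[k] V} {b : X →ₗ[k] V} {c : X →ₗ[k] Y} (ha : a ∈ homDeg U V n)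
    (hb : b ∈ homDeg X V n) (hc : c ∈ homDeg X Y n) :
    blockMap a b c ∈ homDeg (U.prod X) (V.prod Y) n :=
  fun i _ hx => ⟨add_mem (ha i _ hx.1) (hb i _ hx.2), hc i _ hx.2⟩

/-- The differential on `U ⊕ X` with diagonal entries `d_U`, `d_X` and off-diagonal entry
`δ ∈ Hom^1(X, U)` satisfying `d_U δ + δ d_X = 0`. -/
def blockDifferential {k : Type u} [Field k] {U X : FlagSpace.{u, v} k} (dU : FlagDifferential U)
    (dX : FlagDifferential X) (δ : X →ₗ[k] U) (hδ : δ ∈ homDeg X U 1)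
    (h : dU.map ∘ₗ δ + δ ∘ₗ dX.map = 0) : FlagDifferential (U.prod X) where
  map := blockMap dU.map δ dX.map
  mem := by
    refine ⟨blockMap_mem_homDeg dU.mem.1 hδ dX.mem.1, ?_⟩
    rintro j ⟨x, y⟩ ⟨hx, hy⟩
    change x ∈ U.flag (j + 1) at hx
    change y ∈ X.flag (j + 1 - U.dim) at hy
    change dU.map x + δ y ∈ U.flag j ∧ dX.map y ∈ X.flag (j - U.dim)
    rcases le_or_gt U.dim j with hj | hj
    · refine ⟨?_, dX.mem.2 _ _ ?_⟩
      · rw [U.flag_top hj]; exact Submodule.mem_top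
      · rwa [← Nat.sub_add_comm hj]
    · have h0 : j + 1 - U.dim = 0 := Nat.sub_eq_zero_of_le hj
      rw [h0, X.flag_zero, Submodule.mem_bot] at hy
      subst hy
      simp only [map_zero, add_zero]
      exact ⟨dU.mem.2 j x hx, zero_mem _⟩
  sq := by
    refine LinearMap.ext fun p => ?_
    have h1 := LinearMap.congr_fun dU.sq p.1
    have h2 := LinearMap.congr_fun dX.sq p.2
    have h3 := LinearMap.congr_fun h p.2
    simp only [LinearMap.comp_apply, LinearMap.add_apply, LinearMap.zero_apply] at h1 h2 h3
    refine Prod.ext ?_ h2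
    change dU.map (dU.map p.1 + δ p.2) + δ (dX.map p.2) = 0
    rw [map_add, h1, zero_add, h3]

/-- The index set of the monoidal product of two triples: all
`(δ₁₁, δ₁₂, δ₂₂) ∈ Hom^1(X, U) ⊕ Hom^0(X, V) ⊕ Hom^1(Y, V)` with `d_U δ₁₁ + δ₁₁ d_X = 0`,
`d_V δ₂₂ + δ₂₂ d_Y = 0` and `δ₁₂ d_X + f δ₁₁ = d_V δ₁₂ + δ₂₂ g`. -/
@[ext]
structure Extension {k : Type u} [Field k] {U V X Y : FlagSpace.{u, v} k} (t : Triple U V)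
    (s : Triple X Y) where
  δ₁₁ : X →ₗ[k] U
  δ₁₂ : X →ₗ[k] V
  δ₂₂ : Y →ₗ[k] V
  mem₁₁ : δ₁₁ ∈ homDeg X U 1
  mem₁₂ : δ₁₂ ∈ homDeg X V 0
  mem₂₂ : δ₂₂ ∈ homDeg Y V 1
  eq₁₁ : t.dSrc.map ∘ₗ δ₁₁ + δ₁₁ ∘ₗ s.dSrc.map = 0
  eq₂₂ : t.dTgt.map ∘ₗ δ₂₂ + δ₂₂ ∘ₗ s.dTgt.map = 0
  eq₁₂ : δ₁₂ ∘ₗ s.dSrc.map + t.map ∘ₗ δ₁₁ = t.dTgt.map ∘ₗ δ₁₂ + δ₂₂ ∘ₗ s.map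

/-- The triple of upper triangular block matrices determined by `δ`. -/
def Extension.triple {k : Type u} [Field k] {U V X Y : FlagSpace.{u, v} k} {t : Triple U V}
    {s : Triple X Y} (δ : Extension t s) : Triple (U.prod X) (V.prod Y) where
  dSrc := blockDifferential t.dSrc s.dSrc δ.δ₁₁ δ.mem₁₁ δ.eq₁₁
  map := blockMap t.map δ.δ₁₂ s.map
  dTgt := blockDifferential t.dTgt s.dTgt δ.δ₂₂ δ.mem₂₂ δ.eq₂₂
  isQuasiIso := by
    obtain ⟨f0, fc, fi, fs⟩ := (isQuasiIso_iff _ _ _).mp t.isQuasiIso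
    obtain ⟨g0, gc, gi, gs⟩ := (isQuasiIso_iff _ _ _).mp s.isQuasiIso
    have e11 : ∀ x, t.dSrc.map (δ.δ₁₁ x) + δ.δ₁₁ (s.dSrc.map x) = 0 :=
      fun x => LinearMap.congr_fun δ.eq₁₁ x
    have e22 : ∀ x, t.dTgt.map (δ.δ₂₂ x) + δ.δ₂₂ (s.dTgt.map x) = 0 :=
      fun x => LinearMap.congr_fun δ.eq₂₂ x
    have e12 : ∀ x, δ.δ₁₂ (s.dSrc.map x) + t.map (δ.δ₁₁ x) =
        t.dTgt.map (δ.δ₁₂ x) + δ.δ₂₂ (s.map x) := fun x => LinearMap.congr_fun δ.eq₁₂ x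
    rw [isQuasiIso_iff]
    refine ⟨blockMap_mem_homDeg f0 δ.mem₁₂ g0, ?_, ?_, ?_⟩
    · rintro ⟨x, y⟩
      refine Prod.ext ?_ (gc y)
      change t.map (t.dSrc.map x + δ.δ₁₁ y) + δ.δ₁₂ (s.dSrc.map y) =
        t.dTgt.map (t.map x + δ.δ₁₂ y) + δ.δ₂₂ (s.map y)
      rw [map_add, map_add, fc, add_assoc, add_assoc, ← e12, add_comm (t.map _)]
    · rintro ⟨x, y⟩ ⟨v, w⟩ h1 h2
      have h11 : t.dSrc.map x + δ.δ₁₁ y = 0 := congrArg Prod.fst h1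
      have h12 : s.dSrc.map y = 0 := congrArg Prod.snd h1
      have h21 : t.map x + δ.δ₁₂ y = t.dTgt.map v + δ.δ₂₂ w := congrArg Prod.fst h2
      have h22 : s.map y = s.dTgt.map w := congrArg Prod.snd h2
      obtain ⟨y', rfl⟩ := gi y w h12 h22
      have c1 : s.dTgt.map (w - s.map y') = 0 := by rw [map_sub, ← h22, gc, sub_self]
      obtain ⟨a, b, ha, hb⟩ := gs _ c1
      have hw : w = s.map (y' + a) + s.dTgt.map b := by
        rw [map_add, add_assoc, ← hb]; abel
      have hy' : s.dSrc.map (y' + a) = s.dSrc.map y' := by rw [map_add, ha, add_zero]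
      rw [← hy'] at h11 h21 ⊢
      generalize y' + a = z at *
      have k1 : t.dSrc.map (x - δ.δ₁₁ z) = 0 := by
        rw [map_sub, eq_neg_of_add_eq_zero_left (e11 z), sub_neg_eq_add, h11]
      have k2 : t.map (x - δ.δ₁₁ z) = t.dTgt.map (v - δ.δ₁₂ z - δ.δ₂₂ b) := by
        have i1 := e12 z
        have i2 := e22 b
        rw [hw, map_add] at h21
        rw [map_sub, map_sub, map_sub, eq_neg_of_add_eq_zero_left i2]
        have j1 : t.map x = t.dTgt.map v + (δ.δ₂₂ (s.map z) + δ.δ₂₂ (s.dTgt.map b)) -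
            δ.δ₁₂ (s.dSrc.map z) := eq_sub_of_add_eq h21
        have j2 : t.map (δ.δ₁₁ z) = t.dTgt.map (δ.δ₁₂ z) + δ.δ₂₂ (s.map z) -
            δ.δ₁₂ (s.dSrc.map z) := by rw [← i1]; abel
        rw [j1, j2]; abel
      obtain ⟨r, hr⟩ := fi _ _ k1 k2
      refine ⟨(r, z), Prod.ext ?_ rfl⟩
      change x = t.dSrc.map r + δ.δ₁₁ z
      rw [← hr]; abel
    · rintro ⟨v, w⟩ h1
      have h11 : t.dTgt.map v + δ.δ₂₂ w = 0 := congrArg Prod.fst h1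
      have h12 : s.dTgt.map w = 0 := congrArg Prod.snd h1
      obtain ⟨x, w', hx, rfl⟩ := gs w h12
      have i1 := e12 x
      rw [hx, map_zero, zero_add] at i1
      have i2 := e22 w'
      rw [map_add] at h11
      have k1 : t.map (δ.δ₁₁ x) = t.dTgt.map (δ.δ₁₂ x - v + δ.δ₂₂ w') := by
        rw [map_add, map_sub, eq_neg_of_add_eq_zero_left i2, i1,
          eq_neg_of_add_eq_zero_left h11]
        abel
      have k0 : t.dSrc.map (δ.δ₁₁ x) = 0 := by
        have := e11 x
        rwa [hx, map_zero, add_zero] at this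
      obtain ⟨r, hr⟩ := fi _ _ k0 k1
      have k2 : t.dTgt.map (v - δ.δ₂₂ w' - δ.δ₁₂ x + t.map r) = 0 := by
        rw [map_add, ← fc, ← hr, k1, ← map_add]
        have : v - δ.δ₂₂ w' - δ.δ₁₂ x + (δ.δ₁₂ x - v + δ.δ₂₂ w') = 0 := by abel
        rw [this, map_zero]
      obtain ⟨a, b, ha, hb⟩ := fs _ k2
      refine ⟨(a - r, x), (b, w'), Prod.ext ?_ hx, Prod.ext ?_ rfl⟩
      · change t.dSrc.map (a - r) + δ.δ₁₁ x = 0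
        rw [map_sub, ha, ← hr]; abel
      · change v = t.map (a - r) + δ.δ₁₂ x + (t.dTgt.map b + δ.δ₂₂ w')
        have : v = t.map a + t.dTgt.map b + δ.δ₂₂ w' + δ.δ₁₂ x - t.map r := by
          rw [← hb]; abel
        rw [this, map_sub]; abel

/-- The monoidal product `t ⊗ s` of two triples. -/
def Triple.tensor {k : Type u} [Field k] {U V X Y : FlagSpace.{u, v} k} (t : Triple U V)
    (s : Triple X Y) : HHom (U.prod X) (V.prod Y) :=
  (∏ᶠ i : ℕ, ((Nat.card (homDeg X U (-(i : ℤ))) : ℚ) * Nat.card (homDeg Y V (-(i : ℤ))) *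
      Nat.card (homDeg X V (-(i : ℤ) - 1))) ^ ((-1 : ℤ) ^ (i + 1))) •
    ∑ᶠ δ : Extension t s, δ.triple.basis

/-- The constant `(q - 1)^{-dim V} ∏_{i ≥ 0} |Hom^{-i}_{<0}(V, V)|^{(-1)^{i+1}}`. -/
def idCoeff {k : Type u} [Field k] (V : FlagSpace.{u, v} k) : ℚ :=
  ((Nat.card k : ℚ) - 1) ^ (-(V.dim : ℤ)) *
    ∏ᶠ i : ℕ, (Nat.card (homLower V (-(i : ℤ))) : ℚ) ^ ((-1 : ℤ) ^ (i + 1))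

/-- The triple `(d, 1, d)`. -/
def idTriple {k : Type u} [Field k] {V : FlagSpace.{u, v} k} (d : FlagDifferential V) :
    Triple V V where
  dSrc := d
  map := LinearMap.id
  dTgt := d
  isQuasiIso := FlagIso.Intertwines.isQuasiIso (e := FlagIso.refl V) rfl

/-- The identity `1_V = (q - 1)^{-dim V} (∏_{i ≥ 0} |Hom^{-i}_{<0}(V, V)|^{(-1)^{i+1}}) ∑_d (d, 1, d)`,
the sum being over all flag-lowering differentials `d` on `V`. -/
def hId {k : Type u} [Field k] (V : FlagSpace.{u, v} k) : HHom V V :=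
  idCoeff V • ∑ᶠ d : FlagDifferential V, (idTriple d).basis

/-- The differential `e d e⁻¹` on `W` obtained from `d` by transport along `e : V ≅ W`. -/
def FlagIso.transport {k : Type u} [Field k] {V W : FlagSpace.{u, v} k} (e : FlagIso V W)
    (d : FlagDifferential V) : FlagDifferential W where
  map := e.map ∘ₗ d.map ∘ₗ e.symm.map
  mem := ⟨fun i x hx => (e.deg_iff _ _).mpr (d.mem.1 i _ ((e.symm.deg_iff i x).mpr hx)),
    fun j x hx => (e.flag_iff _ _).mpr (d.mem.2 j _ ((e.symm.flag_iff _ x).mpr hx))⟩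
  sq := by
    ext x
    have h := LinearMap.congr_fun d.sq (e.equiv.symm x)
    simp only [LinearMap.comp_apply, LinearMap.zero_apply] at h
    simp [FlagIso.symm, h]

/-- The triple `(d, e, e d e⁻¹)`. -/
def FlagIso.triple {k : Type u} [Field k] {V W : FlagSpace.{u, v} k} (e : FlagIso V W)
    (d : FlagDifferential V) : Triple V W where
  dSrc := d
  map := e.map
  dTgt := e.transport d
  isQuasiIso := FlagIso.Intertwines.isQuasiIso (by
    ext x
    simp [FlagIso.transport, FlagIso.symm])

/-- The morphism `V → W` induced by an isomorphism `e : V ≅ W` of graded spaces with flag: it is the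
identity formula, transported along `e` in the target. -/
def FlagIso.hom {k : Type u} [Field k] {V W : FlagSpace.{u, v} k} (e : FlagIso V W) : HHom V W :=
  idCoeff V • ∑ᶠ d : FlagDifferential V, (e.triple d).basis

/-- A `ℚ`-bilinear composition law (in diagrammatic order). -/
abbrev CompLaw (k : Type u) [Field k] : Type (max u (v + 1)) :=
  ∀ U V W : FlagSpace.{u, v} k, HHom U V →ₗ[ℚ] HHom V W →ₗ[ℚ] HHom U W

/-- A `ℚ`-bilinear product of morphisms, over the monoidal product of objects. -/
abbrev TensorLaw (k : Type u) [Field k] : Type (max u (v + 1)) :=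
  ∀ U V X Y : FlagSpace.{u, v} k, HHom U V →ₗ[ℚ] HHom X Y →ₗ[ℚ] HHom (U.prod X) (V.prod Y)

/-- Composition is unital, with the identities `hId V`, and associative. -/
structure CategoryLaws {k : Type u} [Field k] (comp : CompLaw.{u, v} k) : Prop where
  id_comp : ∀ (U V : FlagSpace.{u, v} k) (a : HHom U V), comp U U V (hId U) a = a
  comp_id : ∀ (U V : FlagSpace.{u, v} k) (a : HHom U V), comp U V V a (hId V) = a
  assoc : ∀ (U V W X : FlagSpace.{u, v} k) (a : HHom U V) (b : HHom V W) (c : HHom W X),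
    comp U W X (comp U V W a b) c = comp U V X a (comp V W X b c)

/-- Mutually inverse isomorphisms of graded spaces with flag induce mutually inverse morphisms. -/
def IsoLaws {k : Type u} [Field k] (comp : CompLaw.{u, v} k) : Prop :=
  ∀ (V W : FlagSpace.{u, v} k) (e : FlagIso V W), comp V W V e.hom e.symm.hom = hId V

/-- The category with morphism spaces `HHom`, identities `hId` and composition `comp`. -/
abbrev hCategory {k : Type u} [Field k] (comp : CompLaw.{u, v} k) (hc : CategoryLaws comp) :
    Category.{v} (FlagSpace.{u, v} k) where
  Hom := HHom
  id := hId
  comp := fun {U V W} a b => comp U V W a b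
  id_comp := fun {U V} a => hc.id_comp U V a
  comp_id := fun {U V} a => hc.comp_id U V a
  assoc := fun {U V W X} a b c => hc.assoc U V W X a b c

/-- The isomorphism of `hCategory` induced by an isomorphism of graded spaces with flag. -/
abbrev hIso {k : Type u} [Field k] (comp : CompLaw.{u, v} k) (hc : CategoryLaws comp)
    (hi : IsoLaws comp) {V W : FlagSpace.{u, v} k} (e : FlagIso V W) :
    @Iso _ (hCategory comp hc) V W :=
  letI := hCategory comp hc
  { hom := e.hom
    inv := e.symm.hom
    hom_inv_id := hi V W e
    inv_hom_id := hi W V e.symm }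

/-- The monoidal data on `hCategory`: the product of objects is `FlagSpace.prod`, the product of
morphisms is `tensor`, the unit is the zero space, and the associator and unitors are induced by the
canonical isomorphisms of direct sums. -/
abbrev hMonoidalStruct {k : Type u} [Field k] (comp : CompLaw.{u, v} k)
    (tensor : TensorLaw.{u, v} k) (hc : CategoryLaws comp) (hi : IsoLaws comp) :
    @MonoidalCategoryStruct (FlagSpace.{u, v} k) (hCategory comp hc) :=
  letI := hCategory comp hc
  { tensorObj := FlagSpace.prod
    whiskerLeft := fun X {Y Z} b => tensor X X Y Z (hId X) b
    whiskerRight := fun {X Y} a Z => tensor X Y Z Z a (hId Z)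
    tensorHom := fun {X X' Y Y'} a b => tensor X X' Y Y' a b
    tensorUnit := FlagSpace.zero k
    associator := fun U V W => hIso comp hc hi (FlagIso.assoc U V W)
    leftUnitor := fun V => hIso comp hc hi (FlagIso.leftUnit V)
    rightUnitor := fun V => hIso comp hc hi (FlagIso.rightUnit V) }

end

/-!
Identities between morphisms are proved by reindexing finite sums of triples and comparing the
constants in front of them. The constants are controlled by two alternating products: for graded
spaces `A`, `B` the number `euler A B = ∏_{i ≥ 0} |Hom^{-i}(A, B)|^{(-1)^i}`, and its analogue
`lowerEuler V` for flag-lowering endomorphisms. Both are computed for direct sums and (the first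
one) for shifts, and every constant in the definition of the category is a monomial in them, in
`q - 1` and in the numbers `|Hom^n(A, B)|` and `|Hom^n_{<0}(V, V)|` (`compCoeff_eq`,
`tensorCoeff_eq`, `idCoeff_eq`).

*Composition.* Conjugation by an equivalence of triples permutes the isomorphisms of complexes
over which the composite is summed, so composition is well defined (`Triple.comp_congr`), and it
is associative by a change of the order of summation. In a homogeneous basis adapted to the flag
an automorphism is an invertible diagonal matrix plus a flag-lowering map, hence
`|Aut V| = (q - 1)^{dim V} |Hom^0_{<0}(V, V)|` (`FlagSpace.card_flagIso`). The constant of `1_V`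
is therefore the inverse of `|Aut V|` times the constant of the composition over `V`, and
composition with the morphism induced by an isomorphism `e` is transport of structure along `e`
(`hComp_hom`, `hom_hComp`). This gives the unit laws.

*The product and isomorphisms.* The product is well defined by `exists_extension_of_equiv`. If `f`
and `g` are isomorphisms of graded spaces with flag then `δ₂₂` is determined by `δ₁₁` and `δ₁₂`,
and every extension is equivalent to one with `δ₁₂ = 0`; so the product of the morphisms induced
by `e` and `e'` is induced by `e ⊕ e'` (`hTensor_hom`). The pentagon and the triangle, and the
compatibility with identities, thereby become equations between canonical isomorphisms of direct
sums. Naturality of the associator holds because both iterated products are sums over the same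
upper triangular `3 × 3` block matrices (`tensorIndexAssoc`), and naturality of the unitors
because an extension by the zero space is unique.

*The interchange law* (`hTensor_hComp`) is the main point. An automorphism `B` of `V ⊕ Y` is block
upper triangular, and the composite `(δ, B, ε)` of two extensions can be rewritten as a composite
of two extensions whose inner off-diagonal blocks agree
(`TensorCompIndex.toCompTensor_bijective`). It remains to count, for quasi-isomorphisms
`t : U → V`, `t' : V → W`, `s : X → Y`, `s' : Y → Z` and an extension `γ` of the composites `t' t`
and `s' s`, the ways to write `γ`, up to a homotopy `h ∈ Hom^{-1}(X, W)`, as a product of an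
extension of `t`, `s` with one of `t'`, `s'`. The unknown blocks and the homotopy assemble to one
homogeneous map `F` of degree `0` from the mapping cone `Y ⊕ X[1]` of `s` to the mapping cone
`W ⊕ V[1]` of `t'`, and the equations say that `D F = G`, where `D` is the differential of the
morphism complex and the cocycle `G` depends only on `γ` (`ExtensionPair.solution_bijective`).
Since `t'` is a quasi-isomorphism its cone is contractible, hence so is the morphism complex;
`D F = G` is then solvable, and the number of solutions, which is the number of cocycles of degree
`0`, is an alternating product of numbers `|Hom^{-i}|` by telescoping
(`card_homDifferential_fiber`). In particular it does not depend on `γ`. Evaluating it for cones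
gives `finsum_extensionPair`, and the constants of composition and product account for it exactly.
-/

noncomputable section

/-! ### Graded linear algebra -/

namespace FlagSpace

variable {k : Type u} [Field k]

theorem iSup_deg (V : FlagSpace.{u, v} k) : ⨆ n, V.deg n = ⊤ :=
  V.isInternal.submodule_iSup_eq_top

theorem hom_ext_deg {V : FlagSpace.{u, v} k} {M : Type*} [AddCommGroup M] [Module k M]
    {f g : V →ₗ[k] M} (h : ∀ n, ∀ x ∈ V.deg n, f x = g x) : f = g := by
  rw [← sub_eq_zero, ← LinearMap.ker_eq_top, ← top_le_iff, ← V.iSup_deg]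
  exact iSup_le fun n x hx => by simp [h n x hx]

/-- The linear map that agrees with `f n` on the homogeneous component of degree `n`. -/
def glue (V : FlagSpace.{u, v} k) {M : Type*} [AddCommGroup M] [Module k M]
    (f : ℤ → V →ₗ[k] M) : V →ₗ[k] M :=
  (DirectSum.toModule k ℤ M fun n => f n ∘ₗ (V.deg n).subtype) ∘ₗ
    (LinearEquiv.ofBijective (DirectSum.coeLinearMap V.deg) V.isInternal).symm.toLinearMap

theorem glue_apply (V : FlagSpace.{u, v} k) {M : Type*} [AddCommGroup M] [Module k M]
    (f : ℤ → V →ₗ[k] M) {n : ℤ} {x : V} (hx : x ∈ V.deg n) : V.glue f x = f n x := by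
  have h : (LinearEquiv.ofBijective (DirectSum.coeLinearMap V.deg) V.isInternal).symm x =
      DirectSum.lof k ℤ (fun n => V.deg n) n ⟨x, hx⟩ := by
    rw [LinearEquiv.symm_apply_eq]
    exact (DirectSum.coeLinearMap_lof V.deg n ⟨x, hx⟩).symm
  simp only [glue, LinearMap.comp_apply, LinearEquiv.coe_coe, h, DirectSum.toModule_lof]
  rfl

/-- The projection to the homogeneous component of degree `n`. -/
def proj (V : FlagSpace.{u, v} k) (n : ℤ) : V →ₗ[k] V :=
  V.glue fun m => if m = n then LinearMap.id else 0

theorem proj_of_mem {V : FlagSpace.{u, v} k} {n : ℤ} {x : V} (hx : x ∈ V.deg n) :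
    V.proj n x = x := by
  simp [proj, glue_apply _ _ hx]

theorem proj_of_ne {V : FlagSpace.{u, v} k} {m n : ℤ} {x : V} (hx : x ∈ V.deg m) (h : m ≠ n) :
    V.proj n x = 0 := by
  simp [proj, glue_apply _ _ hx, h]

theorem proj_mem (V : FlagSpace.{u, v} k) (n : ℤ) (x : V) : V.proj n x ∈ V.deg n := by
  have h : ⊤ ≤ (V.deg n).comap (V.proj n) := by
    rw [← V.iSup_deg]
    refine iSup_le fun m y hy => ?_
    rw [Submodule.mem_comap]
    rcases eq_or_ne m n with rfl | hmn
    · rwa [proj_of_mem hy]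
    · rw [proj_of_ne hy hmn]
      exact zero_mem _
  exact h trivial

theorem finite_setOf_deg_ne_bot (V : FlagSpace.{u, v} k) : {n | V.deg n ≠ ⊥}.Finite :=
  WellFoundedGT.finite_ne_bot_of_iSupIndep V.isInternal.submodule_iSupIndep

theorem flag_succ_eq_sup (V : FlagSpace.{u, v} k) {i : ℕ} {x : V} (hx : x ∈ V.flag (i + 1))
    (hx' : x ∉ V.flag i) : V.flag (i + 1) = V.flag i ⊔ Submodule.span k {x} := by
  symm
  have hle : V.flag i ⊔ Submodule.span k {x} ≤ V.flag (i + 1) :=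
    sup_le (V.flag_mono i.le_succ) ((Submodule.span_singleton_le_iff_mem _ _).mpr hx)
  refine Submodule.eq_of_le_of_finrank_le hle ?_
  have hlt : V.flag i < V.flag i ⊔ Submodule.span k {x} := by
    refine lt_of_le_of_ne le_sup_left fun h => hx' ?_
    rw [h]
    exact Submodule.mem_sup_right (Submodule.mem_span_singleton_self x)
  have h := Submodule.finrank_lt_finrank_of_lt hlt
  rw [V.finrank_flag] at h
  rw [V.finrank_flag]
  omega

theorem exists_homogeneous (V : FlagSpace.{u, v} k) {i : ℕ} (hi : i < V.dim) :
    ∃ n, ∃ x ∈ V.deg n, x ∈ V.flag (i + 1) ∧ x ∉ V.flag i := by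
  by_contra! h
  have hle : V.flag (i + 1) ≤ V.flag i := by
    rw [V.flag_graded (i + 1)]
    exact iSup_le fun n x hx => h n x hx.2 hx.1
  have := Submodule.finrank_mono hle
  rw [V.finrank_flag, V.finrank_flag] at this
  simp only [dim] at hi
  omega

end FlagSpace

section

variable {k : Type u} [Field k]

theorem homDeg_proj {V W : FlagSpace.{u, v} k} {m : ℤ} {f : V →ₗ[k] W} (hf : f ∈ homDeg V W m)
    (n : ℤ) (x : V) : W.proj (n + m) (f x) = f (V.proj n x) := by
  have h : W.proj (n + m) ∘ₗ f = f ∘ₗ V.proj n := FlagSpace.hom_ext_deg fun i y hy => by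
    rcases eq_or_ne i n with rfl | hin
    · simp [FlagSpace.proj_of_mem hy, FlagSpace.proj_of_mem (hf i y hy)]
    · have : i + m ≠ n + m := by omega
      simp [FlagSpace.proj_of_ne hy hin, FlagSpace.proj_of_ne (hf i y hy) this]
  exact LinearMap.congr_fun h x

theorem mem_homDeg_zero {V W : FlagSpace.{u, v} k} {f : V →ₗ[k] W} :
    f ∈ homDeg V W 0 ↔ ∀ i, ∀ x ∈ V.deg i, f x ∈ W.deg i := by
  refine forall_congr' fun i => ?_
  rw [add_zero]

theorem homDeg_comp {U V W : FlagSpace.{u, v} k} {m n l : ℤ} {f : U →ₗ[k] V} {g : V →ₗ[k] W}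
    (hf : f ∈ homDeg U V m) (hg : g ∈ homDeg V W n) (h : m + n = l) :
    g ∘ₗ f ∈ homDeg U W l := fun i x hx => by
  have := hg _ _ (hf i x hx)
  rwa [add_assoc, h] at this

/-- An acyclic complex over a field is contractible. A linear map `t` with `d t + t d = 1` comes
from a splitting of `d` onto its image, and the component of degree `-1` of `t` is a contraction
as well. -/
theorem exists_contraction {V : FlagSpace.{u, v} k} {d : V →ₗ[k] V} (hd : d ∈ homDeg V V 1)
    (hex : ∀ x, d x = 0 ↔ ∃ y, d y = x) :
    ∃ s ∈ homDeg V V (-1), ∀ x, d (s x) + s (d x) = x := by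
  have hdd : ∀ x, d (d x) = 0 := fun x => (hex _).mpr ⟨x, rfl⟩
  obtain ⟨r, hr⟩ := (d.rangeRestrict).exists_rightInverse_of_surjective
    d.range_rangeRestrict
  have hr' : ∀ z : LinearMap.range d, d (r z) = z := fun z =>
    congrArg Subtype.val (LinearMap.congr_fun hr z)
  -- `r` inverts `d` on its image `= ker d`, and `x - r (d x)` is the projection of `x` to `ker d`
  let p : V →ₗ[k] LinearMap.range d :=
    (LinearMap.id - r ∘ₗ d.rangeRestrict).codRestrict (LinearMap.range d) fun x =>
      (hex _).mp (by
        simp only [LinearMap.sub_apply, LinearMap.id_apply, LinearMap.comp_apply, map_sub, hr']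
        exact sub_self _)
  have hp : ∀ x, (p x : V) = x - r (d.rangeRestrict x) := fun x => rfl
  let t : V →ₗ[k] V := r ∘ₗ p
  have ht : ∀ x, d (t x) + t (d x) = x := fun x => by
    have h1 : p (d x) = d.rangeRestrict x := Subtype.ext (by
      rw [hp]
      have : d.rangeRestrict (d x) = 0 := Subtype.ext (hdd x)
      rw [this, map_zero, sub_zero]
      rfl)
    simp only [t, LinearMap.comp_apply, hr', h1, hp, sub_add_cancel]
  refine ⟨V.glue fun n => V.proj (n + -1) ∘ₗ t, fun n x hx => ?_, fun x => ?_⟩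
  · rw [V.glue_apply _ hx]
    exact V.proj_mem _ _
  · have : d ∘ₗ (V.glue fun n => V.proj (n + -1) ∘ₗ t) +
        (V.glue fun n => V.proj (n + -1) ∘ₗ t) ∘ₗ d = LinearMap.id :=
      FlagSpace.hom_ext_deg fun n y hy => by
        simp only [LinearMap.add_apply, LinearMap.comp_apply, V.glue_apply _ hy,
          V.glue_apply _ (hd n y hy), LinearMap.id_apply]
        rw [← homDeg_proj hd, add_neg_cancel_right, neg_add_cancel_right, ← map_add, ht,
          FlagSpace.proj_of_mem hy]
    exact LinearMap.congr_fun this x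

/-- A bijective linear map of degree `0` mapping the steps of the flag to each other is an
isomorphism of graded spaces with flag: the conditions for the inverse hold for reasons of
dimension. -/
def FlagIso.ofBijective {V W : FlagSpace.{u, v} k} (f : V →ₗ[k] W) (hf : Function.Bijective f)
    (h0 : f ∈ homDeg V W 0) (hfl : ∀ i, ∀ x ∈ V.flag i, f x ∈ W.flag i) : FlagIso V W where
  equiv := LinearEquiv.ofBijective f hf
  deg_iff n x := by
    refine ⟨fun h => ?_, mem_homDeg_zero.mp h0 n x⟩
    have h1 : f (V.proj n x) = f x := by
      rw [← homDeg_proj h0, add_zero]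
      exact FlagSpace.proj_of_mem h
    rw [← hf.1 h1]
    exact V.proj_mem n x
  flag_iff i x := by
    refine ⟨fun h => ?_, hfl i x⟩
    have h1 : (V.flag i).map f = W.flag i := by
      refine Submodule.eq_of_le_of_finrank_le (Submodule.map_le_iff_le_comap.mpr (hfl i)) ?_
      rw [← (Submodule.equivMapOfInjective f hf.1 (V.flag i)).finrank_eq, V.finrank_flag,
        W.finrank_flag, (LinearEquiv.ofBijective f hf).finrank_eq]
    rw [← h1] at h
    obtain ⟨y, hy, hxy⟩ := h
    rwa [← hf.1 hxy]

theorem FlagIso.mem_homDeg {V W : FlagSpace.{u, v} k} (e : FlagIso V W) :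
    e.map ∈ homDeg V W 0 :=
  mem_homDeg_zero.mpr fun i x hx => (e.deg_iff i x).mpr hx

theorem FlagIso.dim_eq {V W : FlagSpace.{u, v} k} (e : FlagIso V W) : V.dim = W.dim :=
  e.equiv.finrank_eq

end

/-! ### Finiteness -/

section

variable {k : Type u} [Field k] [Finite k]

instance FlagSpace.finite_carrier (V : FlagSpace.{u, v} k) : Finite V :=
  Module.finite_of_finite k

instance finite_linearMap (V W : FlagSpace.{u, v} k) : Finite (V →ₗ[k] W) :=
  DFunLike.finite _

instance (V : FlagSpace.{u, v} k) : Finite (FlagDifferential V) :=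
  Finite.of_injective FlagDifferential.map fun _ _ => FlagDifferential.ext

instance (V W : FlagSpace.{u, v} k) : Finite (FlagIso V W) :=
  Finite.of_injective FlagIso.map fun _ _ h =>
    FlagIso.ext (LinearEquiv.toLinearMap_injective h)

instance {U V X Y : FlagSpace.{u, v} k} (t : Triple U V) (s : Triple X Y) :
    Finite (Extension t s) :=
  Finite.of_injective (fun δ => (δ.δ₁₁, δ.δ₁₂, δ.δ₂₂)) fun a b h => by
    simp only [Prod.mk.injEq] at h
    exact Extension.ext h.1 h.2.1 h.2.2

end

/-! ### Counting flag-preserving automorphisms -/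

section

variable {k : Type u} [Field k]

/-- There is a homogeneous basis adapted to the flag. -/
theorem FlagSpace.exists_flagBasis (V : FlagSpace.{u, v} k) :
    ∃ (e : Module.Basis (Fin V.dim) k V) (n : Fin V.dim → ℤ), ∀ i, e i ∈ V.deg (n i) ∧
      e i ∉ V.flag i ∧ V.flag (i + 1) = V.flag i ⊔ Submodule.span k {e i} := by
  choose n x hdeg hmem hnot using fun i : Fin V.dim => V.exists_homogeneous i.2
  have hspan : ∀ j ≤ V.dim, V.flag j ≤ Submodule.span k (Set.range x) := by
    intro j
    induction j with
    | zero => intro _; simp [V.flag_zero]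
    | succ j ih =>
      intro hj
      rw [V.flag_succ_eq_sup (hmem ⟨j, hj⟩) (hnot ⟨j, hj⟩)]
      refine sup_le (ih (Nat.le_of_succ_le hj)) ?_
      rw [Submodule.span_singleton_le_iff_mem]
      exact Submodule.subset_span ⟨_, rfl⟩
  refine ⟨basisOfTopLeSpanOfCardEqFinrank x ?_ (by simp), n, fun i => ?_⟩
  · rw [← V.flag_top le_rfl]
    exact hspan _ le_rfl
  · rw [coe_basisOfTopLeSpanOfCardEqFinrank]
    exact ⟨hdeg i, hnot i, V.flag_succ_eq_sup (hmem i) (hnot i)⟩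

variable {V : FlagSpace.{u, v} k} {e : Module.Basis (Fin V.dim) k V} {n : Fin V.dim → ℤ}

/-- A map respects the flag if it does so on an adapted basis. -/
theorem flag_le_comap (he : ∀ i : Fin V.dim, V.flag (i + 1) = V.flag i ⊔ Submodule.span k {e i})
    {g : V →ₗ[k] V} (hg : ∀ i : Fin V.dim, g (e i) ∈ V.flag (i + 1)) (j : ℕ) :
    V.flag j ≤ (V.flag j).comap g := by
  induction j with
  | zero => rw [V.flag_zero]; exact bot_le
  | succ j ih =>
    rcases lt_or_ge j V.dim with hj | hj
    · have hle := V.flag_mono j.le_succ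
      conv_lhs => rw [he ⟨j, hj⟩]
      refine sup_le (ih.trans (Submodule.comap_mono hle)) ?_
      rw [Submodule.span_singleton_le_iff_mem]
      exact hg ⟨j, hj⟩
    · rw [V.flag_top (Nat.le_succ_of_le hj), Submodule.comap_top]

theorem flag_succ_le_comap
    (he : ∀ i : Fin V.dim, V.flag (i + 1) = V.flag i ⊔ Submodule.span k {e i})
    {g : V →ₗ[k] V} (hg : ∀ i : Fin V.dim, g (e i) ∈ V.flag i) (j : ℕ) :
    V.flag (j + 1) ≤ (V.flag j).comap g := by
  have h := flag_le_comap he fun i => V.flag_mono (Nat.le_succ i) (hg i)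
  rcases lt_or_ge j V.dim with hj | hj
  · rw [he ⟨j, hj⟩]
    refine sup_le (h j) ?_
    rw [Submodule.span_singleton_le_iff_mem]
    exact hg ⟨j, hj⟩
  · rw [V.flag_top hj, Submodule.comap_top]
    exact le_top

/-- The diagonal map with entries `a` in the basis `e`. -/
def diagMap (e : Module.Basis (Fin V.dim) k V) (a : Fin V.dim → kˣ) : V →ₗ[k] V :=
  e.constr k fun i => (a i : k) • e i

theorem diagMap_apply_basis (a : Fin V.dim → kˣ) (i : Fin V.dim) :
    diagMap e a (e i) = (a i : k) • e i :=
  e.constr_basis k _ i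

theorem diagMap_mem_homDeg (hn : ∀ i, e i ∈ V.deg (n i)) (a : Fin V.dim → kˣ) :
    diagMap e a ∈ homDeg V V 0 := by
  have h : ∀ m, diagMap e a ∘ₗ V.proj m = V.proj m ∘ₗ diagMap e a := fun m =>
    e.ext fun i => by
      simp only [LinearMap.comp_apply, diagMap_apply_basis, map_smul]
      rcases eq_or_ne (n i) m with rfl | h
      · rw [FlagSpace.proj_of_mem (hn i), diagMap_apply_basis]
      · rw [FlagSpace.proj_of_ne (hn i) h, map_zero, smul_zero]
  rw [mem_homDeg_zero]
  intro m x hx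
  have h1 := LinearMap.congr_fun (h m) x
  simp only [LinearMap.comp_apply, FlagSpace.proj_of_mem hx] at h1
  rw [h1]
  exact V.proj_mem m _

theorem diagMap_mem_flag
    (he : ∀ i : Fin V.dim, V.flag (i + 1) = V.flag i ⊔ Submodule.span k {e i})
    (a : Fin V.dim → kˣ) (j : ℕ) : V.flag j ≤ (V.flag j).comap (diagMap e a) :=
  flag_le_comap he (fun i => by
    rw [diagMap_apply_basis, he i]
    exact Submodule.smul_mem _ _
      (Submodule.mem_sup_right (Submodule.mem_span_singleton_self _))) j

theorem diagMap_add_injective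
    (he : ∀ i : Fin V.dim, V.flag (i + 1) = V.flag i ⊔ Submodule.span k {e i})
    (hnot : ∀ i : Fin V.dim, e i ∉ V.flag i) (a : Fin V.dim → kˣ) (N : homLower V 0) :
    Function.Injective (diagMap e a + N.1) := by
  rw [← LinearMap.ker_eq_bot, ← le_bot_iff]
  have key : ∀ j ≤ V.dim, ∀ x ∈ V.flag j, (diagMap e a + N.1) x = 0 → x = 0 := by
    intro j
    induction j with
    | zero => intro _ x hx _; rwa [V.flag_zero] at hx
    | succ j ih =>
      intro hj x hx hx0
      have hx' := hx
      rw [he ⟨j, hj⟩] at hx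
      obtain ⟨y, hy, z, hz, rfl⟩ := Submodule.mem_sup.mp hx
      obtain ⟨c, rfl⟩ := Submodule.mem_span_singleton.mp hz
      -- modulo the `j`-th step of the flag, the map multiplies by the `j`-th diagonal entry
      have h1 : (c * (a ⟨j, hj⟩ : k)) • e ⟨j, hj⟩ ∈ V.flag j := by
        have h2 : (c * (a ⟨j, hj⟩ : k)) • e ⟨j, hj⟩ =
            -(diagMap e a y + N.1 (y + c • e ⟨j, hj⟩)) := by
          rw [LinearMap.add_apply, map_add, map_smul, diagMap_apply_basis, smul_smul] at hx0
          linear_combination (norm := abel) hx0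
        rw [h2]
        exact neg_mem (add_mem (diagMap_mem_flag he a j hy) (N.2.2 j _ hx'))
      have hc : c = 0 := by
        by_contra hc
        exact hnot ⟨j, hj⟩ ((Submodule.smul_mem_iff _
          (mul_ne_zero hc (a ⟨j, hj⟩).ne_zero)).mp h1)
      subst hc
      rw [zero_smul, add_zero] at hx0 ⊢
      exact ih (Nat.le_of_succ_le hj) y hy hx0
  intro x hx
  exact key V.dim le_rfl x (by rw [V.flag_top le_rfl]; trivial) hx

/-- In a homogeneous basis adapted to the flag, an automorphism is an invertible diagonal matrix
plus a flag-lowering map, and every such sum is an automorphism. -/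
theorem FlagSpace.card_flagIso [Finite k] (V : FlagSpace.{u, v} k) :
    (Nat.card (FlagIso V V) : ℚ) =
      ((Nat.card k : ℚ) - 1) ^ V.dim * Nat.card (homLower V 0) := by
  obtain ⟨e, n, h⟩ := V.exists_flagBasis
  have hn := fun i => (h i).1
  have hnot := fun i => (h i).2.1
  have he := fun i => (h i).2.2
  let Φ : (Fin V.dim → kˣ) × homLower V 0 → FlagIso V V := fun p =>
    FlagIso.ofBijective (diagMap e p.1 + p.2.1)
      (LinearMap.injective_iff_surjective.mp (diagMap_add_injective he hnot p.1 p.2) |>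
        fun hs => ⟨diagMap_add_injective he hnot p.1 p.2, hs⟩)
      (add_mem (diagMap_mem_homDeg hn p.1) p.2.2.1)
      (fun i x hx => by
        refine add_mem (diagMap_mem_flag he p.1 i hx) ?_
        exact p.2.2.2 i x (V.flag_mono i.le_succ hx))
  have hΦ : Function.Bijective Φ := by
    constructor
    · rintro ⟨a, N⟩ ⟨a', N'⟩ hab
      have h1 : ∀ x, diagMap e a x + N.1 x = diagMap e a' x + N'.1 x := fun x =>
        congrArg (fun b : FlagIso V V => b.equiv x) hab
      have h2 : a = a' := by
        funext i
        have h3 : ((a i : k) - a' i) • e i ∈ V.flag i := by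
          have h4 := h1 (e i)
          rw [diagMap_apply_basis, diagMap_apply_basis] at h4
          have hei : e i ∈ V.flag (i + 1) := by
            rw [he i]
            exact Submodule.mem_sup_right (Submodule.mem_span_singleton_self _)
          have h5 : ((a i : k) - a' i) • e i = N'.1 (e i) - N.1 (e i) := by
            rw [sub_smul]
            linear_combination (norm := abel) h4
          rw [h5]
          exact sub_mem (N'.2.2 i _ hei) (N.2.2 i _ hei)
        by_contra hne
        exact hnot i ((Submodule.smul_mem_iff _
          (sub_ne_zero.mpr fun h => hne (Units.ext h))).mp h3)
      subst h2
      refine Prod.ext rfl (Subtype.ext (LinearMap.ext fun x => ?_))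
      exact add_left_cancel (h1 x)
    · intro b
      have hb : ∀ i : Fin V.dim, ∃ c : kˣ, b.equiv (e i) - (c : k) • e i ∈ V.flag i := by
        intro i
        have h1 : b.equiv (e i) ∈ V.flag (i + 1) := by
          rw [b.flag_iff, he i]
          exact Submodule.mem_sup_right (Submodule.mem_span_singleton_self _)
        rw [he i] at h1
        obtain ⟨y, hy, z, hz, hyz⟩ := Submodule.mem_sup.mp h1
        obtain ⟨c, rfl⟩ := Submodule.mem_span_singleton.mp hz
        have hc : c ≠ 0 := by
          rintro rfl
          rw [zero_smul, add_zero] at hyz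
          exact hnot i ((b.flag_iff _ _).mp (hyz ▸ hy))
        refine ⟨Units.mk0 c hc, ?_⟩
        rw [← hyz, Units.val_mk0, add_sub_cancel_right]
        exact hy
      choose a ha using hb
      refine ⟨(a, ⟨b.map - diagMap e a, sub_mem b.mem_homDeg (diagMap_mem_homDeg hn a),
        fun j x hx => flag_succ_le_comap (g := b.map - diagMap e a) he (fun i => by
          rw [LinearMap.sub_apply, diagMap_apply_basis]
          exact ha i) j hx⟩), ?_⟩
      refine FlagIso.ext (LinearEquiv.ext fun x => ?_)
      exact add_sub_cancel (diagMap e a x) (b.equiv x)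
  rw [← Nat.card_congr (Equiv.ofBijective Φ hΦ), Nat.card_prod, Nat.card_fun, Nat.card_units,
    Nat.card_fin, Nat.cast_mul, Nat.cast_pow, Nat.cast_sub Nat.card_pos, Nat.cast_one]

end

/-! ### Alternating products -/

section AltProd

/-- The alternating product `a_0 a_1⁻¹ a_2 a_3⁻¹ ⋯` of a sequence with almost all terms `1`. -/
def altProd (a : ℕ → ℚ) : ℚ := ∏ᶠ i, a i ^ ((-1 : ℤ) ^ i)

theorem hasFiniteMulSupport_zpow {a : ℕ → ℚ} (ha : a.HasFiniteMulSupport) (n : ℕ → ℤ) :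
    (fun i => a i ^ n i).HasFiniteMulSupport :=
  Set.Finite.subset ha fun i hi h => hi (by simp [h])

theorem altProd_mul {a b : ℕ → ℚ} (ha : a.HasFiniteMulSupport) (hb : b.HasFiniteMulSupport) :
    altProd (fun i => a i * b i) = altProd a * altProd b := by
  simp only [altProd, mul_zpow]
  exact finprod_mul_distrib (hasFiniteMulSupport_zpow ha _) (hasFiniteMulSupport_zpow hb _)

theorem altProd_ne_zero {a : ℕ → ℚ} (ha : ∀ i, a i ≠ 0) : altProd a ≠ 0 :=
  finprod_induction (· ≠ 0) one_ne_zero (fun _ _ => mul_ne_zero) fun i => zpow_ne_zero _ (ha i)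

theorem finprod_zpow_succ (a : ℕ → ℚ) :
    ∏ᶠ i, a i ^ ((-1 : ℤ) ^ (i + 1)) = (altProd a)⁻¹ := by
  rw [altProd, ← finprod_inv_distrib]
  refine finprod_congr fun i => ?_
  rw [pow_succ, mul_neg_one, zpow_neg]

theorem altProd_succ {a : ℕ → ℚ} (ha : a.HasFiniteMulSupport) (h0 : a 0 ≠ 0) :
    altProd (fun i => a (i + 1)) = a 0 / altProd a := by
  obtain ⟨N, hN⟩ := (Set.Finite.bddAbove ha)
  have hN' : ∀ i, N < i → a i = 1 := fun i hi => by
    by_contra h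
    exact absurd (hN h) (not_le.mpr hi)
  have h1 : altProd a = ∏ i ∈ Finset.range (N + 1), a i ^ ((-1 : ℤ) ^ i) := by
    refine finprod_eq_prod_of_mulSupport_subset _ fun i hi => ?_
    rw [Finset.coe_range, Set.mem_Iio]
    by_contra h
    exact hi (by simp [hN' i (by omega)])
  have h2 : altProd (fun i => a (i + 1)) =
      ∏ i ∈ Finset.range N, a (i + 1) ^ ((-1 : ℤ) ^ i) := by
    refine finprod_eq_prod_of_mulSupport_subset _ fun i hi => ?_
    rw [Finset.coe_range, Set.mem_Iio]
    by_contra h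
    exact hi (by simp [hN' (i + 1) (by omega)])
  rw [h1, h2, Finset.prod_range_succ', pow_zero, zpow_one]
  have h3 : ∏ i ∈ Finset.range N, a (i + 1) ^ ((-1 : ℤ) ^ (i + 1)) =
      (∏ i ∈ Finset.range N, a (i + 1) ^ ((-1 : ℤ) ^ i))⁻¹ := by
    rw [← Finset.prod_inv_distrib]
    refine Finset.prod_congr rfl fun i _ => ?_
    rw [pow_succ, mul_neg_one, zpow_neg]
  rw [h3, div_mul_cancel_right₀ h0, inv_inv]

/-- If the terms `a_i = z_i z_{i+1}` are products of consecutive terms of another sequence, then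
the alternating product telescopes. -/
theorem altProd_telescope {a z : ℕ → ℚ} (hz : z.HasFiniteMulSupport) (hz0 : ∀ i, z i ≠ 0)
    (h : ∀ i, a i = z i * z (i + 1)) : altProd a = z 0 := by
  have hs : (fun i => z (i + 1)).HasFiniteMulSupport :=
    Set.Finite.preimage (Set.injOn_of_injective (add_left_injective 1)) hz
  rw [funext h, altProd_mul hz hs, altProd_succ hz (hz0 0),
    mul_div_cancel₀ _ (altProd_ne_zero hz0)]

end AltProd

/-! ### Block decompositions and the normalising constants -/

section

variable {k : Type u} [Field k]

/-- In `V ⊕ W` the step of the flag with index `dim V` is `V`. -/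
theorem snd_eq_zero_of_mem_flag_dim {V W : FlagSpace.{u, v} k} {p : V × W}
    (hp : p ∈ (V.prod W).flag V.dim) : p.2 = 0 := by
  have h : p.2 ∈ W.flag (V.dim - V.dim) := hp.2
  rw [Nat.sub_self, W.flag_zero] at h
  exact h

/-- A linear map `F : V ⊕ W → V' ⊕ W'` that maps `V` to `V'` is block upper triangular. -/
theorem eq_blockMap {V W V' W' : FlagSpace.{u, v} k} (F : V.prod W →ₗ[k] V'.prod W')
    (hF : ∀ x : V, (F ((x, 0) : V × W)).2 = 0) :
    F = blockMap (LinearMap.fst k V' W' ∘ₗ F ∘ₗ LinearMap.inl k V W)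
      (LinearMap.fst k V' W' ∘ₗ F ∘ₗ LinearMap.inr k V W)
      (LinearMap.snd k V' W' ∘ₗ F ∘ₗ LinearMap.inr k V W) := by
  refine LinearMap.ext fun p => ?_
  have hp : p = ((p.1, 0) : V × W) + ((0, p.2) : V × W) :=
    Prod.ext (add_zero _).symm (zero_add _).symm
  have h : F p = F ((p.1, 0) : V × W) + F ((0, p.2) : V × W) := by
    conv_lhs => rw [hp]
    exact map_add F _ _
  rw [h]
  refine Prod.ext rfl ?_
  exact (congrArg (· + _) (hF p.1)).trans (zero_add _)

theorem fst_block_mem {U X V Y : FlagSpace.{u, v} k} {n : ℤ} {F : U.prod X →ₗ[k] V.prod Y}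
    (hF : F ∈ homDeg (U.prod X) (V.prod Y) n) :
    LinearMap.fst k V Y ∘ₗ F ∘ₗ LinearMap.inl k U X ∈ homDeg U V n :=
  fun i x hx => (hF i (x, 0) ⟨hx, zero_mem _⟩).1

theorem off_block_mem {U X V Y : FlagSpace.{u, v} k} {n : ℤ} {F : U.prod X →ₗ[k] V.prod Y}
    (hF : F ∈ homDeg (U.prod X) (V.prod Y) n) :
    LinearMap.fst k V Y ∘ₗ F ∘ₗ LinearMap.inr k U X ∈ homDeg X V n :=
  fun i x hx => (hF i (0, x) ⟨zero_mem _, hx⟩).1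

theorem snd_block_mem {U X V Y : FlagSpace.{u, v} k} {n : ℤ} {F : U.prod X →ₗ[k] V.prod Y}
    (hF : F ∈ homDeg (U.prod X) (V.prod Y) n) :
    LinearMap.snd k V Y ∘ₗ F ∘ₗ LinearMap.inr k U X ∈ homDeg X Y n :=
  fun i x hx => (hF i (0, x) ⟨zero_mem _, hx⟩).2

/-- Maps out of a direct sum are pairs of maps. -/
def homDegProdLeft (U X W : FlagSpace.{u, v} k) (n : ℤ) :
    homDeg (U.prod X) W n ≃ homDeg U W n × homDeg X W n where
  toFun F := (⟨F.1 ∘ₗ LinearMap.inl k U X, fun i _ hx => F.2 i (_, 0) ⟨hx, zero_mem _⟩⟩,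
    ⟨F.1 ∘ₗ LinearMap.inr k U X, fun i _ hx => F.2 i (0, _) ⟨zero_mem _, hx⟩⟩)
  invFun p := ⟨LinearMap.coprod p.1.1 p.2.1,
    fun i _ hx => add_mem (p.1.2 i _ hx.1) (p.2.2 i _ hx.2)⟩
  left_inv F := Subtype.ext (LinearMap.coprod_comp_inl_inr F.1)
  right_inv _ := Prod.ext (Subtype.ext (LinearMap.coprod_inl _ _))
    (Subtype.ext (LinearMap.coprod_inr _ _))

/-- Maps into a direct sum are pairs of maps. -/
def homDegProdRight (U V Y : FlagSpace.{u, v} k) (n : ℤ) :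
    homDeg U (V.prod Y) n ≃ homDeg U V n × homDeg U Y n where
  toFun F := (⟨LinearMap.fst k V Y ∘ₗ F.1, fun i x hx => (F.2 i x hx).1⟩,
    ⟨LinearMap.snd k V Y ∘ₗ F.1, fun i x hx => (F.2 i x hx).2⟩)
  invFun p := ⟨LinearMap.prod p.1.1 p.2.1, fun i x hx => ⟨p.1.2 i x hx, p.2.2 i x hx⟩⟩
  left_inv _ := rfl
  right_inv _ := rfl

theorem blockMap_mem_homLower {V W : FlagSpace.{u, v} k} {n : ℤ} {a : V →ₗ[k] V}
    {b : W →ₗ[k] V} {c : W →ₗ[k] W} (ha : a ∈ homLower V n) (hb : b ∈ homDeg W V n)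
    (hc : c ∈ homLower W n) : blockMap a b c ∈ homLower (V.prod W) n := by
  refine ⟨blockMap_mem_homDeg ha.1 hb hc.1, fun j p hp => ?_⟩
  have h1 : p.1 ∈ V.flag (j + 1) := hp.1
  have h2 : p.2 ∈ W.flag (j + 1 - V.dim) := hp.2
  change a p.1 + b p.2 ∈ V.flag j ∧ c p.2 ∈ W.flag (j - V.dim)
  rcases le_or_gt V.dim j with hj | hj
  · refine ⟨?_, hc.2 _ _ ?_⟩
    · rw [V.flag_top hj]; exact Submodule.mem_top
    · rwa [← Nat.sub_add_comm hj]
  · rw [Nat.sub_eq_zero_of_le hj, W.flag_zero, Submodule.mem_bot] at h2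
    rw [h2, map_zero, map_zero, add_zero]
    exact ⟨ha.2 j _ h1, zero_mem _⟩

theorem fst_block_mem_homLower {V W : FlagSpace.{u, v} k} {n : ℤ}
    {F : V.prod W →ₗ[k] V.prod W} (hF : F ∈ homLower (V.prod W) n) :
    LinearMap.fst k V W ∘ₗ F ∘ₗ LinearMap.inl k V W ∈ homLower V n :=
  ⟨fst_block_mem hF.1, fun j x hx => (hF.2 j ((x, 0) : V × W) ⟨hx, zero_mem _⟩).1⟩

theorem snd_block_mem_homLower {V W : FlagSpace.{u, v} k} {n : ℤ}
    {F : V.prod W →ₗ[k] V.prod W} (hF : F ∈ homLower (V.prod W) n) :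
    LinearMap.snd k V W ∘ₗ F ∘ₗ LinearMap.inr k V W ∈ homLower W n := by
  refine ⟨snd_block_mem hF.1, fun j x hx => ?_⟩
  have hx' : ((0, x) : V × W) ∈ (V.prod W).flag (j + V.dim + 1) := by
    refine ⟨zero_mem _, ?_⟩
    change x ∈ W.flag (j + V.dim + 1 - V.dim)
    rwa [Nat.add_right_comm, Nat.add_sub_cancel]
  have h : (F ((0, x) : V × W)).2 ∈ W.flag (j + V.dim - V.dim) := (hF.2 _ _ hx').2
  rwa [Nat.add_sub_cancel] at h

theorem snd_apply_eq_zero_of_mem_homLower {V W : FlagSpace.{u, v} k} {n : ℤ}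
    {F : V.prod W →ₗ[k] V.prod W} (hF : F ∈ homLower (V.prod W) n) (x : V) :
    (F ((x, 0) : V × W)).2 = 0 := by
  apply snd_eq_zero_of_mem_flag_dim
  apply (V.prod W).flag_mono le_rfl
  refine hF.2 _ _ ⟨?_, zero_mem _⟩
  rw [V.flag_top (Nat.le_succ _)]
  exact Submodule.mem_top

/-- Flag-lowering maps of `V ⊕ W` are block upper triangular with flag-lowering diagonal blocks and
arbitrary off-diagonal block. -/
def homLowerProd (V W : FlagSpace.{u, v} k) (n : ℤ) :
    homLower (V.prod W) n ≃ (homLower V n × homLower W n) × homDeg W V n where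
  toFun F := ((⟨_, fst_block_mem_homLower F.2⟩, ⟨_, snd_block_mem_homLower F.2⟩),
    ⟨_, off_block_mem F.2.1⟩)
  invFun p := ⟨_, blockMap_mem_homLower p.1.1.2 p.2.2 p.1.2.2⟩
  left_inv F := Subtype.ext (eq_blockMap F.1 (snd_apply_eq_zero_of_mem_homLower F.2)).symm
  right_inv p := by
    refine Prod.ext (Prod.ext (Subtype.ext (LinearMap.ext fun x => ?_))
      (Subtype.ext (LinearMap.ext fun x => ?_))) (Subtype.ext (LinearMap.ext fun x => ?_))
    · change p.1.1.1 x + p.2.1 0 = p.1.1.1 x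
      rw [map_zero, add_zero]
    · rfl
    · change p.1.1.1 0 + p.2.1 x = p.2.1 x
      rw [map_zero, zero_add]

/-- The shift `V[1]`, with the same flag. -/
def FlagSpace.shift (V : FlagSpace.{u, v} k) : FlagSpace.{u, v} k where
  carrier := V
  deg n := V.deg (n + 1)
  isInternal := by
    rw [DirectSum.isInternal_submodule_iff_iSupIndep_and_iSup_eq_top]
    refine ⟨V.isInternal.submodule_iSupIndep.comp (add_left_injective 1), ?_⟩
    rw [← V.iSup_deg]
    exact (Equiv.addRight (1 : ℤ)).iSup_comp (g := V.deg)
  flag := V.flag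
  flag_mono := V.flag_mono
  finrank_flag := V.finrank_flag
  flag_graded i := by
    conv_lhs => rw [V.flag_graded i]
    exact ((Equiv.addRight (1 : ℤ)).iSup_comp (g := fun n => V.flag i ⊓ V.deg n)).symm

theorem mem_homDeg_shift_left {V W : FlagSpace.{u, v} k} {n : ℤ} {f : V →ₗ[k] W} :
    f ∈ homDeg V.shift W n ↔ f ∈ homDeg V W (n - 1) := by
  constructor
  · intro h i x hx
    have := h (i - 1) x (by change x ∈ V.deg (i - 1 + 1); rwa [sub_add_cancel])
    rwa [sub_add_eq_add_sub, add_sub_assoc] at this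
  · intro h i x hx
    have := h (i + 1) x hx
    rwa [add_assoc, add_sub_cancel] at this

theorem mem_homDeg_shift_right {V W : FlagSpace.{u, v} k} {n : ℤ} {f : V →ₗ[k] W} :
    f ∈ homDeg V W.shift n ↔ f ∈ homDeg V W (n + 1) := by
  refine forall_congr' fun i => ?_
  rw [← add_assoc]
  rfl

/-- The number of elements of `Hom^n(V, W)`. -/
def homCard (V W : FlagSpace.{u, v} k) (n : ℤ) : ℚ := Nat.card (homDeg V W n)

/-- The number of elements of `Hom^n_{<0}(V, V)`. -/
def lowerCard (V : FlagSpace.{u, v} k) (n : ℤ) : ℚ := Nat.card (homLower V n)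

/-- The alternating product `∏_{i ≥ 0} |Hom^{-i}(V, W)|^{(-1)^i}`. -/
def euler (V W : FlagSpace.{u, v} k) : ℚ := altProd fun i => homCard V W (-(i : ℤ))

/-- The alternating product `∏_{i ≥ 0} |Hom^{-i}_{<0}(V, V)|^{(-1)^i}`. -/
def lowerEuler (V : FlagSpace.{u, v} k) : ℚ := altProd fun i => lowerCard V (-(i : ℤ))

theorem homCard_prod_left (U X W : FlagSpace.{u, v} k) (n : ℤ) :
    homCard (U.prod X) W n = homCard U W n * homCard X W n := by
  rw [homCard, Nat.card_congr (homDegProdLeft U X W n), Nat.card_prod, Nat.cast_mul]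
  rfl

theorem homCard_prod_right (U V Y : FlagSpace.{u, v} k) (n : ℤ) :
    homCard U (V.prod Y) n = homCard U V n * homCard U Y n := by
  rw [homCard, Nat.card_congr (homDegProdRight U V Y n), Nat.card_prod, Nat.cast_mul]
  rfl

theorem lowerCard_prod (V W : FlagSpace.{u, v} k) (n : ℤ) :
    lowerCard (V.prod W) n = lowerCard V n * lowerCard W n * homCard W V n := by
  rw [lowerCard, Nat.card_congr (homLowerProd V W n), Nat.card_prod, Nat.card_prod,
    Nat.cast_mul, Nat.cast_mul]
  rfl

theorem homCard_shift_left (V W : FlagSpace.{u, v} k) (n : ℤ) :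
    homCard V.shift W n = homCard V W (n - 1) :=
  congrArg Nat.cast (Nat.card_congr (Equiv.subtypeEquivRight fun _ => mem_homDeg_shift_left))

theorem homCard_shift_right (V W : FlagSpace.{u, v} k) (n : ℤ) :
    homCard V W.shift n = homCard V W (n + 1) :=
  congrArg Nat.cast (Nat.card_congr (Equiv.subtypeEquivRight fun _ => mem_homDeg_shift_right))

theorem finite_setOf_homDeg_ne_bot (V W : FlagSpace.{u, v} k) :
    {n | homDeg V W n ≠ ⊥}.Finite := by
  refine (V.finite_setOf_deg_ne_bot.image2 (fun a b => b - a)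
    W.finite_setOf_deg_ne_bot).subset fun m hm => ?_
  obtain ⟨f, hf, hf0⟩ := Submodule.exists_mem_ne_zero_of_ne_bot hm
  have : ∃ n, ∃ x ∈ V.deg n, f x ≠ 0 := by
    by_contra! h
    exact hf0 (FlagSpace.hom_ext_deg h)
  obtain ⟨n, x, hx, hfx⟩ := this
  refine ⟨n, fun h => hfx ?_, n + m, fun h => hfx ?_, add_sub_cancel_left n m⟩
  · rw [h, Submodule.mem_bot] at hx
    rw [hx, map_zero]
  · have := hf n x hx
    rwa [h, Submodule.mem_bot] at this

theorem hasFiniteMulSupport_homCard (V W : FlagSpace.{u, v} k) {c : ℕ → ℤ}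
    (hc : Function.Injective c) :
    (fun i => homCard V W (c i)).HasFiniteMulSupport := by
  refine ((finite_setOf_homDeg_ne_bot V W).preimage hc.injOn).subset fun i hi h => hi ?_
  have h' : homDeg V W (c i) = ⊥ := h
  simp [homCard, h']

theorem hasFiniteMulSupport_lowerCard (V : FlagSpace.{u, v} k) {c : ℕ → ℤ}
    (hc : Function.Injective c) :
    (fun i => lowerCard V (c i)).HasFiniteMulSupport := by
  refine ((finite_setOf_homDeg_ne_bot V V).preimage hc.injOn).subset fun i hi h => hi ?_
  have h' : homLower V (c i) = ⊥ := by
    rw [← le_bot_iff, ← (h : homDeg V V (c i) = ⊥)]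
    exact fun f hf => hf.1
  simp [lowerCard, h']

theorem neg_natCast_injective : Function.Injective fun i : ℕ => -(i : ℤ) :=
  neg_injective.comp Nat.cast_injective

theorem euler_prod_left (U X W : FlagSpace.{u, v} k) :
    euler (U.prod X) W = euler U W * euler X W := by
  simp only [euler, homCard_prod_left]
  exact altProd_mul (hasFiniteMulSupport_homCard _ _ neg_natCast_injective)
    (hasFiniteMulSupport_homCard _ _ neg_natCast_injective)

theorem euler_prod_right (U V Y : FlagSpace.{u, v} k) :
    euler U (V.prod Y) = euler U V * euler U Y := by
  simp only [euler, homCard_prod_right]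
  exact altProd_mul (hasFiniteMulSupport_homCard _ _ neg_natCast_injective)
    (hasFiniteMulSupport_homCard _ _ neg_natCast_injective)

theorem lowerEuler_prod (V W : FlagSpace.{u, v} k) :
    lowerEuler (V.prod W) = lowerEuler V * lowerEuler W * euler W V := by
  have hV := hasFiniteMulSupport_lowerCard V neg_natCast_injective
  have hW := hasFiniteMulSupport_lowerCard W neg_natCast_injective
  simp only [lowerEuler, lowerCard_prod]
  rw [altProd_mul ((hV.union hW).subset (Function.mulSupport_mul _ _))
    (hasFiniteMulSupport_homCard _ _ neg_natCast_injective), altProd_mul hV hW, euler]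

theorem idCoeff_eq (V : FlagSpace.{u, v} k) :
    idCoeff V = (((Nat.card k : ℚ) - 1) ^ V.dim * lowerEuler V)⁻¹ := by
  rw [idCoeff, zpow_neg, zpow_natCast, mul_inv]
  exact congrArg _ (finprod_zpow_succ _)

theorem FlagIso.lowerCard_eq {V W : FlagSpace.{u, v} k} (e : FlagIso V W) (n : ℤ) :
    lowerCard V n = lowerCard W n := by
  have h : ∀ {V W : FlagSpace.{u, v} k} (e : FlagIso V W), ∀ f ∈ homLower V n,
      e.map ∘ₗ f ∘ₗ e.symm.map ∈ homLower W n := fun e f hf =>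
    ⟨fun i x hx => (e.deg_iff _ _).mpr (hf.1 i _ ((e.symm.deg_iff i x).mpr hx)),
      fun j x hx => (e.flag_iff _ _).mpr (hf.2 j _ ((e.symm.flag_iff _ x).mpr hx))⟩
  refine congrArg Nat.cast (Nat.card_congr
    { toFun := fun f => ⟨_, h e f.1 f.2⟩
      invFun := fun f => ⟨_, h e.symm f.1 f.2⟩
      left_inv := fun f => Subtype.ext (LinearMap.ext fun x => ?_)
      right_inv := fun f => Subtype.ext (LinearMap.ext fun x => ?_) })
  · simp [FlagIso.symm]
  · simp [FlagIso.symm]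

theorem FlagIso.idCoeff_eq {V W : FlagSpace.{u, v} k} (e : FlagIso V W) :
    idCoeff V = idCoeff W := by
  simp only [_root_.idCoeff_eq, lowerEuler, e.lowerCard_eq, e.dim_eq]

variable [Finite k]

theorem homCard_ne_zero (V W : FlagSpace.{u, v} k) (n : ℤ) : homCard V W n ≠ 0 :=
  Nat.cast_ne_zero.mpr Nat.card_pos.ne'

theorem lowerCard_ne_zero (V : FlagSpace.{u, v} k) (n : ℤ) : lowerCard V n ≠ 0 :=
  Nat.cast_ne_zero.mpr Nat.card_pos.ne'

theorem euler_ne_zero (V W : FlagSpace.{u, v} k) : euler V W ≠ 0 :=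
  altProd_ne_zero fun _ => homCard_ne_zero _ _ _

theorem lowerEuler_ne_zero (V : FlagSpace.{u, v} k) : lowerEuler V ≠ 0 :=
  altProd_ne_zero fun _ => lowerCard_ne_zero _ _

theorem card_sub_one_ne_zero (k : Type u) [Field k] [Finite k] : (Nat.card k : ℚ) - 1 ≠ 0 := by
  have h : 1 < Nat.card k := Finite.one_lt_card
  have : (1 : ℚ) < Nat.card k := by exact_mod_cast h
  exact (sub_pos.mpr this).ne'

theorem altProd_homCard_succ (V W : FlagSpace.{u, v} k) :
    altProd (fun i => homCard V W (-(i : ℤ) - 1)) = homCard V W 0 / euler V W := by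
  have h := altProd_succ (hasFiniteMulSupport_homCard V W neg_natCast_injective)
    (homCard_ne_zero V W _)
  simp only [Nat.cast_add, Nat.cast_one, neg_add', Nat.cast_zero, neg_zero] at h
  exact h

theorem euler_shift_left (V W : FlagSpace.{u, v} k) :
    euler V.shift W = homCard V W 0 / euler V W := by
  simp only [euler, homCard_shift_left]
  exact altProd_homCard_succ V W

theorem euler_shift_right (V W : FlagSpace.{u, v} k) :
    euler V W.shift = homCard V W 1 / euler V W := by
  have hc : Function.Injective fun i : ℕ => -(i : ℤ) + 1 :=
    (add_left_injective 1).comp neg_natCast_injective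
  have h := altProd_succ (hasFiniteMulSupport_homCard V W hc) (homCard_ne_zero V W _)
  simp only [Nat.cast_add, Nat.cast_one, neg_add, neg_add_cancel_right, Nat.cast_zero, neg_zero,
    zero_add] at h
  rw [euler, euler, h, div_div_cancel₀ (homCard_ne_zero V W 1)]
  simp only [homCard_shift_right]

/-- The coefficient in the composition of triples. -/
def compCoeff (V : FlagSpace.{u, v} k) : ℚ :=
  ∏ᶠ i : ℕ, (Nat.card (homLower V (-((i : ℤ) + 1))) : ℚ) ^ ((-1 : ℤ) ^ (i + 1))

/-- The coefficient in the monoidal product of a triple from `U` to `V` and one from `X` to `Y`. -/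
def tensorCoeff (U V X Y : FlagSpace.{u, v} k) : ℚ :=
  ∏ᶠ i : ℕ, ((Nat.card (homDeg X U (-(i : ℤ))) : ℚ) * Nat.card (homDeg Y V (-(i : ℤ))) *
      Nat.card (homDeg X V (-(i : ℤ) - 1))) ^ ((-1 : ℤ) ^ (i + 1))

theorem compCoeff_eq (V : FlagSpace.{u, v} k) :
    compCoeff V = lowerEuler V / lowerCard V 0 := by
  have h := altProd_succ (hasFiniteMulSupport_lowerCard V neg_natCast_injective)
    (lowerCard_ne_zero V _)
  simp only [Nat.cast_add, Nat.cast_one, Nat.cast_zero, neg_zero] at h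
  rw [lowerEuler, ← inv_div, ← h, ← finprod_zpow_succ]
  rfl

theorem tensorCoeff_eq (U V X Y : FlagSpace.{u, v} k) :
    tensorCoeff U V X Y = euler X V / (euler X U * euler Y V * homCard X V 0) := by
  have hc : Function.Injective fun i : ℕ => -(i : ℤ) - 1 :=
    (sub_left_injective (b := 1)).comp neg_natCast_injective
  have h1 := hasFiniteMulSupport_homCard X U neg_natCast_injective
  have h2 := hasFiniteMulSupport_homCard Y V neg_natCast_injective
  have h : tensorCoeff U V X Y = (altProd fun i => homCard X U (-(i : ℤ)) *
      homCard Y V (-(i : ℤ)) * homCard X V (-(i : ℤ) - 1))⁻¹ := (finprod_zpow_succ _)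
  rw [h, altProd_mul ((h1.union h2).subset (Function.mulSupport_mul _ _))
      (hasFiniteMulSupport_homCard X V hc),
    altProd_mul h1 h2, altProd_homCard_succ, ← mul_div_assoc, inv_div]
  rfl

theorem idCoeff_mul_compCoeff (V : FlagSpace.{u, v} k) :
    idCoeff V * compCoeff V * Nat.card (FlagIso V V) = 1 := by
  rw [idCoeff_eq, compCoeff_eq, V.card_flagIso, ← lowerCard]
  have h1 := lowerEuler_ne_zero V
  have h2 := lowerCard_ne_zero V 0
  have h3 := pow_ne_zero V.dim (card_sub_one_ne_zero k)
  field_simp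

end

/-! ### Finite sums -/

section

variable {M : Type*} [AddCommGroup M]

theorem finsum_comm_of_finite {α β : Type*} [Finite α] [Finite β] (f : α → β → M) :
    ∑ᶠ a, ∑ᶠ b, f a b = ∑ᶠ b, ∑ᶠ a, f a b := by
  have := Fintype.ofFinite α
  have := Fintype.ofFinite β
  simp only [finsum_eq_sum_of_fintype]
  exact Finset.sum_comm

theorem finsum_sigma_of_finite {α : Type*} {β : α → Type*} [Finite α] [∀ a, Finite (β a)]
    (f : ∀ a, β a → M) : ∑ᶠ p : Σ a, β a, f p.1 p.2 = ∑ᶠ a, ∑ᶠ b, f a b := by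
  have := Fintype.ofFinite α
  have := fun a => Fintype.ofFinite (β a)
  simp only [finsum_eq_sum_of_fintype]
  exact Fintype.sum_sigma _

theorem finsum_prod_of_finite {α β : Type*} [Finite α] [Finite β] (f : α → β → M) :
    ∑ᶠ p : α × β, f p.1 p.2 = ∑ᶠ a, ∑ᶠ b, f a b := by
  rw [← finsum_sigma_of_finite, ← finsum_comp_equiv (Equiv.sigmaEquivProd α β)]
  rfl

theorem finsum_const_of_finite {α : Type*} [Finite α] [Module ℚ M] (c : M) :
    ∑ᶠ _ : α, c = (Nat.card α : ℚ) • c := by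
  have := Fintype.ofFinite α
  rw [finsum_eq_sum_of_fintype, Finset.sum_const, Finset.card_univ, Nat.card_eq_fintype_card,
    Nat.cast_smul_eq_nsmul]

theorem map_finsum_of_finite {α : Type*} [Finite α] {N : Type*} [AddCommGroup N] [Module ℚ M]
    [Module ℚ N] (L : M →ₗ[ℚ] N) (f : α → M) : L (∑ᶠ a, f a) = ∑ᶠ a, L (f a) :=
  map_finsum L (Set.toFinite _)

theorem map_finsum_left_of_finite {α : Type*} [Finite α] {N P : Type*} [AddCommGroup N]
    [AddCommGroup P] [Module ℚ M] [Module ℚ N] [Module ℚ P] (L : M →ₗ[ℚ] N →ₗ[ℚ] P)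
    (f : α → M) (b : N) : L (∑ᶠ a, f a) b = ∑ᶠ a, L (f a) b :=
  map_finsum_of_finite (L.flip b) f

/-- If for every `b` exactly one `a` satisfies `P a b`, then the pairs satisfying `P` are counted by
`b`. This evaluates composites with morphisms induced by isomorphisms, where `a` is a differential
and `b` an automorphism. -/
theorem finsum_subtype_of_existsUnique {α β : Type*} [Finite α] [Finite β] [Module ℚ M]
    {P : α → β → Prop} (h : ∀ b, ∃! a, P a b) (f : ∀ a, {b // P a b} → M) (c : M)
    (hf : ∀ a b, f a b = c) : ∑ᶠ a, ∑ᶠ b, f a b = (Nat.card β : ℚ) • c := by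
  simp only [hf]
  rw [← finsum_sigma_of_finite (fun (a : α) (_ : {b // P a b}) => c), finsum_const_of_finite]
  have hb : Function.Bijective fun p : Σ a, {b // P a b} => p.2.1 := by
    constructor
    · rintro ⟨a, b, hb⟩ ⟨a', b', hb'⟩ (rfl : b = b')
      obtain rfl := (h b).unique hb hb'
      rfl
    · intro b
      obtain ⟨a, ha, _⟩ := h b
      exact ⟨⟨a, b, ha⟩, rfl⟩
  rw [Nat.card_congr (Equiv.ofBijective _ hb)]

end

/-! ### Linear maps out of the morphism spaces -/

section

variable {k : Type u} [Field k] {U V W X Y : FlagSpace.{u, v} k}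
  {M : Type*} [AddCommGroup M] [Module ℚ M]

theorem Triple.basis_eq_of_equiv {t t' : Triple U V} (h : TripleEquiv t t') :
    t.basis = t'.basis :=
  congrArg (fun c : TripleClass U V => (Finsupp.single c 1 : HHom U V)) (Quotient.sound h)

theorem HHom.ext_basis {f g : HHom U V →ₗ[ℚ] M} (h : ∀ t : Triple U V, f t.basis = g t.basis) :
    f = g :=
  Finsupp.lhom_ext' fun c => Quotient.inductionOn c fun t => LinearMap.ext_ring (h t)

theorem HHom.induction {p : HHom U V → Prop} (a : HHom U V) (zero : p 0)
    (add : ∀ a b, p a → p b → p (a + b)) (smul : ∀ (c : ℚ) a, p a → p (c • a))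
    (basis : ∀ t : Triple U V, p t.basis) : p a := by
  refine Finsupp.induction_linear a zero add fun c r => Quotient.inductionOn c fun t => ?_
  have h := smul r _ (basis t)
  rwa [Triple.basis, Finsupp.smul_single, smul_eq_mul, mul_one] at h

/-- The linear map on `Hom(U, V)` with prescribed values on triples. -/
def HHom.lift (F : Triple U V → M) (h : ∀ t t', TripleEquiv t t' → F t = F t') :
    HHom U V →ₗ[ℚ] M :=
  Finsupp.linearCombination ℚ (Quotient.lift F h)

theorem HHom.lift_basis (F : Triple U V → M) (h : ∀ t t', TripleEquiv t t' → F t = F t')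
    (t : Triple U V) : HHom.lift F h t.basis = F t := by
  rw [HHom.lift, Triple.basis, Finsupp.linearCombination_single, one_smul]
  rfl

/-- The bilinear map with prescribed values on pairs of triples. -/
def HHom.lift₂ (F : Triple U V → Triple X Y → M)
    (h : ∀ t t' s s', TripleEquiv t t' → TripleEquiv s s' → F t s = F t' s') :
    HHom U V →ₗ[ℚ] HHom X Y →ₗ[ℚ] M :=
  HHom.lift (fun t => HHom.lift (F t) fun s s' hs =>
      h t t s s' ((tripleEquiv_equivalence U V).refl t) hs)
    fun t t' ht => HHom.ext_basis fun s => by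
      rw [HHom.lift_basis, HHom.lift_basis]
      exact h t t' s s ht ((tripleEquiv_equivalence X Y).refl s)

theorem HHom.lift₂_basis (F : Triple U V → Triple X Y → M)
    (h : ∀ t t' s s', TripleEquiv t t' → TripleEquiv s s' → F t s = F t' s')
    (t : Triple U V) (s : Triple X Y) : HHom.lift₂ F h t.basis s.basis = F t s := by
  rw [HHom.lift₂, HHom.lift_basis, HHom.lift_basis]

/-! ### Elementwise forms of the structure equations -/

theorem FlagDifferential.map_map (d : FlagDifferential V) (x : V) : d.map (d.map x) = 0 :=
  LinearMap.congr_fun d.sq x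

theorem Triple.map_comm (t : Triple U V) (x : U) :
    t.map (t.dSrc.map x) = t.dTgt.map (t.map x) :=
  LinearMap.congr_fun t.isQuasiIso.comm x

theorem FlagIso.Intertwines.apply {e : FlagIso V W} {d : FlagDifferential V}
    {d' : FlagDifferential W} (h : e.Intertwines d d') (x : V) :
    e.equiv (d.map x) = d'.map (e.equiv x) :=
  LinearMap.congr_fun h x

theorem FlagIso.intertwines_transport (e : FlagIso V W) (d : FlagDifferential V) :
    e.Intertwines d (e.transport d) := by
  ext x
  simp [FlagIso.transport, FlagIso.symm]

theorem FlagIso.Intertwines.eq_transport {e : FlagIso V W} {d : FlagDifferential V}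
    {d' : FlagDifferential W} (h : e.Intertwines d d') : d' = e.transport d := by
  refine FlagDifferential.ext (LinearMap.ext fun x => ?_)
  have := h.apply (e.equiv.symm x)
  rw [LinearEquiv.apply_symm_apply] at this
  exact this.symm

@[simp]
theorem FlagIso.transport_apply (e : FlagIso V W) (d : FlagDifferential V) (x : W) :
    (e.transport d).map x = e.equiv (d.map (e.equiv.symm x)) := rfl

@[simp]
theorem FlagIso.symm_equiv (e : FlagIso V W) : e.symm.equiv = e.equiv.symm := rfl

@[simp]
theorem FlagIso.refl_apply (x : V) : (FlagIso.refl V).equiv x = x := rfl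

@[simp]
theorem FlagIso.trans_apply (e : FlagIso U V) (e' : FlagIso V W) (x : U) :
    (e.trans e').equiv x = e'.equiv (e.equiv x) := rfl

/-- Equivalence of triples by automorphisms that make the square commute strictly. -/
theorem Triple.basis_eq {t t' : Triple U V} (φ : FlagIso U U) (ψ : FlagIso V V)
    (hφ : ∀ x, φ.equiv (t.dSrc.map x) = t'.dSrc.map (φ.equiv x))
    (hψ : ∀ x, ψ.equiv (t.dTgt.map x) = t'.dTgt.map (ψ.equiv x))
    (h : ∀ x, ψ.equiv (t.map x) = t'.map (φ.equiv x)) : t.basis = t'.basis :=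
  Triple.basis_eq_of_equiv ⟨φ, ψ, LinearMap.ext hφ, LinearMap.ext hψ, 0, zero_mem _,
    LinearMap.ext fun x => by simp [h]⟩

/-! ### Composition -/

theorem hId_eq (V : FlagSpace.{u, v} k) : hId V = (FlagIso.refl V).hom := rfl

theorem FlagIso.trans_symm (e : FlagIso V W) : e.trans e.symm = FlagIso.refl V :=
  FlagIso.ext (LinearEquiv.ext fun x => by simp)

/-- The triple obtained from `t` by transport of its target along `e`. -/
def Triple.post (t : Triple U V) (e : FlagIso V W) : Triple U W where
  dSrc := t.dSrc
  map := e.map ∘ₗ t.map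
  dTgt := e.transport t.dTgt
  isQuasiIso := (e.intertwines_transport t.dTgt).isQuasiIso.comp t.isQuasiIso

/-- The triple obtained from `t` by transport of its source along `e`. -/
def Triple.pre (e : FlagIso U V) (t : Triple V W) : Triple U W where
  dSrc := e.symm.transport t.dSrc
  map := t.map ∘ₗ e.map
  dTgt := t.dTgt
  isQuasiIso := t.isQuasiIso.comp (e.symm.intertwines_transport t.dSrc).symm.isQuasiIso

theorem FlagIso.hom_eq (e : FlagIso V W) :
    e.hom = idCoeff V • ∑ᶠ d : FlagDifferential V, (e.triple d).basis := rfl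

/-- Equivalences of the factors give an equivalence of the composite along `b` with the composite
along the conjugate `ψ' b ψ⁻¹`. -/
theorem Triple.compAlong_equiv {t t' : Triple U V} {s s' : Triple V W} {φ : FlagIso U U}
    {ψ ψ' : FlagIso V V} {χ : FlagIso W W} (hφ : φ.Intertwines t.dSrc t'.dSrc)
    (hψ : ψ.Intertwines t.dTgt t'.dTgt) (hψ' : ψ'.Intertwines s.dSrc s'.dSrc)
    (hχ : χ.Intertwines s.dTgt s'.dTgt)
    (ht : ∃ h ∈ homDeg U V (-1),
      ψ.map ∘ₗ t.map - t'.map ∘ₗ φ.map = t'.dTgt.map ∘ₗ h + h ∘ₗ t.dSrc.map)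
    (hs : ∃ h ∈ homDeg V W (-1),
      χ.map ∘ₗ s.map - s'.map ∘ₗ ψ'.map = s'.dTgt.map ∘ₗ h + h ∘ₗ s.dSrc.map)
    (b : {b : FlagIso V V // b.Intertwines t.dTgt s.dSrc}) :
    TripleEquiv (t.compAlong s b)
      (t'.compAlong s' ⟨(ψ.symm.trans b.1).trans ψ', (hψ.symm.trans b.2).trans hψ'⟩) := by
  obtain ⟨h, hh, eh⟩ := ht
  obtain ⟨h', hh', eh'⟩ := hs
  refine ⟨φ, χ, hφ, hχ, h' ∘ₗ b.1.map ∘ₗ t.map +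
    s'.map ∘ₗ ψ'.map ∘ₗ b.1.map ∘ₗ ψ.symm.map ∘ₗ h, add_mem ?_ ?_, LinearMap.ext fun x => ?_⟩
  · exact homDeg_comp (homDeg_comp t.isQuasiIso.mem_homDeg b.1.mem_homDeg (zero_add 0)) hh'
      (zero_add _)
  · exact homDeg_comp (homDeg_comp (homDeg_comp (homDeg_comp hh ψ.symm.mem_homDeg (add_zero _))
      b.1.mem_homDeg (add_zero _)) ψ'.mem_homDeg (add_zero _)) s'.isQuasiIso.mem_homDeg
      (add_zero _)
  · have e1 := congrArg (fun y => s'.map (ψ'.equiv (b.1.equiv (ψ.equiv.symm y))))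
      (LinearMap.congr_fun eh x)
    have e2 := LinearMap.congr_fun eh' (b.1.equiv (t.map x))
    have e3 := b.2.apply (t.map x)
    have e4 := t.map_comm x
    have e5 := hψ.symm.apply (h x)
    have e6 := b.2.apply (ψ.equiv.symm (h x))
    have e7 := hψ'.apply (b.1.equiv (ψ.equiv.symm (h x)))
    have e8 := s'.map_comm (ψ'.equiv (b.1.equiv (ψ.equiv.symm (h x))))
    simp only [LinearMap.comp_apply, LinearMap.sub_apply, LinearMap.add_apply,
      LinearEquiv.coe_coe, map_sub, map_add, LinearEquiv.symm_apply_apply, FlagIso.symm_equiv]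
      at e1 e2 e5
    simp only [Triple.compAlong, LinearMap.comp_apply, LinearMap.sub_apply, LinearMap.add_apply,
      LinearEquiv.coe_coe, map_add, FlagIso.trans_apply, FlagIso.symm_equiv]
    rw [e4, e3, ← e8, ← e7, ← e6, ← e5]
    linear_combination (norm := abel) e1 + e2

theorem Triple.comp_congr {t t' : Triple U V} {s s' : Triple V W} (ht : TripleEquiv t t')
    (hs : TripleEquiv s s') : t.comp s = t'.comp s' := by
  obtain ⟨φ, ψ, hφ, hψ, h⟩ := ht
  obtain ⟨ψ', χ, hψ', hχ, h'⟩ := hs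
  refine congrArg _ (finsum_eq_of_bijective
    (fun b : {b : FlagIso V V // b.Intertwines t.dTgt s.dSrc} =>
      (⟨(ψ.symm.trans b.1).trans ψ', (hψ.symm.trans b.2).trans hψ'⟩ :
        {b : FlagIso V V // b.Intertwines t'.dTgt s'.dSrc})) ⟨?_, ?_⟩
    fun b => Triple.basis_eq_of_equiv (Triple.compAlong_equiv hφ hψ hψ' hχ h h' b))
  · intro b b' hb
    refine Subtype.ext (FlagIso.ext (LinearEquiv.ext fun x => ?_))
    have := congrArg (fun c => (Subtype.val c).equiv (ψ.equiv x)) hb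
    simpa using this
  · intro b
    refine ⟨⟨(ψ.trans b.1).trans ψ'.symm, (hψ.trans b.2).trans hψ'.symm⟩,
      Subtype.ext (FlagIso.ext (LinearEquiv.ext fun x => ?_))⟩
    simp

variable (k) in
/-- The bilinear composition law. -/
def hComp : CompLaw.{u, v} k := fun _ _ _ =>
  HHom.lift₂ Triple.comp fun _ _ _ _ => Triple.comp_congr

theorem hComp_basis (t : Triple U V) (s : Triple V W) :
    hComp k U V W t.basis s.basis = t.comp s :=
  HHom.lift₂_basis _ _ _ _

theorem Triple.comp_eq (t : Triple U V) (s : Triple V W) :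
    t.comp s = compCoeff V •
      ∑ᶠ b : {b : FlagIso V V // b.Intertwines t.dTgt s.dSrc}, (t.compAlong s b).basis := rfl

variable [Finite k]

theorem hComp_assoc (a : HHom U V) (b : HHom V W) (c : HHom W X) :
    hComp k U W X (hComp k U V W a b) c = hComp k U V X a (hComp k V W X b c) := by
  induction a using HHom.induction with
  | zero => simp
  | add a a' h h' => simp [h, h']
  | smul r a h => simp [h]
  | basis t =>
    induction b using HHom.induction with
    | zero => simp
    | add b b' h h' => simp [h, h']
    | smul r b h => simp [h]
    | basis s =>
      induction c using HHom.induction with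
      | zero => simp
      | add c c' h h' => simp [h, h']
      | smul r c h => simp [h]
      | basis q =>
        rw [hComp_basis, hComp_basis, Triple.comp_eq, Triple.comp_eq, map_smul,
          LinearMap.smul_apply, map_smul, map_finsum_left_of_finite, map_finsum_of_finite]
        simp only [hComp_basis, Triple.comp_eq]
        rw [← smul_finsum, ← smul_finsum, smul_comm]
        exact congrArg _ (congrArg _ (finsum_comm_of_finite
          fun (b : {b : FlagIso V V // b.Intertwines t.dTgt s.dSrc})
            (b' : {b : FlagIso W W // b.Intertwines s.dTgt q.dSrc}) =>
          ((t.compAlong s b).compAlong q b').basis))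

/-- Composition with the morphism induced by `e` is transport along `e`. For every automorphism
`b` of `V` there is exactly one differential `d` with `b : (V, d_V) ≅ (V, d)`, and all these
composites are equivalent, so the constant in `e.hom` cancels `|Aut V|` and the constant of the
composition. -/
theorem hComp_hom (t : Triple U V) (e : FlagIso V W) :
    hComp k U V W t.basis e.hom = (t.post e).basis := by
  rw [FlagIso.hom_eq, map_smul, map_finsum_of_finite]
  simp only [hComp_basis, Triple.comp_eq]
  rw [← smul_finsum, smul_smul, finsum_subtype_of_existsUnique
    (P := fun (d : FlagDifferential V) (b : FlagIso V V) => b.Intertwines t.dTgt (e.triple d).dSrc)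
    (fun b => ⟨_, b.intertwines_transport _, fun d hd => hd.eq_transport⟩) _ (t.post e).basis,
    smul_smul, idCoeff_mul_compCoeff, one_smul]
  intro d b
  refine Triple.basis_eq (FlagIso.refl U) ((e.symm.trans b.1.symm).trans e) (fun _ => rfl)
    (fun x => ?_) fun x => ?_
  · have := b.2.symm.apply (e.equiv.symm x)
    simp only [FlagIso.symm_equiv] at this
    simpa [Triple.post, Triple.compAlong, FlagIso.triple] using this
  · simp [Triple.post, Triple.compAlong, FlagIso.triple]

theorem hom_hComp (e : FlagIso U V) (t : Triple V W) :
    hComp k U V W e.hom t.basis = (t.pre e).basis := by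
  rw [FlagIso.hom_eq, map_smul, LinearMap.smul_apply, map_finsum_left_of_finite]
  simp only [hComp_basis, Triple.comp_eq]
  rw [← smul_finsum, smul_smul, finsum_subtype_of_existsUnique
    (P := fun (d : FlagDifferential U) (b : FlagIso V V) =>
      b.Intertwines (e.triple d).dTgt t.dSrc)
    (fun b => ⟨(b.symm.trans e.symm).transport t.dSrc, ?_, fun d hd => ?_⟩) _ (t.pre e).basis,
    smul_smul, e.idCoeff_eq, idCoeff_mul_compCoeff, one_smul]
  · intro d b
    refine Triple.basis_eq ((e.trans b.1).trans e.symm) (FlagIso.refl W)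
      (fun x => ?_) (fun _ => rfl) fun x => ?_
    · have := b.2.apply (e.equiv x)
      simp only [FlagIso.triple, FlagIso.transport_apply, LinearEquiv.symm_apply_apply] at this
      simp [Triple.pre, Triple.compAlong, FlagIso.triple, this]
    · simp [Triple.pre, Triple.compAlong, FlagIso.triple]
  · refine LinearMap.ext fun x => ?_
    have h : (b.symm.trans e.symm).equiv.symm (e.equiv.symm x) = b.equiv x := by
      rw [LinearEquiv.symm_apply_eq]
      simp
    simp [FlagIso.triple, h]
  · exact (((e.intertwines_transport d).trans hd).symm).eq_transport

theorem FlagIso.hom_trans (e : FlagIso U V) (e' : FlagIso V W) :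
    hComp k U V W e.hom e'.hom = (e.trans e').hom := by
  rw [e.hom_eq, map_smul, LinearMap.smul_apply, map_finsum_left_of_finite]
  simp only [hComp_hom]
  rfl

theorem hId_comp (a : HHom U V) : hComp k U U V (hId U) a = a := by
  induction a using HHom.induction with
  | zero => simp
  | add a a' h h' => simp [h, h']
  | smul r a h => simp [h]
  | basis t => rw [hId_eq, hom_hComp]; rfl

theorem hComp_id (a : HHom U V) : hComp k U V V a (hId V) = a := by
  induction a using HHom.induction with
  | zero => simp
  | add a a' h h' => simp [h, h']
  | smul r a h => simp [h]
  | basis t => rw [hId_eq, hComp_hom]; rfl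

theorem hComp_categoryLaws : CategoryLaws (hComp.{u, v} k) where
  id_comp _ _ := hId_comp
  comp_id _ _ := hComp_id
  assoc _ _ _ _ := hComp_assoc

theorem hComp_isoLaws : IsoLaws (hComp.{u, v} k) := fun V W e => by
  rw [FlagIso.hom_trans, FlagIso.trans_symm, hId_eq]

end

/-! ### The monoidal product of triples -/

section

variable {k : Type u} [Field k] {U V W X Y Z : FlagSpace.{u, v} k}

theorem Extension.apply₁₁ {t : Triple U V} {s : Triple X Y} (δ : Extension t s) (x : X) :
    t.dSrc.map (δ.δ₁₁ x) + δ.δ₁₁ (s.dSrc.map x) = 0 :=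
  LinearMap.congr_fun δ.eq₁₁ x

theorem Extension.apply₂₂ {t : Triple U V} {s : Triple X Y} (δ : Extension t s) (y : Y) :
    t.dTgt.map (δ.δ₂₂ y) + δ.δ₂₂ (s.dTgt.map y) = 0 :=
  LinearMap.congr_fun δ.eq₂₂ y

theorem Extension.apply₁₂ {t : Triple U V} {s : Triple X Y} (δ : Extension t s) (x : X) :
    δ.δ₁₂ (s.dSrc.map x) + t.map (δ.δ₁₁ x) = t.dTgt.map (δ.δ₁₂ x) + δ.δ₂₂ (s.map x) :=
  LinearMap.congr_fun δ.eq₁₂ x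

/-- The direct sum of two isomorphisms. -/
def FlagIso.prod (e : FlagIso U V) (e' : FlagIso X Y) : FlagIso (U.prod X) (V.prod Y) where
  equiv := LinearEquiv.prodCongr e.equiv e'.equiv
  deg_iff n p := and_congr (e.deg_iff n p.1) (e'.deg_iff n p.2)
  flag_iff i p := and_congr (e.flag_iff i p.1) (by
    rw [← e.dim_eq]
    exact e'.flag_iff _ p.2)

/-- The isomorphism with block upper triangular matrix with diagonal entries `e`, `e'`. -/
def FlagIso.block (e : FlagIso U V) (b : X →ₗ[k] V) (hb : b ∈ homDeg X V 0) (e' : FlagIso X Y) :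
    FlagIso (U.prod X) (V.prod Y) :=
  FlagIso.ofBijective (blockMap e.map b e'.map)
    (by
      constructor
      · intro p q hpq
        have h1 : e.equiv p.1 + b p.2 = e.equiv q.1 + b q.2 := congrArg Prod.fst hpq
        have h2 : e'.equiv p.2 = e'.equiv q.2 := congrArg Prod.snd hpq
        have h3 := e'.equiv.injective h2
        rw [h3] at h1
        exact Prod.ext (e.equiv.injective (add_right_cancel h1)) h3
      · intro q
        refine ⟨(e.equiv.symm (q.1 - b (e'.equiv.symm q.2)), e'.equiv.symm q.2), ?_⟩
        refine Prod.ext ?_ (e'.equiv.apply_symm_apply q.2)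
        change e.equiv (e.equiv.symm (q.1 - b (e'.equiv.symm q.2))) + b (e'.equiv.symm q.2) = q.1
        rw [LinearEquiv.apply_symm_apply, sub_add_cancel])
    (blockMap_mem_homDeg e.mem_homDeg hb e'.mem_homDeg)
    (by
      intro i p hp
      have h1 : p.1 ∈ U.flag i := hp.1
      have h2 : p.2 ∈ X.flag (i - U.dim) := hp.2
      change e.equiv p.1 + b p.2 ∈ V.flag i ∧ e'.equiv p.2 ∈ Y.flag (i - V.dim)
      refine ⟨add_mem ((e.flag_iff i _).mpr h1) ?_, ?_⟩
      · rcases le_or_gt V.dim i with hi | hi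
        · rw [V.flag_top hi]; trivial
        · rw [e.dim_eq, Nat.sub_eq_zero_of_le hi.le, X.flag_zero, Submodule.mem_bot] at h2
          rw [h2, map_zero]
          exact zero_mem _
      · rw [← e.dim_eq]
        exact (e'.flag_iff _ _).mpr h2)

/-- Equivalences `(φ, ψ, h)` from `t` to `t'` and `(φ', ψ', h')` from `s` to `s'` transform
extensions of `t`, `s` into extensions of `t'`, `s'`: the differentials are conjugated by
`diag(φ, φ')` and `diag(ψ, ψ')`, and the block `δ₁₂` is corrected so that `diag(h, h')` is a
homotopy. -/
theorem exists_extension_of_equiv {t t' : Triple U V} {s s' : Triple X Y}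
    (ht : TripleEquiv t t') (hs : TripleEquiv s s') :
    ∃ F : Extension t s → Extension t' s', Function.Injective F ∧
      ∀ δ, TripleEquiv δ.triple (F δ).triple := by
  obtain ⟨φ, ψ, hφ, hψ, h, hh, eh⟩ := ht
  obtain ⟨φ', ψ', hφ', hψ', h', hh', eh'⟩ := hs
  have eh₁ : ∀ x, ψ.equiv (t.map x) - t'.map (φ.equiv x) = t'.dTgt.map (h x) + h (t.dSrc.map x) :=
    LinearMap.congr_fun eh
  have eh₂ : ∀ x, ψ'.equiv (s.map x) - s'.map (φ'.equiv x) =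
    s'.dTgt.map (h' x) + h' (s.dSrc.map x) := LinearMap.congr_fun eh'
  let F : Extension t s → Extension t' s' := fun δ =>
    { δ₁₁ := φ.map ∘ₗ δ.δ₁₁ ∘ₗ φ'.symm.map
      δ₂₂ := ψ.map ∘ₗ δ.δ₂₂ ∘ₗ ψ'.symm.map
      δ₁₂ := (ψ.map ∘ₗ δ.δ₁₂ - ((ψ.map ∘ₗ δ.δ₂₂ ∘ₗ ψ'.symm.map) ∘ₗ h' + h ∘ₗ δ.δ₁₁)) ∘ₗ
        φ'.symm.map
      mem₁₁ := homDeg_comp (homDeg_comp φ'.symm.mem_homDeg δ.mem₁₁ (zero_add 1)) φ.mem_homDeg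
        (add_zero _)
      mem₂₂ := homDeg_comp (homDeg_comp ψ'.symm.mem_homDeg δ.mem₂₂ (zero_add 1)) ψ.mem_homDeg
        (add_zero _)
      mem₁₂ := homDeg_comp φ'.symm.mem_homDeg (sub_mem
        (homDeg_comp δ.mem₁₂ ψ.mem_homDeg (add_zero 0))
        (add_mem (homDeg_comp hh' (homDeg_comp (homDeg_comp ψ'.symm.mem_homDeg δ.mem₂₂
          (zero_add 1)) ψ.mem_homDeg (add_zero _)) (neg_add_cancel _))
          (homDeg_comp δ.mem₁₁ hh (add_neg_cancel _)))) (add_zero _)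
      eq₁₁ := LinearMap.ext fun x => by
        have e1 := hφ.apply (δ.δ₁₁ (φ'.equiv.symm x))
        have e2 := hφ'.symm.apply x
        have e3 := congrArg φ.equiv (δ.apply₁₁ (φ'.equiv.symm x))
        simp only [FlagIso.symm_equiv, map_add, map_zero] at e2 e3
        simp only [LinearMap.add_apply, LinearMap.comp_apply, LinearEquiv.coe_coe,
          FlagIso.symm_equiv, e2, ← e1, e3, LinearMap.zero_apply]
      eq₂₂ := LinearMap.ext fun x => by
        have e1 := hψ.apply (δ.δ₂₂ (ψ'.equiv.symm x))
        have e2 := hψ'.symm.apply x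
        have e3 := congrArg ψ.equiv (δ.apply₂₂ (ψ'.equiv.symm x))
        simp only [FlagIso.symm_equiv, map_add, map_zero] at e2 e3
        simp only [LinearMap.add_apply, LinearMap.comp_apply, LinearEquiv.coe_coe,
          FlagIso.symm_equiv, e2, ← e1, e3, LinearMap.zero_apply]
      eq₁₂ := LinearMap.ext fun x => by
        obtain ⟨x, rfl⟩ := φ'.equiv.surjective x
        have e1 := eh₁ (δ.δ₁₁ x)
        have e2 := congrArg (fun y => ψ.equiv (δ.δ₂₂ (ψ'.equiv.symm y))) (eh₂ x)
        have e3 := congrArg ψ.equiv (δ.apply₁₂ x)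
        have e4 := congrArg h (δ.apply₁₁ x)
        have e5 := hψ.apply (δ.δ₁₂ x)
        have e6 := hψ.apply (δ.δ₂₂ (ψ'.equiv.symm (h' x)))
        have e7 := congrArg ψ.equiv (δ.apply₂₂ (ψ'.equiv.symm (h' x)))
        have e8 := hψ'.symm.apply (h' x)
        have e9 := hφ'.apply x
        simp only [FlagIso.symm_equiv, map_add, map_sub, map_zero,
          LinearEquiv.symm_apply_apply] at e1 e2 e3 e4 e7 e8
        simp only [LinearMap.add_apply, LinearMap.sub_apply, LinearMap.comp_apply,
          LinearEquiv.coe_coe, FlagIso.symm_equiv, LinearEquiv.symm_apply_apply, map_add, map_sub,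
          ← e9]
        rw [e8] at e2
        rw [← e5, ← e6]
        linear_combination (norm := abel) e3 - e1 + e2 - e4 + e7 }
  refine ⟨F, fun δ ε hδε => ?_, fun δ => ?_⟩
  · have h11 := congrArg Extension.δ₁₁ hδε
    have h12 := congrArg Extension.δ₁₂ hδε
    have h22 := congrArg Extension.δ₂₂ hδε
    have k11 : δ.δ₁₁ = ε.δ₁₁ := LinearMap.ext fun x => by
      simpa [F] using LinearMap.congr_fun h11 (φ'.equiv x)
    have k22 : δ.δ₂₂ = ε.δ₂₂ := LinearMap.ext fun x => by
      simpa [F] using LinearMap.congr_fun h22 (ψ'.equiv x)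
    refine Extension.ext k11 (LinearMap.ext fun x => ?_) k22
    simpa [F, k11, k22] using LinearMap.congr_fun h12 (φ'.equiv x)
  · refine ⟨φ.prod φ', ψ.prod ψ', LinearMap.ext fun p => ?_, LinearMap.ext fun p => ?_,
      blockMap h 0 h', blockMap_mem_homDeg hh (zero_mem _) hh', LinearMap.ext fun p => ?_⟩
    · refine Prod.ext ?_ (hφ'.apply p.2)
      change φ.equiv (t.dSrc.map p.1 + δ.δ₁₁ p.2) =
        t'.dSrc.map (φ.equiv p.1) + φ.equiv (δ.δ₁₁ (φ'.equiv.symm (φ'.equiv p.2)))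
      rw [map_add, hφ.apply, LinearEquiv.symm_apply_apply]
    · refine Prod.ext ?_ (hψ'.apply p.2)
      change ψ.equiv (t.dTgt.map p.1 + δ.δ₂₂ p.2) =
        t'.dTgt.map (ψ.equiv p.1) + ψ.equiv (δ.δ₂₂ (ψ'.equiv.symm (ψ'.equiv p.2)))
      rw [map_add, hψ.apply, LinearEquiv.symm_apply_apply]
    · refine Prod.ext ?_ (eh₂ p.2)
      change ψ.equiv (t.map p.1 + δ.δ₁₂ p.2) - (t'.map (φ.equiv p.1) +
          (ψ.equiv (δ.δ₁₂ (φ'.equiv.symm (φ'.equiv p.2))) -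
            (ψ.equiv (δ.δ₂₂ (ψ'.equiv.symm (h' (φ'.equiv.symm (φ'.equiv p.2))))) +
              h (δ.δ₁₁ (φ'.equiv.symm (φ'.equiv p.2)))))) =
        (t'.dTgt.map (h p.1 + 0) + ψ.equiv (δ.δ₂₂ (ψ'.equiv.symm (h' p.2)))) +
          (h (t.dSrc.map p.1 + δ.δ₁₁ p.2) + 0)
      simp only [LinearEquiv.symm_apply_apply, map_add, add_zero]
      linear_combination (norm := abel) eh₁ p.1

theorem Triple.tensor_eq (t : Triple U V) (s : Triple X Y) :
    t.tensor s = tensorCoeff U V X Y • ∑ᶠ δ : Extension t s, δ.triple.basis := rfl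

variable [Finite k]

/-- The transformation of extensions is bijective because there is an injection in the other
direction between the same finite sets. -/
theorem Triple.tensor_congr {t t' : Triple U V} {s s' : Triple X Y} (ht : TripleEquiv t t')
    (hs : TripleEquiv s s') : t.tensor s = t'.tensor s' := by
  obtain ⟨F, hF, hF'⟩ := exists_extension_of_equiv ht hs
  obtain ⟨G, hG, -⟩ := exists_extension_of_equiv ((tripleEquiv_equivalence U V).symm ht)
    ((tripleEquiv_equivalence X Y).symm hs)
  exact congrArg _ (finsum_eq_of_bijective F
    (hF.bijective_of_nat_card_le (Nat.card_le_card_of_injective G hG))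
    fun δ => Triple.basis_eq_of_equiv (hF' δ))

variable (k) in
/-- The bilinear product of morphisms. -/
def hTensor : TensorLaw.{u, v} k := fun _ _ _ _ =>
  HHom.lift₂ Triple.tensor fun _ _ _ _ => Triple.tensor_congr

theorem hTensor_basis (t : Triple U V) (s : Triple X Y) :
    hTensor k U V X Y t.basis s.basis = t.tensor s :=
  HHom.lift₂_basis _ _ _ _

end

/-! ### The product of isomorphisms of graded spaces with flag -/

section

variable {k : Type u} [Field k] {U V W X Y Z : FlagSpace.{u, v} k}

theorem FlagIso.homCard_left (e : FlagIso X Y) (V : FlagSpace.{u, v} k) (n : ℤ) :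
    homCard X V n = homCard Y V n :=
  congrArg Nat.cast (Nat.card_congr
    { toFun := fun f => ⟨f.1 ∘ₗ e.symm.map, homDeg_comp e.symm.mem_homDeg f.2 (zero_add n)⟩
      invFun := fun f => ⟨f.1 ∘ₗ e.map, homDeg_comp e.mem_homDeg f.2 (zero_add n)⟩
      left_inv := fun f => Subtype.ext (LinearMap.ext fun x => by simp)
      right_inv := fun f => Subtype.ext (LinearMap.ext fun x => by simp) })

theorem FlagIso.euler_left (e : FlagIso X Y) (V : FlagSpace.{u, v} k) :
    euler X V = euler Y V := by
  simp only [euler, e.homCard_left]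

/-- Every flag-lowering differential on `U ⊕ X` is block upper triangular. -/
theorem FlagDifferential.exists_eq_block (D : FlagDifferential (U.prod X)) :
    ∃ (d : FlagDifferential U) (d' : FlagDifferential X) (δ : X →ₗ[k] U) (hδ : δ ∈ homDeg X U 1)
      (h : d.map ∘ₗ δ + δ ∘ₗ d'.map = 0), D = blockDifferential d d' δ hδ h := by
  have hD := eq_blockMap D.map (snd_apply_eq_zero_of_mem_homLower D.mem)
  set a := LinearMap.fst k U X ∘ₗ D.map ∘ₗ LinearMap.inl k U X with ha
  set b := LinearMap.fst k U X ∘ₗ D.map ∘ₗ LinearMap.inr k U X with hb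
  set c := LinearMap.snd k U X ∘ₗ D.map ∘ₗ LinearMap.inr k U X with hc
  have hsq : ∀ p : U × X, blockMap a b c (blockMap a b c p) = 0 := fun p => by
    have := D.map_map p
    rwa [hD] at this
  have h1 : ∀ p : U × X, a (a p.1 + b p.2) + b (c p.2) = 0 := fun p => congrArg Prod.fst (hsq p)
  have h2 : ∀ p : U × X, c (c p.2) = 0 := fun p => congrArg Prod.snd (hsq p)
  refine ⟨⟨a, fst_block_mem_homLower D.mem, LinearMap.ext fun x => ?_⟩,
    ⟨c, snd_block_mem_homLower D.mem, LinearMap.ext fun x => h2 (0, x)⟩, b, off_block_mem D.mem.1,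
    LinearMap.ext fun x => ?_, FlagDifferential.ext hD⟩
  · simpa using h1 (x, 0)
  · simpa using h1 (0, x)

theorem blockMap_injective {a a' : U →ₗ[k] V} {b b' : X →ₗ[k] V} {c c' : X →ₗ[k] Y}
    (h : blockMap a b c = blockMap a' b' c') : a = a' ∧ b = b' ∧ c = c' := by
  have h1 : ∀ p : U × X, a p.1 + b p.2 = a' p.1 + b' p.2 := fun p =>
    congrArg Prod.fst (LinearMap.congr_fun h p)
  have h2 : ∀ p : U × X, c p.2 = c' p.2 := fun p =>
    congrArg Prod.snd (LinearMap.congr_fun h p)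
  refine ⟨LinearMap.ext fun x => ?_, LinearMap.ext fun x => ?_, LinearMap.ext fun x => h2 (0, x)⟩
  · simpa using h1 (x, 0)
  · simpa using h1 (0, x)

/-- An extension of `(d, e, e d e⁻¹)` and `(d', e', e' d' e'⁻¹)` amounts to a differential on
`U ⊕ X` with diagonal blocks `d`, `d'` and an arbitrary `δ₁₂ ∈ Hom^0(X, V)`, because `e'` is
invertible and so `δ₂₂` is determined. -/
theorem extension_isoTriple_bijective (e : FlagIso U V) (e' : FlagIso X Y) :
    Function.Bijective
      (fun p : Σ (d : FlagDifferential U) (d' : FlagDifferential X),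
          Extension (e.triple d) (e'.triple d') =>
        ((p.2.2.triple.dSrc, ⟨p.2.2.δ₁₂, p.2.2.mem₁₂⟩) :
          FlagDifferential (U.prod X) × homDeg X V 0)) := by
  constructor
  · rintro ⟨d, d', δ⟩ ⟨c, c', ε⟩ h
    obtain ⟨h1, h2, h3⟩ := blockMap_injective
      (congrArg FlagDifferential.map (congrArg Prod.fst h))
    obtain rfl : d = c := FlagDifferential.ext h1
    obtain rfl : d' = c' := FlagDifferential.ext h3
    have h4 : δ.δ₁₂ = ε.δ₁₂ := congrArg (fun q => q.2.1) h
    have h5 : δ.δ₂₂ = ε.δ₂₂ := by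
      refine LinearMap.ext fun y => ?_
      obtain ⟨x, rfl⟩ := e'.equiv.surjective y
      have e1 := δ.apply₁₂ x
      rw [h2, h4, ε.apply₁₂ x] at e1
      exact (add_left_cancel e1).symm
    obtain rfl : δ = ε := Extension.ext h2 h4 h5
    rfl
  · rintro ⟨D, β, hβ⟩
    obtain ⟨d, d', δ, hδ, h, rfl⟩ := D.exists_eq_block
    have h' : ∀ x, d.map (δ x) + δ (d'.map x) = 0 := LinearMap.congr_fun h
    refine ⟨⟨d, d', ⟨δ, β, (β ∘ₗ d'.map + e.map ∘ₗ δ - (e.transport d).map ∘ₗ β) ∘ₗ e'.symm.map,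
      hδ, hβ, ?_, h, ?_, ?_⟩⟩, rfl⟩
    · exact homDeg_comp e'.symm.mem_homDeg (sub_mem (add_mem
        (homDeg_comp d'.mem.1 hβ (add_zero 1)) (homDeg_comp hδ e.mem_homDeg (add_zero 1)))
        (homDeg_comp hβ (e.transport d).mem.1 (zero_add 1))) (zero_add 1)
    · refine LinearMap.ext fun y => ?_
      obtain ⟨x, rfl⟩ := e'.equiv.surjective y
      have e1 := (e.intertwines_transport d).apply (δ x)
      have e2 := congrArg e.equiv (h' x)
      simp only [map_add, map_zero] at e2
      change (e.transport d).map (β (d'.map (e'.equiv.symm (e'.equiv x))) +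
          e.equiv (δ (e'.equiv.symm (e'.equiv x))) -
          (e.transport d).map (β (e'.equiv.symm (e'.equiv x)))) +
        (β (d'.map (e'.equiv.symm ((e'.transport d').map (e'.equiv x)))) +
          e.equiv (δ (e'.equiv.symm ((e'.transport d').map (e'.equiv x)))) -
          (e.transport d).map (β (e'.equiv.symm ((e'.transport d').map (e'.equiv x))))) = 0
      rw [← (e'.intertwines_transport d').apply]
      simp only [LinearEquiv.symm_apply_apply, map_add, map_sub, FlagDifferential.map_map,
        map_zero]
      linear_combination (norm := abel) e2 - e1
    · refine LinearMap.ext fun x => ?_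
      change β (d'.map x) + e.equiv (δ x) = (e.transport d).map (β x) +
        (β (d'.map (e'.equiv.symm (e'.equiv x))) +
          e.equiv (δ (e'.equiv.symm (e'.equiv x))) -
          (e.transport d).map (β (e'.equiv.symm (e'.equiv x))))
      rw [LinearEquiv.symm_apply_apply]
      abel

/-- The block `δ₁₂` is removed by the automorphism of `V ⊕ Y` with off-diagonal block
`-δ₁₂ e'⁻¹`. -/
theorem extension_isoTriple_basis (e : FlagIso U V) (e' : FlagIso X Y) {d : FlagDifferential U}
    {d' : FlagDifferential X} (δ : Extension (e.triple d) (e'.triple d')) :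
    δ.triple.basis = ((e.prod e').triple δ.triple.dSrc).basis := by
  refine Triple.basis_eq (FlagIso.refl _)
    ((FlagIso.refl V).block (-(δ.δ₁₂ ∘ₗ e'.symm.map))
      (neg_mem (homDeg_comp e'.symm.mem_homDeg δ.mem₁₂ (zero_add 0))) (FlagIso.refl Y))
    (fun _ => rfl) (fun p => ?_) fun p => ?_
  · refine Prod.ext ?_ rfl
    obtain ⟨x, hx⟩ := e'.equiv.surjective p.2
    change (e.transport d).map p.1 + δ.δ₂₂ p.2 +
        -(δ.δ₁₂ (e'.equiv.symm ((e'.transport d').map p.2))) =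
      e.equiv (d.map (e.equiv.symm (p.1 + -(δ.δ₁₂ (e'.equiv.symm p.2)))) +
        δ.δ₁₁ (e'.equiv.symm p.2))
    rw [← hx, ← (e'.intertwines_transport d').apply]
    have e1 : δ.δ₁₂ (d'.map x) + e.equiv (δ.δ₁₁ x) =
      (e.transport d).map (δ.δ₁₂ x) + δ.δ₂₂ (e'.equiv x) := δ.apply₁₂ x
    simp only [LinearEquiv.symm_apply_apply, map_add, map_neg, FlagIso.transport_apply] at e1 ⊢
    linear_combination (norm := abel) -e1
  · refine Prod.ext ?_ rfl
    change e.equiv p.1 + δ.δ₁₂ p.2 + -(δ.δ₁₂ (e'.equiv.symm (e'.equiv p.2))) = e.equiv p.1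
    rw [LinearEquiv.symm_apply_apply, add_neg_cancel_right]

variable [Finite k]

/-- The monoidal product of the morphisms induced by `e` and `e'` is induced by `e ⊕ e'`. -/
theorem hTensor_hom (e : FlagIso U V) (e' : FlagIso X Y) :
    hTensor k U V X Y e.hom e'.hom = (e.prod e').hom := by
  have hsum : ∑ᶠ d : FlagDifferential U, ∑ᶠ d' : FlagDifferential X,
      ∑ᶠ δ : Extension (e.triple d) (e'.triple d'), δ.triple.basis =
      homCard X V 0 • ∑ᶠ D : FlagDifferential (U.prod X), ((e.prod e').triple D).basis := by
    simp only [← finsum_sigma_of_finite]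
    rw [finsum_eq_of_bijective
      (g := fun q : FlagDifferential (U.prod X) × homDeg X V 0 => ((e.prod e').triple q.1).basis)
      _ (extension_isoTriple_bijective e e') fun p => extension_isoTriple_basis e e' p.2.2]
    rw [finsum_prod_of_finite (fun (D : FlagDifferential (U.prod X)) (_ : homDeg X V 0) =>
      ((e.prod e').triple D).basis)]
    simp only [finsum_const_of_finite]
    rw [← smul_finsum, homCard]
  rw [e.hom_eq, e'.hom_eq, map_smul, map_smul, LinearMap.smul_apply, map_finsum_left_of_finite]
  simp only [map_finsum_of_finite, hTensor_basis, Triple.tensor_eq, ← smul_finsum]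
  rw [hsum, FlagIso.hom_eq, smul_smul, smul_smul, smul_smul]
  congr 1
  rw [tensorCoeff_eq, idCoeff_eq, idCoeff_eq, idCoeff_eq, FlagSpace.dim_prod, lowerEuler_prod,
    ← e'.euler_left V, pow_add]
  have h1 := euler_ne_zero X V
  have h2 := homCard_ne_zero X V 0
  have h3 := euler_ne_zero X U
  field_simp

end

/-! ### Morphism complexes into an acyclic complex -/

section

variable {k : Type u} [Field k] {A B : FlagSpace.{u, v} k}

/-- The homogeneous maps `F` of degree `n` with `d_B F = c F d_A`. For `c = (-1)^n` these are the
cocycles of the morphism complex; the sign is kept as a free parameter, since all that is needed is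
that it changes with the degree. -/
def homCocycles (dA : FlagDifferential A) (dB : FlagDifferential B) (n : ℤ) (c : k) :
    Submodule k (A →ₗ[k] B) where
  carrier := {F | F ∈ homDeg A B n ∧ ∀ x, dB.map (F x) - c • F (dA.map x) = 0}
  add_mem' hF hG := ⟨add_mem hF.1 hG.1, fun x => by
    have h1 := hF.2 x
    have h2 := hG.2 x
    simp only [LinearMap.add_apply, map_add, smul_add]
    rw [add_sub_add_comm, h1, h2, add_zero]⟩
  zero_mem' := ⟨zero_mem _, fun x => by simp⟩
  smul_mem' r F hF := ⟨Submodule.smul_mem _ r hF.1, fun x => by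
    simp only [LinearMap.smul_apply, map_smul]
    rw [smul_comm c r, ← smul_sub, hF.2 x, smul_zero]⟩

/-- The differential `F ↦ d_B F - c F d_A`. -/
def homDifferential (dA : FlagDifferential A) (dB : FlagDifferential B) (c : k) :
    (A →ₗ[k] B) →ₗ[k] (A →ₗ[k] B) where
  toFun F := dB.map ∘ₗ F - c • F ∘ₗ dA.map
  map_add' F G := LinearMap.ext fun x => by
    simp only [LinearMap.sub_apply, LinearMap.add_apply, LinearMap.comp_apply, map_add,
      LinearMap.smul_apply, smul_add]
    abel
  map_smul' r F := LinearMap.ext fun x => by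
    simp only [LinearMap.sub_apply, LinearMap.comp_apply, map_smul,
      LinearMap.smul_apply, smul_sub, RingHom.id_apply, smul_comm c r]

theorem homDifferential_apply (dA : FlagDifferential A) (dB : FlagDifferential B) (c : k)
    (F : A →ₗ[k] B) (x : A) :
    homDifferential dA dB c F x = dB.map (F x) - c • F (dA.map x) := rfl

theorem homDifferential_mem {dA : FlagDifferential A} {dB : FlagDifferential B} {n m : ℤ} {c : k}
    {F : A →ₗ[k] B} (hF : F ∈ homDeg A B n) (hm : n + 1 = m) :
    homDifferential dA dB c F ∈ homCocycles dA dB m (-c) := by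
  refine ⟨sub_mem (homDeg_comp hF dB.mem.1 hm)
    (Submodule.smul_mem _ c (homDeg_comp dA.mem.1 hF (by omega))), fun x => ?_⟩
  simp only [homDifferential_apply, map_sub, map_smul, FlagDifferential.map_map, map_zero,
    smul_zero, sub_zero, neg_smul]
  abel

/-- A contraction of the target contracts the morphism complex. -/
theorem homDifferential_contraction {dA : FlagDifferential A} {dB : FlagDifferential B} {n : ℤ}
    {c : k} {s : B →ₗ[k] B} (hs : ∀ x, dB.map (s x) + s (dB.map x) = x) {G : A →ₗ[k] B}
    (hG : G ∈ homCocycles dA dB n (-c)) : homDifferential dA dB c (s ∘ₗ G) = G := by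
  refine LinearMap.ext fun x => ?_
  have h1 := hs (G x)
  have h2 := congrArg s (hG.2 x)
  simp only [neg_smul, sub_neg_eq_add, map_add, map_smul, map_zero] at h2
  rw [homDifferential_apply, LinearMap.comp_apply, LinearMap.comp_apply]
  linear_combination (norm := abel) h1 - h2

/-- If the target is contractible then `D : Hom^n(A, B) → Z^{n+1}` is surjective with kernel
`Z^n`. -/
theorem card_homDeg_eq_mul {dA : FlagDifferential A} {dB : FlagDifferential B}
    {s : B →ₗ[k] B} (hs0 : s ∈ homDeg B B (-1)) (hs : ∀ x, dB.map (s x) + s (dB.map x) = x)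
    {n m : ℤ} (hm : n + 1 = m) (c : k) :
    Nat.card (homDeg A B n) =
      Nat.card (homCocycles dA dB m (-c)) * Nat.card (homCocycles dA dB n c) := by
  let φ : homDeg A B n →ₗ[k] homCocycles dA dB m (-c) :=
    ((homDifferential dA dB c).domRestrict _).codRestrict _ fun F => homDifferential_mem F.2 hm
  have hφ : Function.Surjective φ := fun G =>
    ⟨⟨s ∘ₗ G.1, homDeg_comp G.2.1 hs0 (by omega)⟩,
      Subtype.ext (homDifferential_contraction hs G.2)⟩
  have hker : LinearMap.ker φ ≃ homCocycles dA dB n c :=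
    { toFun := fun F => ⟨F.1.1, F.1.2, fun x =>
        LinearMap.congr_fun (congrArg Subtype.val (LinearMap.mem_ker.mp F.2)) x⟩
      invFun := fun F => ⟨⟨F.1, F.2.1⟩, LinearMap.mem_ker.mpr
        (Subtype.ext (LinearMap.ext fun x => F.2.2 x))⟩
      left_inv := fun _ => rfl
      right_inv := fun _ => rfl }
  rw [Submodule.card_eq_card_quotient_mul_card (LinearMap.ker φ),
    Nat.card_congr (φ.quotKerEquivOfSurjective hφ).toEquiv, Nat.card_congr hker, mul_comm]

variable [Finite k]

/-- The number of cocycles of degree `0` of an acyclic morphism complex: since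
`|Hom^{-i-1}| = |Z^{-i}| |Z^{-i-1}|`, the alternating product of these numbers telescopes. -/
theorem card_homCocycles {dA : FlagDifferential A} {dB : FlagDifferential B}
    {s : B →ₗ[k] B} (hs0 : s ∈ homDeg B B (-1)) (hs : ∀ x, dB.map (s x) + s (dB.map x) = x) :
    (Nat.card (homCocycles dA dB 0 1) : ℚ) = homCard A B 0 / euler A B := by
  have hz : (fun i : ℕ => (Nat.card (homCocycles dA dB (-(i : ℤ)) ((-1) ^ i)) : ℚ)
      ).HasFiniteMulSupport := by
    refine ((finite_setOf_homDeg_ne_bot A B).preimage neg_natCast_injective.injOn).subset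
      fun i hi h => hi ?_
    have h' : homCocycles dA dB (-(i : ℤ)) ((-1) ^ i) = ⊥ := by
      rw [← le_bot_iff, ← (h : homDeg A B (-(i : ℤ)) = ⊥)]
      exact fun F hF => hF.1
    simp [h']
  have h := altProd_telescope hz (fun i => Nat.cast_ne_zero.mpr Nat.card_pos.ne')
    (a := fun i => homCard A B (-(i : ℤ) - 1)) fun i => by
      rw [homCard, card_homDeg_eq_mul hs0 hs (sub_add_cancel _ 1) ((-1) ^ (i + 1)), Nat.cast_mul,
        pow_succ, mul_neg_one, neg_neg, Nat.cast_add, Nat.cast_one, neg_add']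
  rw [altProd_homCard_succ] at h
  rw [h]
  simp

/-- If the target is contractible then the equation `D F = G` has as many solutions `F` of degree
`0` for every cocycle `G`. -/
theorem card_homDifferential_fiber {dA : FlagDifferential A} {dB : FlagDifferential B}
    {s : B →ₗ[k] B} (hs0 : s ∈ homDeg B B (-1)) (hs : ∀ x, dB.map (s x) + s (dB.map x) = x)
    {G : A →ₗ[k] B} (hG : G ∈ homCocycles dA dB 1 (-1)) :
    (Nat.card {F // F ∈ homDeg A B 0 ∧ homDifferential dA dB 1 F = G} : ℚ) =
      homCard A B 0 / euler A B := by
  rw [← card_homCocycles (dA := dA) hs0 hs]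
  have h0 : s ∘ₗ G ∈ homDeg A B 0 := homDeg_comp hG.1 hs0 (by omega)
  have h1 : homDifferential dA dB 1 (s ∘ₗ G) = G := homDifferential_contraction hs hG
  refine congrArg Nat.cast (Nat.card_congr
    { toFun := fun F => ⟨F.1 - s ∘ₗ G, sub_mem F.2.1 h0, fun x => ?_⟩
      invFun := fun F => ⟨F.1 + s ∘ₗ G, add_mem F.2.1 h0, ?_⟩
      left_inv := fun F => Subtype.ext (sub_add_cancel _ _)
      right_inv := fun F => Subtype.ext (add_sub_cancel_right _ _) })
  · rw [← homDifferential_apply, map_sub, F.2.2, h1, sub_self]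
    rfl
  · rw [map_add, h1]
    have : homDifferential dA dB 1 F.1 = 0 := LinearMap.ext F.2.2
    rw [this, zero_add]

end

/-! ### Mapping cones -/

section

variable {k : Type u} [Field k] {X Y V W : FlagSpace.{u, v} k}

/-- The differential `-d` on the shift. -/
def FlagDifferential.shift (d : FlagDifferential X) : FlagDifferential X.shift where
  map := -d.map
  mem := ⟨fun i x hx => neg_mem (S := Submodule k X) (d.mem.1 (i + 1) x hx),
    fun j x hx => neg_mem (S := Submodule k X) (d.mem.2 j x hx)⟩
  sq := by
    have h : ∀ x : X, -d.map (-d.map x) = 0 := fun x => by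
      rw [map_neg, d.map_map, neg_zero, neg_zero]
    exact LinearMap.ext h

/-- The differential of the mapping cone `Y ⊕ X[1]` of a quasi-isomorphism from `X` to `Y`. -/
def Triple.coneDifferential (s : Triple X Y) : FlagDifferential (Y.prod X.shift) :=
  blockDifferential s.dTgt s.dSrc.shift s.map
    (mem_homDeg_shift_left.mpr s.isQuasiIso.mem_homDeg)
    (by
      have h : ∀ x : X, s.dTgt.map (s.map x) + s.map (-s.dSrc.map x) = 0 := fun x => by
        rw [map_neg, s.map_comm, add_neg_cancel]
      exact LinearMap.ext h)

/-- The mapping cone of a quasi-isomorphism is contractible. -/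
theorem Triple.exists_coneContraction (s : Triple X Y) :
    ∃ h ∈ homDeg (Y.prod X.shift) (Y.prod X.shift) (-1),
      ∀ p, s.coneDifferential.map (h p) + h (s.coneDifferential.map p) = p := by
  refine exists_contraction s.coneDifferential.mem.1 fun p => ⟨fun hp => ?_, ?_⟩
  · obtain ⟨-, -, hinj, hsurj⟩ := (isQuasiIso_iff _ _ _).mp s.isQuasiIso
    have h1 : s.dTgt.map p.1 + s.map p.2 = 0 := congrArg Prod.fst hp
    have h2 : -s.dSrc.map p.2 = 0 := congrArg Prod.snd hp
    obtain ⟨z, hz⟩ := hinj p.2 (-p.1) (neg_eq_zero.mp h2) (by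
      rw [map_neg]
      exact (neg_eq_of_add_eq_zero_right h1).symm)
    obtain ⟨x, y, hx, hy⟩ := hsurj (p.1 + s.map z) (by
      rw [map_add, ← s.map_comm, ← hz, h1])
    refine ⟨((y, x - z) : Y × X), Prod.ext ?_ ?_⟩
    · change s.dTgt.map y + s.map (x - z) = p.1
      rw [map_sub]
      linear_combination (norm := abel) -hy
    · change -s.dSrc.map (x - z) = p.2
      rw [map_sub, hx, hz]
      abel
  · rintro ⟨q, rfl⟩
    exact s.coneDifferential.map_map q

end

/-! ### Composites of extensions -/

section

variable {k : Type u} [Field k] {U V W X Y Z : FlagSpace.{u, v} k}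

/-- The composite of two triples with the same differential in the middle. -/
def Triple.seq (t : Triple U V) (t' : Triple V W) (h : t.dTgt = t'.dSrc) : Triple U W where
  dSrc := t.dSrc
  map := t'.map ∘ₗ t.map
  dTgt := t'.dTgt
  isQuasiIso := t'.isQuasiIso.comp (h ▸ t.isQuasiIso)

variable {t : Triple U V} {t' : Triple V W} {s : Triple X Y} {s' : Triple Y Z}

/-- The off-diagonal part of the product of the block matrices of two extensions. -/
def Extension.seq (δ : Extension t s) (ε : Extension t' s') (ht : t.dTgt = t'.dSrc)
    (hs : s.dTgt = s'.dSrc) (h : δ.δ₂₂ = ε.δ₁₁) : Extension (t.seq t' ht) (s.seq s' hs) where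
  δ₁₁ := δ.δ₁₁
  δ₁₂ := ε.δ₁₂ ∘ₗ s.map + t'.map ∘ₗ δ.δ₁₂
  δ₂₂ := ε.δ₂₂
  mem₁₁ := δ.mem₁₁
  mem₁₂ := add_mem (homDeg_comp s.isQuasiIso.mem_homDeg ε.mem₁₂ (add_zero 0))
    (homDeg_comp δ.mem₁₂ t'.isQuasiIso.mem_homDeg (add_zero 0))
  mem₂₂ := ε.mem₂₂
  eq₁₁ := δ.eq₁₁
  eq₂₂ := ε.eq₂₂
  eq₁₂ := LinearMap.ext fun x => by
    have e1 := ε.apply₁₂ (s.map x)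
    have e2 := congrArg t'.map (δ.apply₁₂ x)
    have e3 := t'.map_comm (δ.δ₁₂ x)
    simp only [map_add, h, ht] at e1 e2
    simp only [Triple.seq, LinearMap.add_apply, LinearMap.comp_apply, map_add, s.map_comm, hs]
    linear_combination (norm := abel) e1 + e2 + e3

/-- The linear map from `Y ⊕ X[1]` to `W ⊕ V[1]` with block matrix `[a, h; r, p]`. -/
def coneMap (a : Y →ₗ[k] W) (h : X →ₗ[k] W) (r : Y →ₗ[k] V) (p : X →ₗ[k] V) :
    Y.prod X.shift →ₗ[k] W.prod V.shift :=
  LinearMap.prod (LinearMap.coprod a h) (LinearMap.coprod r p)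

theorem coneMap_mem_homDeg {a : Y →ₗ[k] W} {h : X →ₗ[k] W} {r : Y →ₗ[k] V} {p : X →ₗ[k] V}
    (ha : a ∈ homDeg Y W 0) (hh : h ∈ homDeg X W (-1)) (hr : r ∈ homDeg Y V 1)
    (hp : p ∈ homDeg X V 0) : coneMap a h r p ∈ homDeg (Y.prod X.shift) (W.prod V.shift) 0 := by
  rw [mem_homDeg_zero] at ha hp ⊢
  refine fun i q hq => ⟨add_mem (ha i q.1 hq.1) ?_,
    add_mem (S := Submodule k V) (hr i q.1 hq.1) (hp (i + 1) q.2 hq.2)⟩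
  have := hh (i + 1) q.2 hq.2
  rwa [add_neg_cancel_right] at this

theorem coneMap_injective {a a' : Y →ₗ[k] W} {h h' : X →ₗ[k] W} {r r' : Y →ₗ[k] V}
    {p p' : X →ₗ[k] V} (e : coneMap a h r p = coneMap a' h' r' p') :
    a = a' ∧ h = h' ∧ r = r' ∧ p = p' := by
  have h1 : ∀ q : Y × X, a q.1 + h q.2 = a' q.1 + h' q.2 := fun q =>
    congrArg Prod.fst (LinearMap.congr_fun e q)
  have h2 : ∀ q : Y × X, r q.1 + p q.2 = r' q.1 + p' q.2 := fun q =>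
    congrArg Prod.snd (LinearMap.congr_fun e q)
  refine ⟨LinearMap.ext fun x => ?_, LinearMap.ext fun x => ?_, LinearMap.ext fun x => ?_,
    LinearMap.ext fun x => ?_⟩
  · simpa using h1 (x, 0)
  · simpa using h1 (0, x)
  · simpa using h2 (x, 0)
  · simpa using h2 (0, x)

theorem exists_eq_coneMap {F : Y.prod X.shift →ₗ[k] W.prod V.shift}
    (hF : F ∈ homDeg (Y.prod X.shift) (W.prod V.shift) 0) :
    ∃ (a : Y →ₗ[k] W) (h : X →ₗ[k] W) (r : Y →ₗ[k] V) (p : X →ₗ[k] V),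
      a ∈ homDeg Y W 0 ∧ h ∈ homDeg X W (-1) ∧ r ∈ homDeg Y V 1 ∧ p ∈ homDeg X V 0 ∧
        F = coneMap a h r p := by
  rw [mem_homDeg_zero] at hF
  refine ⟨LinearMap.fst k W V ∘ₗ F ∘ₗ LinearMap.inl k Y X,
    LinearMap.fst k W V ∘ₗ F ∘ₗ LinearMap.inr k Y X,
    LinearMap.snd k W V ∘ₗ F ∘ₗ LinearMap.inl k Y X,
    LinearMap.snd k W V ∘ₗ F ∘ₗ LinearMap.inr k Y X, fun i y hy => ?_, fun i x hx => ?_,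
    fun i y hy => (hF i (y, 0) ⟨hy, zero_mem _⟩).2, fun i x hx => ?_, LinearMap.ext fun q => ?_⟩
  · rw [add_zero]
    exact (hF i (y, 0) ⟨hy, zero_mem _⟩).1
  · refine (hF (i + -1) (0, x) ⟨zero_mem _, ?_⟩).1
    change x ∈ X.deg (i + -1 + 1)
    rwa [neg_add_cancel_right]
  · have h : (F ((0, x) : Y × X)).2 ∈ V.deg (i + -1 + 1) := by
      refine (hF (i + -1) (0, x) ⟨zero_mem _, ?_⟩).2
      change x ∈ X.deg (i + -1 + 1)
      rwa [neg_add_cancel_right]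
    rw [neg_add_cancel_right] at h
    rwa [add_zero]
  · have hq : q = ((q.1, 0) : Y × X) + ((0, q.2) : Y × X) :=
      Prod.ext (add_zero _).symm (zero_add _).symm
    conv_lhs => rw [hq]
    exact map_add F _ _

theorem homDifferential_coneMap (a : Y →ₗ[k] W) (h : X →ₗ[k] W) (r : Y →ₗ[k] V)
    (p : X →ₗ[k] V) (q : Y × X) :
    homDifferential s.coneDifferential t'.coneDifferential 1 (coneMap a h r p) q =
      ((t'.dTgt.map (a q.1 + h q.2) + t'.map (r q.1 + p q.2) -
          (a (s.dTgt.map q.1 + s.map q.2) + h (-s.dSrc.map q.2)),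
        -t'.dSrc.map (r q.1 + p q.2) -
          (r (s.dTgt.map q.1 + s.map q.2) + p (-s.dSrc.map q.2))) : W × V) := by
  have e := homDifferential_apply s.coneDifferential t'.coneDifferential 1 (coneMap a h r p) q
  rw [one_smul] at e
  exact e

variable (ht : t.dTgt = t'.dSrc) (hs : s.dTgt = s'.dSrc)

/-- The map `G = [δ₂₂ s', δ₁₂; 0, -t δ₁₁]` from the cone of `s` to the cone of `t'` attached to an
extension of composites. It is a cocycle of degree `1` of the morphism complex, and its class is
the obstruction to writing the extension, up to homotopy, as a product of two extensions. -/
def Extension.obstruction (γ : Extension (t.seq t' ht) (s.seq s' hs)) :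
    Y.prod X.shift →ₗ[k] W.prod V.shift :=
  blockMap (X := X.shift) (Y := V.shift) (γ.δ₂₂ ∘ₗ s'.map) γ.δ₁₂ (-(t.map ∘ₗ γ.δ₁₁))

theorem Extension.obstruction_apply (γ : Extension (t.seq t' ht) (s.seq s' hs)) (q : Y × X) :
    γ.obstruction ht hs q =
      ((γ.δ₂₂ (s'.map q.1) + γ.δ₁₂ q.2, -(t.map (γ.δ₁₁ q.2))) : W × V) := rfl

theorem Extension.obstruction_mem (γ : Extension (t.seq t' ht) (s.seq s' hs)) :
    γ.obstruction ht hs ∈ homCocycles s.coneDifferential t'.coneDifferential 1 (-1) := by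
  constructor
  · refine blockMap_mem_homDeg (homDeg_comp s'.isQuasiIso.mem_homDeg γ.mem₂₂ (zero_add 1))
      (mem_homDeg_shift_left.mpr γ.mem₁₂) ?_
    have h : -(t.map ∘ₗ γ.δ₁₁) ∈ homDeg X V 1 :=
      neg_mem (homDeg_comp γ.mem₁₁ t.isQuasiIso.mem_homDeg (add_zero 1))
    exact fun i x hx => by
      have := h (i + 1) x hx
      change _ ∈ V.deg (i + 1 + 1)
      exact this
  · have key : ∀ q : Y × X,
        ((t'.dTgt.map (γ.δ₂₂ (s'.map q.1) + γ.δ₁₂ q.2) + t'.map (-(t.map (γ.δ₁₁ q.2))) +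
          (γ.δ₂₂ (s'.map (s.dTgt.map q.1 + s.map q.2)) + γ.δ₁₂ (-s.dSrc.map q.2)),
        -t'.dSrc.map (-(t.map (γ.δ₁₁ q.2))) + -(t.map (γ.δ₁₁ (-s.dSrc.map q.2)))) : W × V) = 0 := by
      intro q
      have e1 : t'.dTgt.map (γ.δ₂₂ (s'.map q.1)) + γ.δ₂₂ (s'.dTgt.map (s'.map q.1)) = 0 :=
        γ.apply₂₂ (s'.map q.1)
      have e2 : γ.δ₁₂ (s.dSrc.map q.2) + t'.map (t.map (γ.δ₁₁ q.2)) =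
        t'.dTgt.map (γ.δ₁₂ q.2) + γ.δ₂₂ (s'.map (s.map q.2)) := γ.apply₁₂ q.2
      have e3 : t.dSrc.map (γ.δ₁₁ q.2) + γ.δ₁₁ (s.dSrc.map q.2) = 0 := γ.apply₁₁ q.2
      have e4 := congrArg t.map e3
      rw [map_add, t.map_comm, map_zero, ht] at e4
      rw [← s'.map_comm, ← hs] at e1
      refine Prod.ext ?_ ?_
      · simp only [map_add, map_neg, Prod.fst_zero]
        linear_combination (norm := abel) e1 - e2
      · simp only [map_neg, neg_neg, Prod.snd_zero]
        exact e4
    intro q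
    rw [neg_smul, one_smul, sub_neg_eq_add]
    exact key q

/-- The space of pairs of composable extensions. -/
abbrev ExtensionPair (t : Triple U V) (t' : Triple V W) (s : Triple X Y) (s' : Triple Y Z) :=
  {p : Extension t s × Extension t' s' // p.1.δ₂₂ = p.2.δ₁₁}

/-- The composite of a pair of composable extensions, with `δ₁₂` changed by the boundary of a
homotopy `h ∈ Hom^{-1}(X, W)`. -/
def ExtensionPair.shear (p : ExtensionPair t t' s s') (h : homDeg X W (-1)) :
    Extension (t.seq t' ht) (s.seq s' hs) where
  δ₁₁ := p.1.1.δ₁₁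
  δ₁₂ := (p.1.1.seq p.1.2 ht hs p.2).δ₁₂ + (t'.dTgt.map ∘ₗ h.1 + h.1 ∘ₗ s.dSrc.map)
  δ₂₂ := p.1.2.δ₂₂
  mem₁₁ := p.1.1.mem₁₁
  mem₁₂ := add_mem (p.1.1.seq p.1.2 ht hs p.2).mem₁₂
    (add_mem (homDeg_comp h.2 t'.dTgt.mem.1 (by omega)) (homDeg_comp s.dSrc.mem.1 h.2 (by omega)))
  mem₂₂ := p.1.2.mem₂₂
  eq₁₁ := p.1.1.eq₁₁
  eq₂₂ := p.1.2.eq₂₂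
  eq₁₂ := LinearMap.ext fun x => by
    have e1 := (p.1.1.seq p.1.2 ht hs p.2).apply₁₂ x
    simp only [Extension.seq, Triple.seq, LinearMap.add_apply, LinearMap.comp_apply] at e1
    simp only [Extension.seq, Triple.seq, LinearMap.add_apply, LinearMap.comp_apply, map_add,
      FlagDifferential.map_map, map_zero] at e1 ⊢
    linear_combination (norm := abel) e1

theorem ExtensionPair.basis_shear (p : ExtensionPair t t' s s') (h : homDeg X W (-1)) :
    (p.1.1.seq p.1.2 ht hs p.2).triple.basis = (p.shear ht hs h).triple.basis := by
  refine Triple.basis_eq_of_equiv ⟨FlagIso.refl _, FlagIso.refl _, rfl, rfl,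
    blockMap 0 (-h.1) 0, blockMap_mem_homDeg (zero_mem _) (neg_mem h.2) (zero_mem _),
    LinearMap.ext fun q => ?_⟩
  refine Prod.ext ?_ ?_
  · change (t'.map (t.map q.1) + (p.1.1.seq p.1.2 ht hs p.2).δ₁₂ q.2) -
      (t'.map (t.map q.1) + ((p.1.1.seq p.1.2 ht hs p.2).δ₁₂ q.2 +
        (t'.dTgt.map (h.1 q.2) + h.1 (s.dSrc.map q.2)))) =
      (t'.dTgt.map (0 + -h.1 q.2) + p.1.2.δ₂₂ 0) + (0 + -h.1 (s.dSrc.map q.2))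
    simp only [map_zero, zero_add, add_zero, map_neg]
    abel
  · change s'.map (s.map q.2) - s'.map (s.map q.2) = s'.dTgt.map 0 + 0
    rw [map_zero, sub_self, add_zero]

theorem ExtensionPair.homDifferential_coneMap_eq (p : ExtensionPair t t' s s')
    (h : homDeg X W (-1)) :
    homDifferential s.coneDifferential t'.coneDifferential 1
      (coneMap (-p.1.2.δ₁₂) h.1 p.1.1.δ₂₂ p.1.1.δ₁₂) = (p.shear ht hs h).obstruction ht hs := by
  have key : ∀ y : Y × X, homDifferential s.coneDifferential t'.coneDifferential 1
      (coneMap (-p.1.2.δ₁₂) h.1 p.1.1.δ₂₂ p.1.1.δ₁₂) y =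
        ((p.1.2.δ₂₂ (s'.map y.1) + (p.1.2.δ₁₂ (s.map y.2) + t'.map (p.1.1.δ₁₂ y.2) +
          (t'.dTgt.map (h.1 y.2) + h.1 (s.dSrc.map y.2))),
          -(t.map (p.1.1.δ₁₁ y.2))) : W × V) := fun y => by
    refine (homDifferential_coneMap _ _ _ _ y).trans ?_
    have e1 := p.1.2.apply₁₂ y.1
    have e2 := p.1.1.apply₂₂ y.1
    have e3 := p.1.1.apply₁₂ y.2
    rw [← p.2, ← hs] at e1
    rw [ht] at e2 e3
    refine Prod.ext ?_ ?_
    · simp only [map_add, map_neg, LinearMap.neg_apply]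
      linear_combination (norm := abel) e1
    · simp only [map_add, map_neg]
      linear_combination (norm := abel) e3 - e2
  exact LinearMap.ext key

/-- The solutions of `D F = G`, where `G` is the obstruction of an extension of composites. -/
abbrev ObstructionSolution :=
  {r : Extension (t.seq t' ht) (s.seq s' hs) × (Y.prod X.shift →ₗ[k] W.prod V.shift) //
    r.2 ∈ homDeg (Y.prod X.shift) (W.prod V.shift) 0 ∧
      homDifferential s.coneDifferential t'.coneDifferential 1 r.2 = r.1.obstruction ht hs}

/-- The solution `F = [-ε₁₂, h; δ₂₂, δ₁₂]` of `D F = G` determined by a pair `(δ, ε)` of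
composable extensions and a homotopy `h`. The entries of `D F = G` are, in this order, the
equation for `ε₁₂`, the formula for the block `δ₁₂` of the composite up to the boundary of `h`,
and the equations for `δ₂₂` and for `δ₁₂`. -/
def ExtensionPair.solution (q : ExtensionPair t t' s s' × homDeg X W (-1)) :
    ObstructionSolution ht hs :=
  ⟨(q.1.shear ht hs q.2, coneMap (-q.1.1.2.δ₁₂) q.2.1 q.1.1.1.δ₂₂ q.1.1.1.δ₁₂),
    coneMap_mem_homDeg (neg_mem q.1.1.2.mem₁₂) q.2.2 q.1.1.1.mem₂₂ q.1.1.1.mem₁₂,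
    q.1.homDifferential_coneMap_eq ht hs q.2⟩

/-- Pairs of composable extensions with given composite up to homotopy correspond to solutions of
`D F = G`, where `G` is the obstruction. -/
theorem ExtensionPair.solution_bijective :
    Function.Bijective (ExtensionPair.solution (t := t) (t' := t') (s := s) (s' := s') ht hs) := by
  constructor
  · rintro ⟨⟨⟨δ, ε⟩, hp⟩, h⟩ ⟨⟨⟨δ', ε'⟩, hp'⟩, h'⟩ hq
    obtain ⟨k1, k2, k3, k4⟩ := coneMap_injective (congrArg (fun r => r.1.2) hq)
    have k5 : δ.δ₁₁ = δ'.δ₁₁ := congrArg (fun r => r.1.1.δ₁₁) hq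
    have k6 : ε.δ₂₂ = ε'.δ₂₂ := congrArg (fun r => r.1.1.δ₂₂) hq
    obtain rfl : δ = δ' := Extension.ext k5 k4 k3
    obtain rfl : ε = ε' := Extension.ext (hp.symm.trans hp') (neg_injective k1) k6
    obtain rfl : h = h' := Subtype.ext k2
    rfl
  · rintro ⟨⟨γ, F⟩, hF, hFD⟩
    obtain ⟨a, h, r, p, ha, hh, hr, hp, rfl⟩ := exists_eq_coneMap hF
    have hD := fun q : Y × X => ((homDifferential_coneMap (t' := t') (s := s) a h r p q).symm.trans
      (LinearMap.congr_fun hFD q)).trans (γ.obstruction_apply ht hs q)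
    have c1 := fun y : Y => congrArg Prod.fst (hD (y, 0))
    have c2 := fun x : X => congrArg Prod.fst (hD (0, x))
    have c3 := fun y : Y => congrArg Prod.snd (hD (y, 0))
    have c4 := fun x : X => congrArg Prod.snd (hD (0, x))
    simp only [map_zero, add_zero, zero_add, neg_zero, map_neg] at c1 c2 c3 c4
    let δ : Extension t s :=
      { δ₁₁ := γ.δ₁₁
        δ₁₂ := p
        δ₂₂ := r
        mem₁₁ := γ.mem₁₁
        mem₁₂ := hp
        mem₂₂ := hr
        eq₁₁ := γ.eq₁₁
        eq₂₂ := LinearMap.ext fun y => by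
          rw [ht]
          change t'.dSrc.map (r y) + r (s.dTgt.map y) = 0
          linear_combination (norm := abel) -c3 y
        eq₁₂ := LinearMap.ext fun x => by
          rw [ht]
          change p (s.dSrc.map x) + t.map (γ.δ₁₁ x) = t'.dSrc.map (p x) + r (s.map x)
          linear_combination (norm := abel) c4 x }
    let ε : Extension t' s' :=
      { δ₁₁ := r
        δ₁₂ := -a
        δ₂₂ := γ.δ₂₂
        mem₁₁ := hr
        mem₁₂ := neg_mem ha
        mem₂₂ := γ.mem₂₂
        eq₁₁ := LinearMap.ext fun y => by
          rw [← hs]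
          change t'.dSrc.map (r y) + r (s.dTgt.map y) = 0
          linear_combination (norm := abel) -c3 y
        eq₂₂ := γ.eq₂₂
        eq₁₂ := LinearMap.ext fun y => by
          rw [← hs]
          change -a (s.dTgt.map y) + t'.map (r y) = t'.dTgt.map (-a y) + γ.δ₂₂ (s'.map y)
          rw [map_neg]
          linear_combination (norm := abel) c1 y }
    refine ⟨(⟨(δ, ε), rfl⟩, ⟨h, hh⟩), Subtype.ext (Prod.ext (Extension.ext rfl
      (LinearMap.ext fun x => ?_) rfl) ?_)⟩
    · change -a (s.map x) + t'.map (p x) + (t'.dTgt.map (h x) + h (s.dSrc.map x)) = γ.δ₁₂ x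
      linear_combination (norm := abel) c2 x
    · change coneMap (- -a) h r p = coneMap a h r p
      rw [neg_neg]

variable [Finite k]

/-- The coefficient that compares sums over pairs of composable extensions with sums over
extensions of composites. -/
def pairCoeff (V W X Y : FlagSpace.{u, v} k) : ℚ :=
  euler X W * euler Y V * homCard Y W 0 * homCard X V 0 /
    (homCard X W 0 * euler Y W * euler X V)

/-- The number of solutions of `D F = G` for maps `F` between the cones. The factor
`|Hom^{-1}(X, W)|` counts the homotopies. -/
theorem homCard_div_euler_cone (V W X Y : FlagSpace.{u, v} k) :
    homCard (Y.prod X.shift) (W.prod V.shift) 0 / euler (Y.prod X.shift) (W.prod V.shift) =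
      homCard X W (-1) * pairCoeff V W X Y := by
  simp only [homCard_prod_left, homCard_prod_right, homCard_shift_left, homCard_shift_right,
    euler_prod_left, euler_prod_right, euler_shift_left, euler_shift_right, pairCoeff, zero_sub,
    zero_add]
  have h1 := homCard_ne_zero X W (-1)
  have h2 := homCard_ne_zero X W 0
  have h3 := homCard_ne_zero Y V 1
  have h4 := homCard_ne_zero X V 0
  have h5 := euler_ne_zero X W
  have h6 := euler_ne_zero Y V
  have h7 := euler_ne_zero Y W
  have h8 := euler_ne_zero X V
  rw [sub_self]
  field_simp

/-- Every extension of the composites is, up to equivalence, obtained equally often from a pair of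
composable extensions. -/
theorem finsum_extensionPair :
    ∑ᶠ p : ExtensionPair t t' s s', (p.1.1.seq p.1.2 ht hs p.2).triple.basis =
      pairCoeff V W X Y •
        ∑ᶠ γ : Extension (t.seq t' ht) (s.seq s' hs), γ.triple.basis := by
  have h1 : ∑ᶠ q : ExtensionPair t t' s s' × homDeg X W (-1),
      (q.1.1.1.seq q.1.1.2 ht hs q.1.2).triple.basis =
      homCard X W (-1) •
        ∑ᶠ p : ExtensionPair t t' s s', (p.1.1.seq p.1.2 ht hs p.2).triple.basis := by
    rw [finsum_prod_of_finite (fun (p : ExtensionPair t t' s s') (_ : homDeg X W (-1)) =>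
      (p.1.1.seq p.1.2 ht hs p.2).triple.basis)]
    simp only [finsum_const_of_finite]
    rw [← smul_finsum, homCard]
  have h2 : ∑ᶠ q : ExtensionPair t t' s s' × homDeg X W (-1),
      (q.1.1.1.seq q.1.1.2 ht hs q.1.2).triple.basis =
      (homCard X W (-1) * pairCoeff V W X Y) •
        ∑ᶠ γ : Extension (t.seq t' ht) (s.seq s' hs), γ.triple.basis := by
    rw [finsum_eq_of_bijective (g := fun r : ObstructionSolution ht hs => r.1.1.triple.basis) _
      (ExtensionPair.solution_bijective ht hs) fun q => q.1.basis_shear ht hs q.2]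
    refine (finsum_comp_equiv (Equiv.subtypeProdEquivSigmaSubtype
      (fun (γ : Extension (t.seq t' ht) (s.seq s' hs))
        (F : Y.prod X.shift →ₗ[k] W.prod V.shift) =>
        F ∈ homDeg (Y.prod X.shift) (W.prod V.shift) 0 ∧
      homDifferential s.coneDifferential t'.coneDifferential 1 F = γ.obstruction ht hs)).symm
      ).symm.trans ?_
    refine (finsum_sigma_of_finite (fun (γ : Extension (t.seq t' ht) (s.seq s' hs))
      (_ : {F // F ∈ homDeg (Y.prod X.shift) (W.prod V.shift) 0 ∧
        homDifferential s.coneDifferential t'.coneDifferential 1 F = γ.obstruction ht hs}) =>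
      γ.triple.basis)).trans ?_
    obtain ⟨c, hc0, hc⟩ := t'.exists_coneContraction
    simp only [finsum_const_of_finite,
      card_homDifferential_fiber hc0 hc (Extension.obstruction_mem ht hs _)]
    rw [← smul_finsum, homCard_div_euler_cone]
  rw [h1, mul_smul] at h2
  exact smul_right_injective _ (homCard_ne_zero X W (-1)) h2

end

/-! ### The interchange law -/

section

variable {k : Type u} [Field k] {U V W X Y Z : FlagSpace.{u, v} k}

/-- Automorphisms of `V ⊕ Y` are block upper triangular. -/
theorem FlagIso.exists_eq_block (B : FlagIso (V.prod Y) (V.prod Y)) :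
    ∃ (b : FlagIso V V) (β : Y →ₗ[k] V) (hβ : β ∈ homDeg Y V 0) (b' : FlagIso Y Y),
      B = b.block β hβ b' := by
  have hB0 : ∀ x : V, (B.map ((x, 0) : V × Y)).2 = 0 := fun x => by
    apply snd_eq_zero_of_mem_flag_dim
    refine (B.flag_iff _ _).mpr ⟨?_, zero_mem _⟩
    rw [V.flag_top le_rfl]
    trivial
  have hB := eq_blockMap B.map hB0
  set f := LinearMap.fst k V Y ∘ₗ B.map ∘ₗ LinearMap.inl k V Y
  set g := LinearMap.snd k V Y ∘ₗ B.map ∘ₗ LinearMap.inr k V Y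
  have hf : Function.Injective f := by
    intro x y hxy
    have h1 : B.equiv ((x, 0) : V × Y) = B.equiv ((y, 0) : V × Y) :=
      Prod.ext hxy ((hB0 x).trans (hB0 y).symm)
    exact congrArg Prod.fst (B.equiv.injective h1)
  have hg : Function.Surjective g := by
    intro y
    obtain ⟨p, hp⟩ := B.equiv.surjective ((0, y) : V × Y)
    refine ⟨p.2, ?_⟩
    have h1 : (B.map p).2 = g p.2 := by rw [hB]; rfl
    rw [← h1]
    exact congrArg Prod.snd hp
  refine ⟨FlagIso.ofBijective f ⟨hf, LinearMap.injective_iff_surjective.mp hf⟩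
      (fst_block_mem B.mem_homDeg) fun i x hx => ?_, _, off_block_mem B.mem_homDeg,
    FlagIso.ofBijective g ⟨LinearMap.injective_iff_surjective.mpr hg, hg⟩
      (snd_block_mem B.mem_homDeg) fun i y hy => ?_,
    FlagIso.ext (LinearEquiv.toLinearMap_injective hB)⟩
  · exact ((B.flag_iff i ((x, 0) : V × Y)).mpr ⟨hx, zero_mem _⟩).1
  · have h1 : ((0, y) : V × Y) ∈ (V.prod Y).flag (i + V.dim) := by
      refine ⟨zero_mem _, ?_⟩
      change y ∈ Y.flag (i + V.dim - V.dim)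
      rwa [Nat.add_sub_cancel]
    have h2 : (B.equiv ((0, y) : V × Y)).2 ∈ Y.flag (i + V.dim - V.dim) :=
      ((B.flag_iff _ _).mpr h1).2
    rwa [Nat.add_sub_cancel] at h2

/-- The triple obtained from `s` by replacing the differential of the source along an
isomorphism `b` of complexes. -/
def Triple.along (s : Triple V W) {d : FlagDifferential V} (b : FlagIso V V)
    (hb : b.Intertwines d s.dSrc) : Triple V W where
  dSrc := d
  map := s.map ∘ₗ b.map
  dTgt := s.dTgt
  isQuasiIso := s.isQuasiIso.comp hb.isQuasiIso

variable {t : Triple U V} {t' : Triple V W} {s : Triple X Y} {s' : Triple Y Z}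

/-- The index type of the composite of two monoidal products. -/
abbrev CompTensorIndex (t : Triple U V) (t' : Triple V W) (s : Triple X Y) (s' : Triple Y Z) :=
  Σ (δ : Extension t s) (ε : Extension t' s'),
    {B : FlagIso (V.prod Y) (V.prod Y) // B.Intertwines δ.triple.dTgt ε.triple.dSrc}

theorem CompTensorIndex.ext {p q : CompTensorIndex t t' s s'} (h1 : p.1 = q.1)
    (h2 : p.2.1 = q.2.1) (h3 : p.2.2.1 = q.2.2.1) : p = q := by
  obtain ⟨δ, ε, B, hB⟩ := p
  obtain ⟨δ', ε', B', hB'⟩ := q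
  obtain rfl : δ = δ' := h1
  obtain rfl : ε = ε' := h2
  obtain rfl : B = B' := h3
  rfl

/-- The pairs of composable extensions over all composites of `t`, `t'` and of `s`, `s'`, together
with the off-diagonal entry of an automorphism of `V ⊕ Y`. -/
abbrev TensorCompIndex (t : Triple U V) (t' : Triple V W) (s : Triple X Y) (s' : Triple Y Z) :=
  Σ (b : {b : FlagIso V V // b.Intertwines t.dTgt t'.dSrc})
    (b' : {b : FlagIso Y Y // b.Intertwines s.dTgt s'.dSrc}),
    homDeg Y V 0 × ExtensionPair t (t'.along b.1 b.2) s (s'.along b'.1 b'.2)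

/-- For `B = [b, β; 0, b']` the second extension is determined by the requirement that `B` is an
isomorphism of complexes and that its product with `B` is the given extension. -/
def TensorCompIndex.extension (p : TensorCompIndex t t' s s') : Extension t' s' where
  δ₁₁ := (p.1.1.map ∘ₗ p.2.2.2.1.1.δ₂₂ + p.2.2.1.1 ∘ₗ s.dTgt.map - t'.dSrc.map ∘ₗ p.2.2.1.1) ∘ₗ
    p.2.1.1.symm.map
  δ₁₂ := (p.2.2.2.1.2.δ₁₂ - t'.map ∘ₗ p.2.2.1.1) ∘ₗ p.2.1.1.symm.map
  δ₂₂ := p.2.2.2.1.2.δ₂₂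
  mem₁₁ := homDeg_comp p.2.1.1.symm.mem_homDeg (sub_mem (add_mem
    (homDeg_comp p.2.2.2.1.1.mem₂₂ p.1.1.mem_homDeg (add_zero 1))
    (homDeg_comp s.dTgt.mem.1 p.2.2.1.2 (add_zero 1)))
    (homDeg_comp p.2.2.1.2 t'.dSrc.mem.1 (zero_add 1))) (zero_add 1)
  mem₁₂ := homDeg_comp p.2.1.1.symm.mem_homDeg (sub_mem p.2.2.2.1.2.mem₁₂
    (homDeg_comp p.2.2.1.2 t'.isQuasiIso.mem_homDeg (add_zero 0))) (zero_add 0)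
  mem₂₂ := p.2.2.2.1.2.mem₂₂
  eq₁₁ := by
    obtain ⟨⟨b, hb⟩, ⟨b', hb'⟩, ⟨β, hβ⟩, ⟨⟨δ, ε⟩, hδε⟩⟩ := p
    refine LinearMap.ext fun y => ?_
    obtain ⟨y, rfl⟩ := b'.equiv.surjective y
    have e1 := congrArg b.equiv (δ.apply₂₂ y)
    have e2 := hb.apply (δ.δ₂₂ y)
    simp only [map_add, map_zero] at e1
    simp only [LinearMap.add_apply, LinearMap.sub_apply, LinearMap.comp_apply,
      LinearEquiv.coe_coe, FlagIso.symm_equiv, ← hb'.apply, LinearEquiv.symm_apply_apply,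
      map_add, map_sub, FlagDifferential.map_map, map_zero, LinearMap.zero_apply]
    linear_combination (norm := abel) e1 - e2
  eq₂₂ := p.2.2.2.1.2.eq₂₂
  eq₁₂ := by
    obtain ⟨⟨b, hb⟩, ⟨b', hb'⟩, ⟨β, hβ⟩, ⟨⟨δ, ε⟩, hδε⟩⟩ := p
    refine LinearMap.ext fun y => ?_
    obtain ⟨y, rfl⟩ := b'.equiv.surjective y
    have e1 : ε.δ₁₂ (s.dTgt.map y) + t'.map (b.equiv (ε.δ₁₁ y)) =
      t'.dTgt.map (ε.δ₁₂ y) + ε.δ₂₂ (s'.map (b'.equiv y)) := ε.apply₁₂ y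
    rw [← (show δ.δ₂₂ = ε.δ₁₁ from hδε)] at e1
    have e2 := t'.map_comm (β y)
    simp only [LinearMap.add_apply, LinearMap.sub_apply, LinearMap.comp_apply,
      LinearEquiv.coe_coe, FlagIso.symm_equiv, ← hb'.apply, LinearEquiv.symm_apply_apply,
      map_add, map_sub]
    linear_combination (norm := abel) e1 - e2

/-- The extensions and the automorphism `[b, β; 0, b']` of `V ⊕ Y` determined by an element of
`TensorCompIndex`. -/
def TensorCompIndex.toCompTensor (p : TensorCompIndex t t' s s') : CompTensorIndex t t' s s' :=
  ⟨p.2.2.2.1.1, p.extension, p.1.1.block p.2.2.1.1 p.2.2.1.2 p.2.1.1, by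
    obtain ⟨⟨b, hb⟩, ⟨b', hb'⟩, ⟨β, hβ⟩, ⟨⟨δ, ε⟩, hδε⟩⟩ := p
    refine LinearMap.ext fun q => Prod.ext ?_ (hb'.apply q.2)
    change b.equiv (t.dTgt.map q.1 + δ.δ₂₂ q.2) + β (s.dTgt.map q.2) =
      t'.dSrc.map (b.equiv q.1 + β q.2) + (b.equiv (δ.δ₂₂ (b'.equiv.symm (b'.equiv q.2))) +
        β (s.dTgt.map (b'.equiv.symm (b'.equiv q.2))) -
        t'.dSrc.map (β (b'.equiv.symm (b'.equiv q.2))))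
    simp only [LinearEquiv.symm_apply_apply, map_add, hb.apply]
    abel⟩

/-- The triples attached to corresponding indices are equal, not just equivalent. -/
theorem TensorCompIndex.compAlong_eq (p : TensorCompIndex t t' s s') :
    (p.2.2.2.1.1.seq p.2.2.2.1.2 rfl rfl p.2.2.2.2).triple =
      p.toCompTensor.1.triple.compAlong p.toCompTensor.2.1.triple p.toCompTensor.2.2 := by
  obtain ⟨⟨b, hb⟩, ⟨b', hb'⟩, ⟨β, hβ⟩, ⟨⟨δ, ε⟩, hδε⟩⟩ := p
  refine Triple.ext rfl (LinearMap.ext fun q => Prod.ext ?_ rfl) rfl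
  change t'.map (b.equiv (t.map q.1)) + (ε.δ₁₂ (s.map q.2) + t'.map (b.equiv (δ.δ₁₂ q.2))) =
    t'.map (b.equiv (t.map q.1 + δ.δ₁₂ q.2) + β (s.map q.2)) +
      (ε.δ₁₂ (b'.equiv.symm (b'.equiv (s.map q.2))) -
        t'.map (β (b'.equiv.symm (b'.equiv (s.map q.2)))))
  simp only [LinearEquiv.symm_apply_apply, map_add]
  abel

theorem FlagIso.block_injective {b c : FlagIso V V} {β γ : Y →ₗ[k] V} {hβ : β ∈ homDeg Y V 0}
    {hγ : γ ∈ homDeg Y V 0} {b' c' : FlagIso Y Y} (h : b.block β hβ b' = c.block γ hγ c') :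
    b = c ∧ β = γ ∧ b' = c' := by
  obtain ⟨h1, h2, h3⟩ := blockMap_injective (congrArg FlagIso.map h)
  exact ⟨FlagIso.ext (LinearEquiv.toLinearMap_injective h1), h2,
    FlagIso.ext (LinearEquiv.toLinearMap_injective h3)⟩

theorem TensorCompIndex.toCompTensor_bijective : Function.Bijective
    (TensorCompIndex.toCompTensor (t := t) (t' := t') (s := s) (s' := s')) := by
  constructor
  · rintro ⟨⟨b, hb⟩, ⟨b', hb'⟩, ⟨β, hβ⟩, ⟨⟨δ, ε⟩, hδε⟩⟩
      ⟨⟨c, hc⟩, ⟨c', hc'⟩, ⟨γ, hγ⟩, ⟨⟨η, θ⟩, hηθ⟩⟩ h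
    obtain ⟨h1, h2, h3⟩ := FlagIso.block_injective (hβ := hβ) (hγ := hγ)
      (congrArg (fun p => p.2.2.1) h)
    obtain rfl : b = c := h1
    obtain rfl : β = γ := h2
    obtain rfl : b' = c' := h3
    obtain rfl : δ = η := congrArg (fun p => p.1) h
    have h4 := congrArg (fun p => p.2.1.δ₁₂) h
    have h5 : ε.δ₂₂ = θ.δ₂₂ := congrArg (fun p => p.2.1.δ₂₂) h
    have h6 : ε.δ₁₂ = θ.δ₁₂ := LinearMap.ext fun y => by
      have h7 : ε.δ₁₂ (b'.equiv.symm (b'.equiv y)) - t'.map (β (b'.equiv.symm (b'.equiv y))) =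
        θ.δ₁₂ (b'.equiv.symm (b'.equiv y)) - t'.map (β (b'.equiv.symm (b'.equiv y))) :=
        LinearMap.congr_fun h4 (b'.equiv y)
      rw [LinearEquiv.symm_apply_apply] at h7
      exact sub_left_injective h7
    obtain rfl : ε = θ := Extension.ext (hδε.symm.trans hηθ) h6 h5
    rfl
  · rintro ⟨δ, ε, B, hB⟩
    obtain ⟨b, β, hβ, b', rfl⟩ := B.exists_eq_block
    have h1 : ∀ q : V × Y, b.equiv (t.dTgt.map q.1 + δ.δ₂₂ q.2) + β (s.dTgt.map q.2) =
        t'.dSrc.map (b.equiv q.1 + β q.2) + ε.δ₁₁ (b'.equiv q.2) := fun q =>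
      congrArg Prod.fst (hB.apply q)
    have hb : b.Intertwines t.dTgt t'.dSrc := LinearMap.ext fun v => by
      simpa using h1 (v, 0)
    have hb' : b'.Intertwines s.dTgt s'.dSrc := LinearMap.ext fun y =>
      congrArg Prod.snd (hB.apply ((0, y) : V × Y))
    have h3 : ∀ y, b.equiv (δ.δ₂₂ y) + β (s.dTgt.map y) =
        t'.dSrc.map (β y) + ε.δ₁₁ (b'.equiv y) := fun y => by simpa using h1 (0, y)
    let η : Extension (t'.along b hb) (s'.along b' hb') :=
      { δ₁₁ := δ.δ₂₂
        δ₁₂ := ε.δ₁₂ ∘ₗ b'.map + t'.map ∘ₗ β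
        δ₂₂ := ε.δ₂₂
        mem₁₁ := δ.mem₂₂
        mem₁₂ := add_mem (homDeg_comp b'.mem_homDeg ε.mem₁₂ (zero_add 0))
          (homDeg_comp hβ t'.isQuasiIso.mem_homDeg (zero_add 0))
        mem₂₂ := ε.mem₂₂
        eq₁₁ := δ.eq₂₂
        eq₂₂ := ε.eq₂₂
        eq₁₂ := LinearMap.ext fun y => by
          change ε.δ₁₂ (b'.equiv (s.dTgt.map y)) + t'.map (β (s.dTgt.map y)) +
              t'.map (b.equiv (δ.δ₂₂ y)) =
            t'.dTgt.map (ε.δ₁₂ (b'.equiv y) + t'.map (β y)) + ε.δ₂₂ (s'.map (b'.equiv y))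
          have e1 := congrArg t'.map (h3 y)
          have e2 := ε.apply₁₂ (b'.equiv y)
          have e3 := t'.map_comm (β y)
          simp only [map_add] at e1
          rw [hb'.apply, map_add]
          linear_combination (norm := abel) e1 + e2 + e3 }
    refine ⟨⟨⟨b, hb⟩, ⟨b', hb'⟩, ⟨β, hβ⟩, ⟨(δ, η), rfl⟩⟩, CompTensorIndex.ext rfl
      (Extension.ext (LinearMap.ext fun y => ?_) (LinearMap.ext fun y => ?_) rfl) rfl⟩
    · obtain ⟨y, rfl⟩ := b'.equiv.surjective y
      change b.equiv (δ.δ₂₂ (b'.equiv.symm (b'.equiv y))) +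
        β (s.dTgt.map (b'.equiv.symm (b'.equiv y))) -
          t'.dSrc.map (β (b'.equiv.symm (b'.equiv y))) = ε.δ₁₁ (b'.equiv y)
      rw [LinearEquiv.symm_apply_apply]
      linear_combination (norm := abel) h3 y
    · obtain ⟨y, rfl⟩ := b'.equiv.surjective y
      change ε.δ₁₂ (b'.equiv (b'.equiv.symm (b'.equiv y))) +
        t'.map (β (b'.equiv.symm (b'.equiv y))) -
          t'.map (β (b'.equiv.symm (b'.equiv y))) = ε.δ₁₂ (b'.equiv y)
      rw [LinearEquiv.symm_apply_apply, add_sub_cancel_right]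

variable [Finite k]

/-- The sum defining the composite of two products, compared with the sum defining the product of
two composites. The factor `|Hom^0(Y, V)|` counts the off-diagonal blocks of automorphisms of
`V ⊕ Y`. -/
theorem finsum_compTensor (t : Triple U V) (t' : Triple V W) (s : Triple X Y)
    (s' : Triple Y Z) :
    ∑ᶠ δ : Extension t s, ∑ᶠ ε : Extension t' s',
      ∑ᶠ B : {B : FlagIso (V.prod Y) (V.prod Y) //
        B.Intertwines δ.triple.dTgt ε.triple.dSrc}, (δ.triple.compAlong ε.triple B).basis =
    (homCard Y V 0 * pairCoeff V W X Y) •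
      ∑ᶠ b : {b : FlagIso V V // b.Intertwines t.dTgt t'.dSrc},
      ∑ᶠ b' : {b : FlagIso Y Y // b.Intertwines s.dTgt s'.dSrc},
      ∑ᶠ γ : Extension (t.compAlong t' b) (s.compAlong s' b'), γ.triple.basis := by
  conv_lhs => simp only [← finsum_sigma_of_finite]
  rw [← finsum_eq_of_bijective _ TensorCompIndex.toCompTensor_bijective
    fun p : TensorCompIndex t t' s s' => congrArg Triple.basis p.compAlong_eq]
  have h : ∀ (b : {b : FlagIso V V // b.Intertwines t.dTgt t'.dSrc})
      (b' : {b : FlagIso Y Y // b.Intertwines s.dTgt s'.dSrc}),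
      ∑ᶠ q : homDeg Y V 0 × ExtensionPair t (t'.along b.1 b.2) s (s'.along b'.1 b'.2),
        (q.2.1.1.seq q.2.1.2 rfl rfl q.2.2).triple.basis =
      (homCard Y V 0 * pairCoeff V W X Y) •
        ∑ᶠ γ : Extension (t.compAlong t' b) (s.compAlong s' b'), γ.triple.basis := fun b b' => by
    rw [finsum_prod_of_finite (fun (_ : homDeg Y V 0)
        (p : ExtensionPair t (t'.along b.1 b.2) s (s'.along b'.1 b'.2)) =>
        (p.1.1.seq p.1.2 rfl rfl p.2).triple.basis), finsum_const_of_finite]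
    refine (congrArg _ (finsum_extensionPair (t' := t'.along b.1 b.2) (s' := s'.along b'.1 b'.2)
      rfl rfl)).trans ?_
    rw [smul_smul]
    rfl
  simp only [smul_finsum] at h ⊢
  refine (finsum_sigma_of_finite (fun (b : {b : FlagIso V V //
      b.Intertwines t.dTgt t'.dSrc}) (r : Σ b' : {b : FlagIso Y Y //
      b.Intertwines s.dTgt s'.dSrc},
    homDeg Y V 0 × ExtensionPair t (t'.along b.1 b.2) s (s'.along b'.1 b'.2)) =>
      (r.2.2.1.1.seq r.2.2.1.2 rfl rfl r.2.2.2).triple.basis)).trans (finsum_congr fun b => ?_)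
  exact (finsum_sigma_of_finite (fun (b' : {b : FlagIso Y Y //
    b.Intertwines s.dTgt s'.dSrc}) (q : homDeg Y V 0 ×
    ExtensionPair t (t'.along b.1 b.2) s (s'.along b'.1 b'.2)) =>
      (q.2.1.1.seq q.2.1.2 rfl rfl q.2.2).triple.basis)).trans (finsum_congr fun b' => h b b')

/-- The interchange law for triples. After the reindexing only an identity between the constants is
left. -/
theorem Triple.interchange (t : Triple U V) (t' : Triple V W) (s : Triple X Y)
    (s' : Triple Y Z) :
    hComp k (U.prod X) (V.prod Y) (W.prod Z) (t.tensor s) (t'.tensor s') =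
      hTensor k U W X Z (t.comp t') (s.comp s') := by
  simp only [Triple.tensor_eq, Triple.comp_eq t, Triple.comp_eq s, map_smul,
    LinearMap.smul_apply]
  rw [map_finsum_left_of_finite, map_finsum_left_of_finite]
  simp only [map_finsum_of_finite, hComp_basis, hTensor_basis, Triple.comp_eq, Triple.tensor_eq,
    ← smul_finsum]
  rw [finsum_compTensor, smul_smul, smul_smul, smul_smul, smul_smul, smul_smul]
  congr 1
  rw [compCoeff_eq, compCoeff_eq, compCoeff_eq, tensorCoeff_eq, tensorCoeff_eq, tensorCoeff_eq,
    lowerEuler_prod, lowerCard_prod, pairCoeff]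
  have h1 := homCard_ne_zero X W 0
  have h2 := homCard_ne_zero Y V 0
  have h3 := homCard_ne_zero X V 0
  have h4 := homCard_ne_zero Y W 0
  have h5 := euler_ne_zero X W
  have h6 := euler_ne_zero Y V
  have h7 := euler_ne_zero Y W
  have h8 := euler_ne_zero X V
  have h9 := euler_ne_zero X U
  have h10 := euler_ne_zero Z W
  have h11 := lowerCard_ne_zero V 0
  have h12 := lowerCard_ne_zero Y 0
  field_simp

/-- The interchange law. -/
theorem hTensor_hComp (a : HHom U V) (a' : HHom V W) (b : HHom X Y) (b' : HHom Y Z) :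
    hComp k (U.prod X) (V.prod Y) (W.prod Z) (hTensor k U V X Y a b) (hTensor k V W Y Z a' b') =
      hTensor k U W X Z (hComp k U V W a a') (hComp k X Y Z b b') := by
  induction a using HHom.induction with
  | zero => simp
  | add a c h h' => simp [h, h']
  | smul r a h => simp [h]
  | basis t =>
    induction a' using HHom.induction with
    | zero => simp
    | add a c h h' => simp [h, h']
    | smul r a h => simp [h]
    | basis t' =>
      induction b using HHom.induction with
      | zero => simp
      | add a c h h' => simp [h, h']
      | smul r a h => simp [h]
      | basis s =>
        induction b' using HHom.induction with
        | zero => simp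
        | add a c h h' => simp [h, h']
        | smul r a h => simp [h]
        | basis s' =>
          rw [hTensor_basis, hTensor_basis, hComp_basis, hComp_basis, Triple.interchange]

end

/-! ### Naturality of the associator -/

section

variable {k : Type u} [Field k] {U₁ U₂ U₃ V₁ V₂ V₃ : FlagSpace.{u, v} k}
  {t₁ : Triple U₁ V₁} {t₂ : Triple U₂ V₂} {t₃ : Triple U₃ V₃}

/-- The index type of the product `(t₁ ⊗ t₂) ⊗ t₃`. -/
abbrev TensorLeftIndex (t₁ : Triple U₁ V₁) (t₂ : Triple U₂ V₂) (t₃ : Triple U₃ V₃) :=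
  Σ δ : Extension t₁ t₂, Extension δ.triple t₃

/-- The index type of the product `t₁ ⊗ (t₂ ⊗ t₃)`. -/
abbrev TensorRightIndex (t₁ : Triple U₁ V₁) (t₂ : Triple U₂ V₂) (t₃ : Triple U₃ V₃) :=
  Σ δ : Extension t₂ t₃, Extension t₁ δ.triple

theorem TensorLeftIndex.ext {p q : TensorLeftIndex t₁ t₂ t₃} (h : p.1 = q.1)
    (h₁₁ : p.2.δ₁₁ = q.2.δ₁₁) (h₁₂ : p.2.δ₁₂ = q.2.δ₁₂) (h₂₂ : p.2.δ₂₂ = q.2.δ₂₂) : p = q := by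
  obtain ⟨δ, ε⟩ := p
  obtain ⟨δ', ε'⟩ := q
  obtain rfl : δ = δ' := h
  obtain rfl : ε = ε' := Extension.ext h₁₁ h₁₂ h₂₂
  rfl

theorem TensorRightIndex.ext {p q : TensorRightIndex t₁ t₂ t₃} (h : p.1 = q.1)
    (h₁₁ : p.2.δ₁₁ = q.2.δ₁₁) (h₁₂ : p.2.δ₁₂ = q.2.δ₁₂) (h₂₂ : p.2.δ₂₂ = q.2.δ₂₂) : p = q := by
  obtain ⟨δ, ε⟩ := p
  obtain ⟨δ', ε'⟩ := q
  obtain rfl : δ = δ' := h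
  obtain rfl : ε = ε' := Extension.ext h₁₁ h₁₂ h₂₂
  rfl

/-- The lower right `2 × 2` block of an upper triangular `3 × 3` extension. -/
def TensorLeftIndex.lower (p : TensorLeftIndex t₁ t₂ t₃) : Extension t₂ t₃ where
  δ₁₁ := LinearMap.snd k U₁ U₂ ∘ₗ p.2.δ₁₁
  δ₁₂ := LinearMap.snd k V₁ V₂ ∘ₗ p.2.δ₁₂
  δ₂₂ := LinearMap.snd k V₁ V₂ ∘ₗ p.2.δ₂₂
  mem₁₁ i x hx := (p.2.mem₁₁ i x hx).2
  mem₁₂ i x hx := (p.2.mem₁₂ i x hx).2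
  mem₂₂ i x hx := (p.2.mem₂₂ i x hx).2
  eq₁₁ := LinearMap.ext fun x => congrArg Prod.snd (p.2.apply₁₁ x)
  eq₂₂ := LinearMap.ext fun x => congrArg Prod.snd (p.2.apply₂₂ x)
  eq₁₂ := LinearMap.ext fun x => congrArg Prod.snd (p.2.apply₁₂ x)

/-- The first row of an upper triangular `3 × 3` extension. -/
def TensorLeftIndex.row (p : TensorLeftIndex t₁ t₂ t₃) : Extension t₁ p.lower.triple where
  δ₁₁ := p.1.δ₁₁.coprod (LinearMap.fst k U₁ U₂ ∘ₗ p.2.δ₁₁)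
  δ₁₂ := p.1.δ₁₂.coprod (LinearMap.fst k V₁ V₂ ∘ₗ p.2.δ₁₂)
  δ₂₂ := p.1.δ₂₂.coprod (LinearMap.fst k V₁ V₂ ∘ₗ p.2.δ₂₂)
  mem₁₁ i x hx := add_mem (p.1.mem₁₁ i _ hx.1) (p.2.mem₁₁ i _ hx.2).1
  mem₁₂ i x hx := add_mem (p.1.mem₁₂ i _ hx.1) (p.2.mem₁₂ i _ hx.2).1
  mem₂₂ i x hx := add_mem (p.1.mem₂₂ i _ hx.1) (p.2.mem₂₂ i _ hx.2).1
  eq₁₁ := by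
    obtain ⟨δ, ε⟩ := p
    have key : ∀ x : U₂ × U₃, t₁.dSrc.map (δ.δ₁₁ x.1 + (ε.δ₁₁ x.2).1) +
        (δ.δ₁₁ (t₂.dSrc.map x.1 + (ε.δ₁₁ x.2).2) + (ε.δ₁₁ (t₃.dSrc.map x.2)).1) = 0 := fun x => by
      have e1 := δ.apply₁₁ x.1
      have e2 : t₁.dSrc.map (ε.δ₁₁ x.2).1 + δ.δ₁₁ (ε.δ₁₁ x.2).2 + (ε.δ₁₁ (t₃.dSrc.map x.2)).1 = 0 :=
        congrArg Prod.fst (ε.apply₁₁ x.2)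
      rw [map_add, map_add]
      linear_combination (norm := abel) e1 + e2
    exact LinearMap.ext key
  eq₂₂ := by
    obtain ⟨δ, ε⟩ := p
    have key : ∀ x : V₂ × V₃, t₁.dTgt.map (δ.δ₂₂ x.1 + (ε.δ₂₂ x.2).1) +
        (δ.δ₂₂ (t₂.dTgt.map x.1 + (ε.δ₂₂ x.2).2) + (ε.δ₂₂ (t₃.dTgt.map x.2)).1) = 0 := fun x => by
      have e1 := δ.apply₂₂ x.1
      have e2 : t₁.dTgt.map (ε.δ₂₂ x.2).1 + δ.δ₂₂ (ε.δ₂₂ x.2).2 + (ε.δ₂₂ (t₃.dTgt.map x.2)).1 = 0 :=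
        congrArg Prod.fst (ε.apply₂₂ x.2)
      rw [map_add, map_add]
      linear_combination (norm := abel) e1 + e2
    exact LinearMap.ext key
  eq₁₂ := by
    obtain ⟨δ, ε⟩ := p
    have key : ∀ x : U₂ × U₃, δ.δ₁₂ (t₂.dSrc.map x.1 + (ε.δ₁₁ x.2).2) +
          (ε.δ₁₂ (t₃.dSrc.map x.2)).1 + t₁.map (δ.δ₁₁ x.1 + (ε.δ₁₁ x.2).1) =
        t₁.dTgt.map (δ.δ₁₂ x.1 + (ε.δ₁₂ x.2).1) +
          (δ.δ₂₂ (t₂.map x.1 + (ε.δ₁₂ x.2).2) + (ε.δ₂₂ (t₃.map x.2)).1) := fun x => by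
      have e1 := δ.apply₁₂ x.1
      have e2 : (ε.δ₁₂ (t₃.dSrc.map x.2)).1 + (t₁.map (ε.δ₁₁ x.2).1 + δ.δ₁₂ (ε.δ₁₁ x.2).2) =
          t₁.dTgt.map (ε.δ₁₂ x.2).1 + δ.δ₂₂ (ε.δ₁₂ x.2).2 + (ε.δ₂₂ (t₃.map x.2)).1 :=
        congrArg Prod.fst (ε.apply₁₂ x.2)
      simp only [map_add]
      linear_combination (norm := abel) e1 + e2
    exact LinearMap.ext key

/-- The upper left `2 × 2` block of an upper triangular `3 × 3` extension. -/
def TensorRightIndex.upper (p : TensorRightIndex t₁ t₂ t₃) : Extension t₁ t₂ where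
  δ₁₁ := p.2.δ₁₁ ∘ₗ LinearMap.inl k U₂ U₃
  δ₁₂ := p.2.δ₁₂ ∘ₗ LinearMap.inl k U₂ U₃
  δ₂₂ := p.2.δ₂₂ ∘ₗ LinearMap.inl k V₂ V₃
  mem₁₁ i x hx := p.2.mem₁₁ i ((x, 0) : U₂ × U₃) ⟨hx, zero_mem _⟩
  mem₁₂ i x hx := p.2.mem₁₂ i ((x, 0) : U₂ × U₃) ⟨hx, zero_mem _⟩
  mem₂₂ i x hx := p.2.mem₂₂ i ((x, 0) : V₂ × V₃) ⟨hx, zero_mem _⟩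
  eq₁₁ := LinearMap.ext fun x => by
    have h : t₁.dSrc.map (p.2.δ₁₁ ((x, 0) : U₂ × U₃)) +
        p.2.δ₁₁ ((t₂.dSrc.map x + p.1.δ₁₁ 0, t₃.dSrc.map 0) : U₂ × U₃) = 0 :=
      p.2.apply₁₁ ((x, 0) : U₂ × U₃)
    rwa [map_zero, map_zero, add_zero] at h
  eq₂₂ := LinearMap.ext fun x => by
    have h : t₁.dTgt.map (p.2.δ₂₂ ((x, 0) : V₂ × V₃)) +
        p.2.δ₂₂ ((t₂.dTgt.map x + p.1.δ₂₂ 0, t₃.dTgt.map 0) : V₂ × V₃) = 0 :=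
      p.2.apply₂₂ ((x, 0) : V₂ × V₃)
    rwa [map_zero, map_zero, add_zero] at h
  eq₁₂ := LinearMap.ext fun x => by
    have h : p.2.δ₁₂ ((t₂.dSrc.map x + p.1.δ₁₁ 0, t₃.dSrc.map 0) : U₂ × U₃) +
        t₁.map (p.2.δ₁₁ ((x, 0) : U₂ × U₃)) = t₁.dTgt.map (p.2.δ₁₂ ((x, 0) : U₂ × U₃)) +
        p.2.δ₂₂ ((t₂.map x + p.1.δ₁₂ 0, t₃.map 0) : V₂ × V₃) :=
      p.2.apply₁₂ ((x, 0) : U₂ × U₃)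
    rwa [map_zero, map_zero, map_zero, map_zero, add_zero, add_zero] at h

/-- The last column of an upper triangular `3 × 3` extension. -/
def TensorRightIndex.column (p : TensorRightIndex t₁ t₂ t₃) : Extension p.upper.triple t₃ where
  δ₁₁ := (p.2.δ₁₁ ∘ₗ LinearMap.inr k U₂ U₃).prod p.1.δ₁₁
  δ₁₂ := (p.2.δ₁₂ ∘ₗ LinearMap.inr k U₂ U₃).prod p.1.δ₁₂
  δ₂₂ := (p.2.δ₂₂ ∘ₗ LinearMap.inr k V₂ V₃).prod p.1.δ₂₂
  mem₁₁ i x hx := ⟨p.2.mem₁₁ i ((0, x) : U₂ × U₃) ⟨zero_mem _, hx⟩, p.1.mem₁₁ i x hx⟩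
  mem₁₂ i x hx := ⟨p.2.mem₁₂ i ((0, x) : U₂ × U₃) ⟨zero_mem _, hx⟩, p.1.mem₁₂ i x hx⟩
  mem₂₂ i x hx := ⟨p.2.mem₂₂ i ((0, x) : V₂ × V₃) ⟨zero_mem _, hx⟩, p.1.mem₂₂ i x hx⟩
  eq₁₁ := LinearMap.ext fun x => Prod.ext (by
    have h : t₁.dSrc.map (p.2.δ₁₁ ((0, x) : U₂ × U₃)) +
        p.2.δ₁₁ ((t₂.dSrc.map 0 + p.1.δ₁₁ x, t₃.dSrc.map x) : U₂ × U₃) = 0 :=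
      p.2.apply₁₁ ((0, x) : U₂ × U₃)
    change t₁.dSrc.map (p.2.δ₁₁ ((0, x) : U₂ × U₃)) + p.2.δ₁₁ ((p.1.δ₁₁ x, 0) : U₂ × U₃) +
      p.2.δ₁₁ ((0, t₃.dSrc.map x) : U₂ × U₃) = 0
    rw [add_assoc]
    refine Eq.trans (congrArg _ ?_) h
    refine ((map_add p.2.δ₁₁ _ _).symm.trans (congrArg p.2.δ₁₁ (Prod.ext ?_ ?_)))
    · change p.1.δ₁₁ x + 0 = t₂.dSrc.map 0 + p.1.δ₁₁ x
      rw [map_zero, add_comm]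
    · exact zero_add _) (p.1.apply₁₁ x)
  eq₂₂ := LinearMap.ext fun x => Prod.ext (by
    have h : t₁.dTgt.map (p.2.δ₂₂ ((0, x) : V₂ × V₃)) +
        p.2.δ₂₂ ((t₂.dTgt.map 0 + p.1.δ₂₂ x, t₃.dTgt.map x) : V₂ × V₃) = 0 :=
      p.2.apply₂₂ ((0, x) : V₂ × V₃)
    change t₁.dTgt.map (p.2.δ₂₂ ((0, x) : V₂ × V₃)) + p.2.δ₂₂ ((p.1.δ₂₂ x, 0) : V₂ × V₃) +
      p.2.δ₂₂ ((0, t₃.dTgt.map x) : V₂ × V₃) = 0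
    rw [add_assoc]
    refine Eq.trans (congrArg _ ?_) h
    refine ((map_add p.2.δ₂₂ _ _).symm.trans (congrArg p.2.δ₂₂ (Prod.ext ?_ ?_)))
    · change p.1.δ₂₂ x + 0 = t₂.dTgt.map 0 + p.1.δ₂₂ x
      rw [map_zero, add_comm]
    · exact zero_add _) (p.1.apply₂₂ x)
  eq₁₂ := LinearMap.ext fun x => Prod.ext (by
    have h : p.2.δ₁₂ ((t₂.dSrc.map 0 + p.1.δ₁₁ x, t₃.dSrc.map x) : U₂ × U₃) +
        t₁.map (p.2.δ₁₁ ((0, x) : U₂ × U₃)) = t₁.dTgt.map (p.2.δ₁₂ ((0, x) : U₂ × U₃)) +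
        p.2.δ₂₂ ((t₂.map 0 + p.1.δ₁₂ x, t₃.map x) : V₂ × V₃) :=
      p.2.apply₁₂ ((0, x) : U₂ × U₃)
    have h1 : p.2.δ₁₂ ((t₂.dSrc.map 0 + p.1.δ₁₁ x, t₃.dSrc.map x) : U₂ × U₃) =
        p.2.δ₁₂ ((p.1.δ₁₁ x, 0) : U₂ × U₃) + p.2.δ₁₂ ((0, t₃.dSrc.map x) : U₂ × U₃) := by
      refine (congrArg p.2.δ₁₂ (Prod.ext ?_ ?_)).trans (map_add p.2.δ₁₂ _ _)
      · change t₂.dSrc.map 0 + p.1.δ₁₁ x = p.1.δ₁₁ x + 0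
        rw [map_zero, add_comm]
      · exact (zero_add _).symm
    have h2 : p.2.δ₂₂ ((t₂.map 0 + p.1.δ₁₂ x, t₃.map x) : V₂ × V₃) =
        p.2.δ₂₂ ((p.1.δ₁₂ x, 0) : V₂ × V₃) + p.2.δ₂₂ ((0, t₃.map x) : V₂ × V₃) := by
      refine (congrArg p.2.δ₂₂ (Prod.ext ?_ ?_)).trans (map_add p.2.δ₂₂ _ _)
      · change t₂.map 0 + p.1.δ₁₂ x = p.1.δ₁₂ x + 0
        rw [map_zero, add_comm]
      · exact (zero_add _).symm
    rw [h1, h2] at h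
    change p.2.δ₁₂ ((0, t₃.dSrc.map x) : U₂ × U₃) + (t₁.map (p.2.δ₁₁ ((0, x) : U₂ × U₃)) +
        p.2.δ₁₂ ((p.1.δ₁₁ x, 0) : U₂ × U₃)) =
      t₁.dTgt.map (p.2.δ₁₂ ((0, x) : U₂ × U₃)) + p.2.δ₂₂ ((p.1.δ₁₂ x, 0) : V₂ × V₃) +
        p.2.δ₂₂ ((0, t₃.map x) : V₂ × V₃)
    linear_combination (norm := abel) h) (p.1.apply₁₂ x)

theorem apply_inl_add_apply_inr {U X Y : FlagSpace.{u, v} k} (f : (X.prod Y) →ₗ[k] U)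
    (x : X × Y) :
    f ((x.1, 0) : X × Y) + f ((0, x.2) : X × Y) = f x := by
  refine (map_add f _ _).symm.trans (congrArg f (Prod.ext ?_ ?_))
  · exact add_zero _
  · exact zero_add _

/-- Both iterated products are indexed by the upper triangular `3 × 3` block matrices with the
given diagonal. -/
def tensorIndexAssoc (t₁ : Triple U₁ V₁) (t₂ : Triple U₂ V₂) (t₃ : Triple U₃ V₃) :
    TensorLeftIndex t₁ t₂ t₃ ≃ TensorRightIndex t₁ t₂ t₃ where
  toFun p := ⟨p.lower, p.row⟩
  invFun p := ⟨p.upper, p.column⟩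
  left_inv p := TensorLeftIndex.ext
    (Extension.ext (LinearMap.coprod_inl _ _) (LinearMap.coprod_inl _ _)
      (LinearMap.coprod_inl _ _))
    (LinearMap.ext fun x => Prod.ext (by
      change p.1.δ₁₁ 0 + (p.2.δ₁₁ x).1 = (p.2.δ₁₁ x).1
      rw [map_zero, zero_add]) rfl)
    (LinearMap.ext fun x => Prod.ext (by
      change p.1.δ₁₂ 0 + (p.2.δ₁₂ x).1 = (p.2.δ₁₂ x).1
      rw [map_zero, zero_add]) rfl)
    (LinearMap.ext fun x => Prod.ext (by
      change p.1.δ₂₂ 0 + (p.2.δ₂₂ x).1 = (p.2.δ₂₂ x).1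
      rw [map_zero, zero_add]) rfl)
  right_inv p := TensorRightIndex.ext rfl
    (LinearMap.ext fun x => apply_inl_add_apply_inr p.2.δ₁₁ x)
    (LinearMap.ext fun x => apply_inl_add_apply_inr p.2.δ₁₂ x)
    (LinearMap.ext fun x => apply_inl_add_apply_inr p.2.δ₂₂ x)

theorem post_assoc_eq_pre_assoc (p : TensorLeftIndex t₁ t₂ t₃) :
    p.2.triple.post (FlagIso.assoc V₁ V₂ V₃) =
      (tensorIndexAssoc t₁ t₂ t₃ p).2.triple.pre (FlagIso.assoc U₁ U₂ U₃) := by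
  obtain ⟨δ, ε⟩ := p
  refine Triple.ext ?_ ?_ ?_
  · refine FlagDifferential.ext ?_
    have key : ∀ x : (U₁ × U₂) × U₃,
        ((t₁.dSrc.map x.1.1 + δ.δ₁₁ x.1.2 + (ε.δ₁₁ x.2).1,
          t₂.dSrc.map x.1.2 + (ε.δ₁₁ x.2).2), t₃.dSrc.map x.2) =
        ((t₁.dSrc.map x.1.1 + (δ.δ₁₁ x.1.2 + (ε.δ₁₁ x.2).1),
          t₂.dSrc.map x.1.2 + (ε.δ₁₁ x.2).2), t₃.dSrc.map x.2) := fun x => by rw [add_assoc]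
    exact LinearMap.ext key
  · have key : ∀ x : (U₁ × U₂) × U₃,
        (t₁.map x.1.1 + δ.δ₁₂ x.1.2 + (ε.δ₁₂ x.2).1, t₂.map x.1.2 + (ε.δ₁₂ x.2).2, t₃.map x.2) =
        (t₁.map x.1.1 + (δ.δ₁₂ x.1.2 + (ε.δ₁₂ x.2).1), t₂.map x.1.2 + (ε.δ₁₂ x.2).2,
          t₃.map x.2) := fun x => by rw [add_assoc]
    exact LinearMap.ext key
  · refine FlagDifferential.ext ?_
    have key : ∀ x : V₁ × V₂ × V₃,
        (t₁.dTgt.map x.1 + δ.δ₂₂ x.2.1 + (ε.δ₂₂ x.2.2).1,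
          t₂.dTgt.map x.2.1 + (ε.δ₂₂ x.2.2).2, t₃.dTgt.map x.2.2) =
        (t₁.dTgt.map x.1 + (δ.δ₂₂ x.2.1 + (ε.δ₂₂ x.2.2).1),
          t₂.dTgt.map x.2.1 + (ε.δ₂₂ x.2.2).2, t₃.dTgt.map x.2.2) := fun x => by rw [add_assoc]
    exact LinearMap.ext key

variable [Finite k]

theorem Triple.associator_naturality (t₁ : Triple U₁ V₁) (t₂ : Triple U₂ V₂)
    (t₃ : Triple U₃ V₃) :
    hComp k _ _ _ (hTensor k (U₁.prod U₂) (V₁.prod V₂) U₃ V₃ (t₁.tensor t₂) t₃.basis)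
        (FlagIso.assoc V₁ V₂ V₃).hom =
      hComp k _ _ _ (FlagIso.assoc U₁ U₂ U₃).hom
        (hTensor k U₁ V₁ (U₂.prod U₃) (V₂.prod V₃) t₁.basis (t₂.tensor t₃)) := by
  simp only [Triple.tensor_eq, map_smul, LinearMap.smul_apply]
  simp only [map_finsum_left_of_finite]
  simp only [hTensor_basis, Triple.tensor_eq, ← smul_finsum, map_smul, LinearMap.smul_apply]
  simp only [map_finsum_left_of_finite]
  simp only [map_finsum_of_finite, hTensor_basis, Triple.tensor_eq, ← smul_finsum, map_smul,
    hComp_hom, hom_hComp]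
  have h : ∑ᶠ (δ : Extension t₁ t₂), ∑ᶠ (ε : Extension δ.triple t₃),
        (ε.triple.post (FlagIso.assoc V₁ V₂ V₃)).basis =
      ∑ᶠ (δ : Extension t₂ t₃), ∑ᶠ (ε : Extension t₁ δ.triple),
        (ε.triple.pre (FlagIso.assoc U₁ U₂ U₃)).basis := by
    simp only [← finsum_sigma_of_finite]
    exact finsum_eq_of_bijective _ (tensorIndexAssoc t₁ t₂ t₃).bijective
      fun p => congrArg Triple.basis (post_assoc_eq_pre_assoc p)
  rw [h, smul_smul, smul_smul]
  congr 1
  rw [tensorCoeff_eq, tensorCoeff_eq, tensorCoeff_eq, tensorCoeff_eq]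
  simp only [euler_prod_left, euler_prod_right, homCard_prod_left, homCard_prod_right]
  have h1 := euler_ne_zero U₂ U₁
  have h2 := euler_ne_zero U₃ U₁
  have h3 := euler_ne_zero U₃ U₂
  have h4 := euler_ne_zero V₂ V₁
  have h5 := euler_ne_zero V₃ V₁
  have h6 := euler_ne_zero V₃ V₂
  have h7 := homCard_ne_zero U₂ V₁ 0
  have h8 := homCard_ne_zero U₃ V₁ 0
  have h9 := homCard_ne_zero U₃ V₂ 0
  field_simp

theorem associator_naturality (a : HHom U₁ V₁) (b : HHom U₂ V₂) (c : HHom U₃ V₃) :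
    hComp k _ _ _ (hTensor k (U₁.prod U₂) (V₁.prod V₂) U₃ V₃ (hTensor k U₁ V₁ U₂ V₂ a b) c)
        (FlagIso.assoc V₁ V₂ V₃).hom =
      hComp k _ _ _ (FlagIso.assoc U₁ U₂ U₃).hom
        (hTensor k U₁ V₁ (U₂.prod U₃) (V₂.prod V₃) a (hTensor k U₂ V₂ U₃ V₃ b c)) := by
  induction a using HHom.induction with
  | zero => simp
  | add a c h h' => simp [h, h']
  | smul r a h => simp [h]
  | basis t₁ =>
    induction b using HHom.induction with
    | zero => simp
    | add a c h h' => simp [h, h']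
    | smul r a h => simp [h]
    | basis t₂ =>
      induction c using HHom.induction with
      | zero => simp
      | add a c h h' => simp [h, h']
      | smul r a h => simp [h]
      | basis t₃ => rw [hTensor_basis, hTensor_basis, Triple.associator_naturality]

end

/-! ### Naturality of the unitors -/

section

variable {k : Type u} [Field k] {U V X Y : FlagSpace.{u, v} k}

instance : Subsingleton (FlagSpace.zero.{u, v} k) := inferInstanceAs (Subsingleton PUnit)

instance : Unique (FlagDifferential (FlagSpace.zero.{u, v} k)) where
  default := ⟨0, zero_mem _, LinearMap.zero_comp _⟩
  uniq _ := FlagDifferential.ext (Subsingleton.elim _ _)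

theorem lowerEuler_zero : lowerEuler (FlagSpace.zero.{u, v} k) = 1 := by
  have h : ∀ n, lowerCard (FlagSpace.zero.{u, v} k) n = 1 := fun n => by
    rw [lowerCard, Nat.card_unique, Nat.cast_one]
  simp [lowerEuler, h, altProd]

theorem hId_zero : hId (FlagSpace.zero.{u, v} k) = (idTriple default).basis := by
  have h : (FlagSpace.zero.{u, v} k).dim = 0 := Module.finrank_zero_of_subsingleton
  rw [hId, idCoeff_eq, lowerEuler_zero, h, pow_zero, mul_one, inv_one, one_smul, finsum_unique]

/-- If the off-diagonal blocks live in zero spaces, there is exactly one extension. -/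
instance (t : Triple U V) (s : Triple X Y) [Subsingleton (X →ₗ[k] U)]
    [Subsingleton (X →ₗ[k] V)] [Subsingleton (Y →ₗ[k] V)] : Unique (Extension t s) where
  default := ⟨0, 0, 0, zero_mem _, zero_mem _, zero_mem _, Subsingleton.elim _ _,
    Subsingleton.elim _ _, Subsingleton.elim _ _⟩
  uniq _ := Extension.ext (Subsingleton.elim _ _) (Subsingleton.elim _ _) (Subsingleton.elim _ _)

theorem Triple.tensor_of_subsingleton (t : Triple U V) (s : Triple X Y)
    [Subsingleton (X →ₗ[k] U)] [Subsingleton (X →ₗ[k] V)] [Subsingleton (Y →ₗ[k] V)] :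
    t.tensor s = (default : Extension t s).triple.basis := by
  have h : tensorCoeff U V X Y = 1 := by simp [tensorCoeff]
  rw [Triple.tensor_eq, h, one_smul, finsum_unique]

variable [Finite k]

theorem leftUnitor_naturality (a : HHom U V) :
    hComp k _ _ _ (hTensor k _ _ U V (hId (FlagSpace.zero.{u, v} k)) a)
      (FlagIso.leftUnit V).hom = hComp k _ _ _ (FlagIso.leftUnit U).hom a := by
  induction a using HHom.induction with
  | zero => simp
  | add a c h h' => simp [h, h']
  | smul r a h => simp [h]
  | basis t =>
    rw [hId_zero, hTensor_basis, Triple.tensor_of_subsingleton, hComp_hom, hom_hComp]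
    exact congrArg Triple.basis (Triple.ext
      (FlagDifferential.ext (LinearMap.ext fun _ => Prod.ext (Subsingleton.elim _ _) rfl)) rfl rfl)

theorem rightUnitor_naturality (a : HHom U V) :
    hComp k _ _ _ (hTensor k U V _ _ a (hId (FlagSpace.zero.{u, v} k)))
      (FlagIso.rightUnit V).hom = hComp k _ _ _ (FlagIso.rightUnit U).hom a := by
  induction a using HHom.induction with
  | zero => simp
  | add a c h h' => simp [h, h']
  | smul r a h => simp [h]
  | basis t =>
    rw [hId_zero, hTensor_basis, Triple.tensor_of_subsingleton, hComp_hom, hom_hComp]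
    have h1 : ∀ x : U × FlagSpace.zero.{u, v} k, t.dSrc.map x.1 + 0 = t.dSrc.map x.1 :=
      fun x => add_zero _
    refine congrArg Triple.basis (Triple.ext (FlagDifferential.ext
      (LinearMap.ext fun x => Prod.ext (h1 x) (Subsingleton.elim _ _)))
      (LinearMap.ext fun x => ?_) (FlagDifferential.ext (LinearMap.ext fun x => ?_)))
    · exact add_zero (t.map (Prod.fst x))
    · exact add_zero (t.dTgt.map x)

end

/-! ### The monoidal category -/

section

variable {k : Type u} [Field k] {U V W X Y Z : FlagSpace.{u, v} k}

theorem FlagIso.refl_prod_refl (V W : FlagSpace.{u, v} k) :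
    (FlagIso.refl V).prod (FlagIso.refl W) = FlagIso.refl (V.prod W) :=
  FlagIso.ext (LinearEquiv.ext fun _ => rfl)

theorem FlagIso.pentagon (W X Y Z : FlagSpace.{u, v} k) :
    (((FlagIso.assoc W X Y).prod (FlagIso.refl Z)).trans (FlagIso.assoc W (X.prod Y) Z)).trans
        ((FlagIso.refl W).prod (FlagIso.assoc X Y Z)) =
      (FlagIso.assoc (W.prod X) Y Z).trans (FlagIso.assoc W X (Y.prod Z)) :=
  FlagIso.ext (LinearEquiv.ext fun _ => rfl)

theorem FlagIso.triangle (X Y : FlagSpace.{u, v} k) :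
    (FlagIso.assoc X (FlagSpace.zero k) Y).trans
        ((FlagIso.refl X).prod (FlagIso.leftUnit Y)) =
      (FlagIso.rightUnit X).prod (FlagIso.refl Y) :=
  FlagIso.ext (LinearEquiv.ext fun _ => rfl)

end

end

theorem mainTheorem2 (k : Type u) [Field k] [Finite k] :
    ∃ (comp : CompLaw.{u, v} k) (tensor : TensorLaw.{u, v} k),
      (∀ (U V W : FlagSpace.{u, v} k) (t : Triple U V) (s : Triple V W),
        comp U V W t.basis s.basis = t.comp s) ∧
      (∀ (U V X Y : FlagSpace.{u, v} k) (t : Triple U V) (s : Triple X Y),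
        tensor U V X Y t.basis s.basis = t.tensor s) ∧
      ∃ (hc : CategoryLaws comp) (hi : IsoLaws comp)
        (M : @MonoidalCategory (FlagSpace.{u, v} k) (hCategory comp hc)),
        @MonoidalCategory.toMonoidalCategoryStruct _ (hCategory comp hc) M =
          hMonoidalStruct comp tensor hc hi := by
  refine ⟨hComp k, hTensor k, fun U V W t s => hComp_basis t s,
    fun U V X Y t s => hTensor_basis t s, hComp_categoryLaws, hComp_isoLaws, ?_⟩
  let _ := hCategory (hComp k) hComp_categoryLaws
  refine ⟨{
      toMonoidalCategoryStruct :=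
        hMonoidalStruct (hComp k) (hTensor k) hComp_categoryLaws hComp_isoLaws
      tensorHom_def := ?_
      id_tensorHom_id := ?_
      tensorHom_comp_tensorHom := ?_
      whiskerLeft_id := ?_
      id_whiskerRight := ?_
      associator_naturality := ?_
      leftUnitor_naturality := ?_
      rightUnitor_naturality := ?_
      pentagon := ?_
      triangle := ?_ }, rfl⟩
  · intro X₁ Y₁ X₂ Y₂ f g
    exact (by rw [hTensor_hComp, hComp_id, hId_comp] :
      hTensor k _ _ _ _ f g = hComp k _ _ _ (hTensor k X₁ Y₁ X₂ X₂ f (hId X₂))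
        (hTensor k Y₁ Y₁ X₂ Y₂ (hId Y₁) g))
  · intro X₁ X₂
    exact (by rw [hId_eq, hId_eq, hId_eq, hTensor_hom, FlagIso.refl_prod_refl] :
      hTensor k X₁ X₁ X₂ X₂ (hId X₁) (hId X₂) = hId (X₁.prod X₂))
  · intro X₁ Y₁ Z₁ X₂ Y₂ Z₂ f₁ f₂ g₁ g₂
    exact hTensor_hComp f₁ g₁ f₂ g₂
  · intro X Y
    exact (by rw [hId_eq, hId_eq, hId_eq, hTensor_hom, FlagIso.refl_prod_refl] :
      hTensor k X X Y Y (hId X) (hId Y) = hId (X.prod Y))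
  · intro X Y
    exact (by rw [hId_eq, hId_eq, hId_eq, hTensor_hom, FlagIso.refl_prod_refl] :
      hTensor k X X Y Y (hId X) (hId Y) = hId (X.prod Y))
  · intro X₁ X₂ X₃ Y₁ Y₂ Y₃ f₁ f₂ f₃
    exact associator_naturality f₁ f₂ f₃
  · intro X Y f
    exact leftUnitor_naturality f
  · intro X Y f
    exact rightUnitor_naturality f
  · intro W X Y Z
    exact (by
      rw [hId_eq, hId_eq, hTensor_hom, hTensor_hom, FlagIso.hom_trans, FlagIso.hom_trans,
        FlagIso.hom_trans, ← FlagIso.pentagon]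
      rfl :
      hComp k _ _ _ (hTensor k _ _ Z Z (FlagIso.assoc W X Y).hom (hId Z))
          (hComp k _ _ _ (FlagIso.assoc W (X.prod Y) Z).hom
            (hTensor k W W _ _ (hId W) (FlagIso.assoc X Y Z).hom)) =
        hComp k _ _ _ (FlagIso.assoc (W.prod X) Y Z).hom (FlagIso.assoc W X (Y.prod Z)).hom)
  · intro X Y
    exact (by rw [hId_eq, hId_eq, hTensor_hom, hTensor_hom, FlagIso.hom_trans, FlagIso.triangle] :
      hComp k _ _ _ (FlagIso.assoc X (FlagSpace.zero k) Y).hom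
          (hTensor k X X _ _ (hId X) (FlagIso.leftUnit Y).hom) =
        hTensor k _ _ Y Y (FlagIso.rightUnit X).hom (hId Y))
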